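/- **Setting.** Algorithms are randomized (WHILE programs over binary trees with fair coin tosses and unit-cost steps, a model polynomially equivalent to randomized Turing machines); running time means the expected number of steps over the coins, in the worst case over inputs. $\mathcal G(n,\frac12)$ is the uniformly random graph on $n$ labelled vertices, and $\mathcal G(n,\frac12,\kappa)$ is the distribution obtained from it by adding a clique on an independent uniformly random set of $\kappa$ vertices. **Strongish Planted Clique Hypothesis (SPCH).** There is a constant $\delta\in(0,\frac12)$ such that no $n^{o(\log n)}$-time algorithm $\mathcal A$ satisfies, for all sufficiently large $n$, both $$\Pr_{G\sim\mathcal G(n,\frac12,\lceil n^\delta\rceil)}[\mathcal A(G)=1]\ \ge\ \tfrac23\qquad\text{and}\qquad \Pr_{G\sim\mathcal G(n,\frac12)}[\mathcal A(G)=1]\ \le\ \tfrac13,$$ the probabilities being over $G$ and the coins of $\mathcal A$. **Directed Steiner Network.** Given a directed graph with nonnegative integer arc weights (in binary) and a set $\{(s_1,t_1),\dots,(s_k,t_k)\}$ of $k$ demand pairs of vertices, find a set of arcs of smallest total weight in which $t_i$ is reachable from $s_i$ for every $i\in\{1,\dots,k\}$. An algorithm approximates the problem within a factor $g(k)$ if,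 on every instance that has a solution, it outputs with probability at least $2/3$ a solution whose weight is at most $g(k)$ times the minimum, where $k$ is the number of demand pairs of the instance. **Theorem.** Assume SPCH. Let $f:\mathbb N\to\mathbb N$ be any function and let $g:\mathbb N\to\mathbb R$ satisfy $g(k)=o(\sqrt k)$ as $k\to\infty$. Then there is no algorithm that runs in time $f(k)\cdot\mathrm{poly}(n)$, where $n$ is the size of the input, and approximates Directed Steiner Network with $k$ demand pairs within a factor $g(k)$. -/

import Mathlib

open scoped ENNReal

noncomputable section

namespace WhileModel

/-! ### The machine model

Randomized WHILE programs over binary trees (the textbook model in which the basic operations are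
`cons`, `hd`, `tl` and the test for `nil`), with an instruction that tosses a fair coin.  A
program has finitely many variables, each holding (a pointer to) a tree.  A command takes one step;
since the expressions of a program have constant size, this agrees up to a polynomial with the
running time on a Turing machine or a random access machine. -/

/-- Binary trees over the single atom `nil`: the values a program computes with. -/
inductive Data : Type
  | nil : Data
  | cons (l r : Data) : Data

namespace Data

/-- First component; `hd nil = nil`. -/
def hd : Data → Data
  | nil => nil
  | cons l _ => l

/-- Second component; `tl nil = nil`. -/
def tl : Data → Data
  | nil => nil
  | cons _ r => r

/-- The truth value of a tree: only `nil` is false. -/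
def toBool : Data → Bool
  | nil => false
  | cons _ _ => true

/-- The number of leaves of a tree. -/
def size : Data → ℕ
  | nil => 1
  | cons l r => size l + size r

/-- `0` is `nil`, `1` is `cons nil nil`. -/
def ofBool : Bool → Data
  | false => nil
  | true => cons nil nil

/-- Lists as right combs. -/
def ofList : List Data → Data
  | [] => nil
  | a :: l => cons a (ofList l)

/-- Unary numerals, used for the names of vertices. -/
def ofUnary (m : ℕ) : Data := ofList (List.replicate m nil)

/-- Binary numerals (least significant bit first), used for weights. -/
def ofBinary (m : ℕ) : Data := ofList (m.bits.map ofBool)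

/-- An `n × n` matrix as the list of its rows. -/
def ofMatrix {n : ℕ} (M : Fin n → Fin n → Data) : Data :=
  ofList (List.ofFn fun i => ofList (List.ofFn fun j => M i j))

end Data

/-- Expressions. -/
inductive Expr : Type
  | var (x : ℕ) : Expr
  | nil : Expr
  | cons (a b : Expr) : Expr
  | hd (a : Expr) : Expr
  | tl (a : Expr) : Expr

/-- The contents of the variables. -/
abbrev Store : Type := ℕ → Data

/-- The value of an expression. -/
def Expr.eval (s : Store) : Expr → Data
  | .var x => s x
  | .nil => .nil
  | .cons a b => .cons (a.eval s) (b.eval s)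
  | .hd a => (a.eval s).hd
  | .tl a => (a.eval s).tl

/-- Programs. -/
inductive Prog : Type
  | assign (x : ℕ) (e : Expr) : Prog
  | flip (x : ℕ) : Prog
  | seq (p q : Prog) : Prog
  | ite (e : Expr) (p q : Prog) : Prog
  | loop (e : Expr) (p : Prog) : Prog

/-- A configuration: the commands that remain to be executed and the contents of the variables. -/
structure Config : Type where
  todo : List Prog
  store : Store

/-- One step.  `flip x` stores a uniformly random bit in `x`; `loop e p` is `while e do p`. -/
def step : Config → PMF Config
  | ⟨[], s⟩ => PMF.pure ⟨[], s⟩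
  | ⟨.assign x e :: K, s⟩ => PMF.pure ⟨K, Function.update s x (e.eval s)⟩
  | ⟨.flip x :: K, s⟩ =>
      (PMF.uniformOfFintype Bool).map fun b => ⟨K, Function.update s x (Data.ofBool b)⟩
  | ⟨.seq p q :: K, s⟩ => PMF.pure ⟨p :: q :: K, s⟩
  | ⟨.ite e p q :: K, s⟩ => PMF.pure ⟨(if (e.eval s).toBool then p else q) :: K, s⟩
  | ⟨.loop e p :: K, s⟩ =>
      PMF.pure ⟨if (e.eval s).toBool then p :: .loop e p :: K else K, s⟩

/-- The distribution of the configuration after `t` steps. -/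
def runFrom (c : Config) : ℕ → PMF Config
  | 0 => PMF.pure c
  | t + 1 => (runFrom c t).bind step

/-- The start configuration: the input is in variable `0`, all other variables hold `nil`. -/
def init (A : Prog) (x : Data) : Config := ⟨[A], Function.update (fun _ => Data.nil) 0 x⟩

/-- The probability that `A` halts on input `x` with an output (the final content of variable `0`)
in `S`.  The supremum is a limit, as halted configurations do not change. -/
def outputProb (A : Prog) (x : Data) (S : Set Data) : ℝ≥0∞ :=
  ⨆ t : ℕ, (runFrom (init A x) t).toOuterMeasure {c | c.todo = [] ∧ c.store 0 ∈ S}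

/-- The expected number of steps of `A` on input `x`, written as the sum over `t` of the probability
that `A` has not halted after `t` steps.  It is at most `T` whenever `A` always halts within `T`
steps. -/
def expectedTime (A : Prog) (x : Data) : ℝ≥0∞ :=
  ∑' t : ℕ, (runFrom (init A x) t).toOuterMeasure {c | c.todo ≠ []}

end WhileModel

open WhileModel

/-! ### The planted clique problem -/

namespace PlantedClique

/-- The distribution `G(n, 1/2)`: a uniformly random graph on `n` vertices. -/
def erdosRenyi (n : ℕ) : PMF (SimpleGraph (Fin n)) :=
  letI : Fintype (SimpleGraph (Fin n)) := Fintype.ofFinite _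
  PMF.uniformOfFintype (SimpleGraph (Fin n))

/-- A uniformly random set of `κ` vertices (of all vertices if `κ > n`). -/
def randomSubset (n κ : ℕ) : PMF (Finset (Fin n)) :=
  PMF.uniformOfFinset (Finset.powersetCard (min κ n) Finset.univ)
    (Finset.powersetCard_nonempty.2 (by simp))

/-- The complete graph on the vertices in `S`. -/
def cliqueOn {n : ℕ} (S : Finset (Fin n)) : SimpleGraph (Fin n) :=
  SimpleGraph.fromRel fun u v => u ∈ S ∧ v ∈ S

/-- The distribution `G(n, 1/2, κ)`: a random graph to which a clique on an independent uniformly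
random set of `κ` vertices is added. -/
def planted (n κ : ℕ) : PMF (SimpleGraph (Fin n)) :=
  (erdosRenyi n).bind fun G => (randomSubset n κ).map fun S => G ⊔ cliqueOn S

open Classical in
/-- A graph is given by its adjacency matrix. -/
def encodeGraph {n : ℕ} (G : SimpleGraph (Fin n)) : Data :=
  Data.ofMatrix fun u v => Data.ofBool (decide (G.Adj u v))

/-- The probability, over `G` drawn from `D` and the coins of `A`, that `A(G) = 1`. -/
def acceptProb (A : Prog) {n : ℕ} (D : PMF (SimpleGraph (Fin n))) : ℝ≥0∞ :=
  ∑' G : SimpleGraph (Fin n), D G * outputProb A (encodeGraph G) {Data.ofBool true}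

/-- `A` runs in (expected) time `n ^ o(log n)` on graphs with `n` vertices. -/
def RunsInTime (A : Prog) : Prop :=
  ∃ h : ℕ → ℝ, (h =o[Filter.atTop] fun n : ℕ => Real.log n) ∧
    ∀ᶠ n : ℕ in Filter.atTop, ∀ G : SimpleGraph (Fin n),
      expectedTime A (encodeGraph G) ≤ ENNReal.ofReal ((n : ℝ) ^ h n)

/-- The Strongish Planted Clique Hypothesis. -/
def SPCH : Prop :=
  ∃ δ : ℝ, 0 < δ ∧ δ < 1 / 2 ∧
    ¬ ∃ A : Prog, RunsInTime A ∧
      ∀ᶠ n : ℕ in Filter.atTop,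
        2 / 3 ≤ acceptProb A (planted n ⌈(n : ℝ) ^ δ⌉₊) ∧
        acceptProb A (erdosRenyi n) ≤ 1 / 3

end PlantedClique

/-! ### Directed Steiner Network -/

namespace DSN

/-- An instance: a directed graph on `n` vertices whose arcs carry nonnegative integer weights
(`weight u v = none` if there is no arc from `u` to `v`), and a set of demand pairs, listed without
repetition. -/
structure Instance : Type where
  n : ℕ
  weight : Fin n → Fin n → Option ℕ
  demands : List (Fin n × Fin n)
  nodup : demands.Nodup

namespace Instance

/-- The number of demand pairs. -/
def k (I : Instance) : ℕ := I.demands.length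

/-- `R`, a set of pairs of vertices, is a set of arcs in which every demand pair is connected by a
directed path. -/
def IsSolution (I : Instance) (R : Fin I.n → Fin I.n → Bool) : Prop :=
  (∀ u v, R u v = true → (I.weight u v).isSome = true) ∧
    ∀ d ∈ I.demands, Relation.ReflTransGen (fun u v => R u v = true) d.1 d.2

/-- The total weight of the arcs in `R`. -/
def cost (I : Instance) (R : Fin I.n → Fin I.n → Bool) : ℕ :=
  ∑ u, ∑ v, if R u v = true then (I.weight u v).getD 0 else 0

/-- `R` is a solution of cost at most `ρ` times the cost of every solution. -/
def IsApproxSolution (I : Instance) (ρ : ℝ) (R : Fin I.n → Fin I.n → Bool) : Prop :=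
  I.IsSolution R ∧ ∀ R', I.IsSolution R' → (I.cost R : ℝ) ≤ ρ * (I.cost R' : ℝ)

/-- No arc is `nil`; an arc of weight `w` is `cons nil w` with `w` in binary. -/
def encodeWeight : Option ℕ → Data
  | none => Data.nil
  | some w => Data.cons Data.nil (Data.ofBinary w)

/-- The input of an algorithm: the weight matrix and the list of demand pairs. -/
def encode (I : Instance) : Data :=
  Data.cons (Data.ofMatrix fun u v => encodeWeight (I.weight u v))
    (Data.ofList (I.demands.map fun d =>
      Data.cons (Data.ofUnary (d.1 : ℕ)) (Data.ofUnary (d.2 : ℕ))))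

/-- The output of an algorithm: the matrix of a set of arcs. -/
def encodeSolution (I : Instance) (R : Fin I.n → Fin I.n → Bool) : Data :=
  Data.ofMatrix fun u v => Data.ofBool (R u v)

end Instance

/-- `A` runs in (expected) time `f(k) · poly(n)`, where `n` is the size of the input. -/
def RunsInTime (A : Prog) (f : ℕ → ℕ) : Prop :=
  ∃ p : Polynomial ℕ, ∀ I : Instance,
    expectedTime A I.encode ≤ ((f I.k * p.eval I.encode.size : ℕ) : ℝ≥0∞)

/-- On every instance that has a solution, `A` outputs with probability at least `2/3` a solution
whose cost is within a factor `g(k)` of the optimum. -/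
def Approximates (A : Prog) (g : ℕ → ℝ) : Prop :=
  ∀ I : Instance, (∃ R, I.IsSolution R) →
    2 / 3 ≤ outputProb A I.encode {y | ∃ R, I.IsApproxSolution (g I.k) R ∧ y = I.encodeSolution R}

end DSN

end

noncomputable section

/-! Suppose `A` approximates within `g(k) = o(√k)` in time `f(k) · poly`. From a graph `G` on `n`
vertices and numbers `k ≤ l ≤ λ`, where `λ = lam n` is about `log₂ n`, an instance with `k²` demand
pairs is built. The vertices of `G` are cut into `2l²` blocks; a left or right vertex of a colour is
a choice of one vertex from each of the `l` blocks of that colour. Sources reach the left vertices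
of their colour, and right vertices reach the sink of their colour, at cost one. A left and a right
vertex are joined by a free arc if `G` contains all edges between the two choices. Every source has
to reach every sink.

Completeness: a clique meeting all blocks yields a solution of cost at most `2k`, one choice per
colour (`exists_cheap_solution`).

Soundness: a solution of cost `x ≤ k²l/(32λ)` routes `k²` pairs through at most `x` left and right
vertices. A subgraph of minimum degree about `k²/x`, and in it a maximal family of disjoint
half-size subsets of the choices, give a set of `μh` vertices, `h = ⌈l/2⌉`, split into `μ ≤ l²`
parts of size `h`, each completely joined to at least `8λ` vertices of that same set
(`exists_hasDense`, `Verified.hasDense`). Because the neighbours lie inside the small set, few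
configurations have to be counted, and a union bound shows that a random graph rarely contains one
(`prob_hasDense_le`, `eventually_prob_verified_le`).

For `l ≥ ελ` the gap between the two cases is at least `εk/64`. Since `g(k²) = o(k)`, some constant
`k` depending only on `ε` lies within it, and then `f(k²)` is a constant too. At `l = ⌈ελ⌉` the
instance has size `n^{O(ελ)}`, so letting `ε` tend to zero gives time `n^{o(log n)}`.

The distinguisher must be a single program, although the rates of `f` and `g` and the exponent `δ`
are arbitrary, possibly uncomputable. It therefore runs stages `l = 1, …, λ`. A stage runs `A` with
a clock for all `k ≤ l` and accepts if some output passes an explicit test; acceptance of random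
graphs is rare whatever `A` does. If nothing is found, the stage checks its own reliability on
random graphs in which it plants cliques itself, and rejects only if all these tests succeed;
otherwise the next stage is entered. A wrong rejection needs a search that fails on planted graphs
while all `n⁵` tests pass, which is unlikely (`expect_stage_reject_le`). The unknown clique size is
met by a random threshold on random labels, whose law dominates every fixed size up to a polynomial
factor (`expect_randomSubset_le`). For each `ε`, stages with `l ≥ ελ` decide almost surely once `n`
is large (`eventually_stage_none_le`), so later stages contribute almost nothing to the expected
time.

The machine model is concrete, so all this has to be a program. Continuation-style specifications of
expected time and output law (`Spec`, `Comp`), a calculus of polynomial-time functions (`RP`) and a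
compiler that adds a clock to `A` (`clocked_spec`) provide it. -/

namespace DSNHardness

open WhileModel

/-! ### Expectations with respect to probability mass functions -/

/-- The expectation of a nonnegative function. -/
def expect {β : Type*} (μ : PMF β) (φ : β → ℝ≥0∞) : ℝ≥0∞ := ∑' x, μ x * φ x

section expect

variable {β γ : Type*}

lemma expect_pure (x : β) (φ : β → ℝ≥0∞) : expect (PMF.pure x) φ = φ x := by
  unfold expect
  rw [tsum_eq_single x]
  · simp
  · intro y hy
    simp [PMF.pure_apply, hy]

lemma expect_bind (μ : PMF β) (ν : β → PMF γ) (φ : γ → ℝ≥0∞) :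
    expect (μ.bind ν) φ = expect μ fun x => expect (ν x) φ := by
  unfold expect
  simp only [PMF.bind_apply, ← ENNReal.tsum_mul_right, ← ENNReal.tsum_mul_left]
  rw [ENNReal.tsum_comm]
  simp only [mul_assoc]

lemma expect_map (μ : PMF β) (f : β → γ) (φ : γ → ℝ≥0∞) :
    expect (μ.map f) φ = expect μ fun x => φ (f x) := by
  rw [PMF.map, expect_bind]
  simp [expect_pure]

lemma expect_mono_on {μ : PMF β} {φ ψ : β → ℝ≥0∞} (h : ∀ x ∈ μ.support, φ x ≤ ψ x) :
    expect μ φ ≤ expect μ ψ := by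
  refine ENNReal.tsum_le_tsum fun x => ?_
  by_cases hx : μ x = 0
  · simp [hx]
  · gcongr
    exact h x ((PMF.mem_support_iff _ _).2 hx)

lemma expect_mono {μ : PMF β} {φ ψ : β → ℝ≥0∞} (h : ∀ x, φ x ≤ ψ x) :
    expect μ φ ≤ expect μ ψ := expect_mono_on fun x _ => h x

lemma expect_congr_on {μ : PMF β} {φ ψ : β → ℝ≥0∞} (h : ∀ x ∈ μ.support, φ x = ψ x) :
    expect μ φ = expect μ ψ :=
  le_antisymm (expect_mono_on fun x hx => (h x hx).le) (expect_mono_on fun x hx => (h x hx).ge)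

lemma expect_const (μ : PMF β) (a : ℝ≥0∞) : expect μ (fun _ => a) = a := by
  unfold expect
  rw [ENNReal.tsum_mul_right, PMF.tsum_coe, one_mul]

lemma expect_add (μ : PMF β) (φ ψ : β → ℝ≥0∞) :
    expect μ (fun x => φ x + ψ x) = expect μ φ + expect μ ψ := by
  unfold expect
  simp only [mul_add, ENNReal.tsum_add]

lemma expect_const_mul (μ : PMF β) (a : ℝ≥0∞) (φ : β → ℝ≥0∞) :
    expect μ (fun x => a * φ x) = a * expect μ φ := by
  unfold expect
  rw [← ENNReal.tsum_mul_left]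
  simp only [mul_left_comm]

lemma expect_mul_const (μ : PMF β) (a : ℝ≥0∞) (φ : β → ℝ≥0∞) :
    expect μ (fun x => φ x * a) = expect μ φ * a := by
  simp only [mul_comm _ a, expect_const_mul]

lemma expect_tsum (μ : PMF β) (φ : ℕ → β → ℝ≥0∞) :
    expect μ (fun x => ∑' t, φ t x) = ∑' t, expect μ (φ t) := by
  unfold expect
  simp only [← ENNReal.tsum_mul_left]
  rw [ENNReal.tsum_comm]

lemma expect_sum {κ : Type*} (μ : PMF β) (s : Finset κ) (φ : κ → β → ℝ≥0∞) :
    expect μ (fun x => ∑ i ∈ s, φ i x) = ∑ i ∈ s, expect μ (φ i) := by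
  classical
  induction s using Finset.induction_on with
  | empty => simp [expect]
  | insert i s hi ih => simp [Finset.sum_insert hi, expect_add, ih]

/-- Monotone convergence. It lets the limit defining the halting value pass through one step of the
machine. -/
lemma expect_iSup (μ : PMF β) (φ : ℕ → β → ℝ≥0∞) (h : ∀ x, Monotone fun t => φ t x) :
    expect μ (fun x => ⨆ t, φ t x) = ⨆ t, expect μ (φ t) := by
  unfold expect
  simp only [ENNReal.mul_iSup, ENNReal.tsum_eq_iSup_sum]
  rw [iSup_comm]
  refine iSup_congr fun s => ?_
  rw [ENNReal.finsetSum_iSup_of_monotone]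
  intro x t t' htt
  exact mul_le_mul_right (h x htt) _

lemma toOuterMeasure_eq_expect (μ : PMF β) (S : Set β) [DecidablePred (· ∈ S)] :
    μ.toOuterMeasure S = expect μ fun x => if x ∈ S then 1 else 0 := by
  rw [PMF.toOuterMeasure_apply]
  refine tsum_congr fun x => ?_
  by_cases hx : x ∈ S <;> simp [hx]

end expect

/-! ### Output value and expected time of a configuration -/

open Classical in
/-- The probability of having halted after `t` steps with output in `S`. -/
def haltProb (S : Set Data) (t : ℕ) (c : Config) : ℝ≥0∞ :=
  expect (runFrom c t) fun c => if c.todo = [] ∧ c.store 0 ∈ S then 1 else 0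

open Classical in
/-- The probability of not having halted after `t` steps. -/
def liveProb (t : ℕ) (c : Config) : ℝ≥0∞ :=
  expect (runFrom c t) fun c => if c.todo ≠ [] then 1 else 0

/-- The probability of halting with output in `S`. -/
def haltValue (S : Set Data) (c : Config) : ℝ≥0∞ := ⨆ t, haltProb S t c

/-- The expected number of steps from a configuration. -/
def timeFrom (c : Config) : ℝ≥0∞ := ∑' t, liveProb t c

lemma outputProb_eq (A : Prog) (x : Data) (S : Set Data) :
    outputProb A x S = haltValue S (init A x) := by
  classical
  unfold outputProb haltValue haltProb
  refine iSup_congr fun t => ?_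
  rw [toOuterMeasure_eq_expect]
  refine expect_congr_on fun c _ => ?_
  simp

lemma expectedTime_eq (A : Prog) (x : Data) : expectedTime A x = timeFrom (init A x) := by
  classical
  unfold expectedTime timeFrom liveProb
  refine tsum_congr fun t => ?_
  rw [toOuterMeasure_eq_expect]
  refine expect_congr_on fun c _ => ?_
  simp

lemma runFrom_succ_eq (c : Config) (t : ℕ) :
    runFrom c (t + 1) = (step c).bind fun c' => runFrom c' t := by
  induction t with
  | zero => simp [runFrom]
  | succ t ih =>
    rw [runFrom, ih, PMF.bind_bind]
    rfl

lemma haltProb_zero (S : Set Data) (p : Prog) (K : List Prog) (s : Store) :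
    haltProb S 0 ⟨p :: K, s⟩ = 0 := by
  simp [haltProb, runFrom, expect_pure]

lemma haltProb_succ (S : Set Data) (t : ℕ) (c : Config) :
    haltProb S (t + 1) c = expect (step c) (haltProb S t) := by
  unfold haltProb
  rw [runFrom_succ_eq, expect_bind]

lemma liveProb_succ (t : ℕ) (c : Config) :
    liveProb (t + 1) c = expect (step c) (liveProb t) := by
  unfold liveProb
  rw [runFrom_succ_eq, expect_bind]

lemma step_nil (s : Store) : step ⟨[], s⟩ = PMF.pure ⟨[], s⟩ := rfl

lemma runFrom_nil (s : Store) (t : ℕ) : runFrom ⟨[], s⟩ t = PMF.pure ⟨[], s⟩ := by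
  induction t with
  | zero => rfl
  | succ t ih => rw [runFrom, ih, PMF.pure_bind, step_nil]

open Classical in
lemma haltProb_nil (S : Set Data) (t : ℕ) (s : Store) :
    haltProb S t ⟨[], s⟩ = if s 0 ∈ S then 1 else 0 := by
  simp [haltProb, runFrom_nil, expect_pure]

lemma haltProb_mono_succ (S : Set Data) (t : ℕ) (c : Config) :
    haltProb S t c ≤ haltProb S (t + 1) c := by
  classical
  unfold haltProb
  rw [runFrom, expect_bind]
  refine expect_mono fun c => ?_
  split_ifs with h
  · obtain ⟨K, s⟩ := c
    obtain ⟨rfl, h2⟩ := h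
    rw [step_nil, expect_pure]
    simp [h2]
  · simp

lemma haltProb_mono (S : Set Data) (c : Config) : Monotone fun t => haltProb S t c :=
  monotone_nat_of_le_succ fun t => haltProb_mono_succ S t c

lemma liveProb_anti (c : Config) : Antitone fun t => liveProb t c := by
  classical
  refine antitone_nat_of_succ_le fun t => ?_
  unfold liveProb
  rw [runFrom, expect_bind]
  refine expect_mono fun c => ?_
  split_ifs with h
  · refine (expect_mono (ψ := fun _ => 1) fun c => ?_).trans (expect_const _ _).le
    split_ifs <;> simp
  · obtain ⟨K, s⟩ := c
    simp only [ne_eq, not_not] at h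
    subst h
    rw [step_nil, expect_pure]
    simp

/-- By monotone convergence and because dropping the first term of a monotone sequence keeps its
supremum. With `timeFrom_eq_step` it replaces all later reasoning about numbers of steps by one-step
equations. -/
lemma haltValue_eq_step (S : Set Data) (c : Config) :
    haltValue S c = expect (step c) (haltValue S) := by
  unfold haltValue
  rw [expect_iSup _ _ fun c => haltProb_mono S c]
  simp only [← haltProb_succ]
  exact ((haltProb_mono S c).iSup_nat_add 1).symm

lemma timeFrom_eq_step {c : Config} (h : c.todo ≠ []) :
    timeFrom c = 1 + expect (step c) timeFrom := by
  classical
  unfold timeFrom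
  rw [expect_tsum, tsum_eq_zero_add' ENNReal.summable]
  simp only [← liveProb_succ]
  congr 1
  simp [liveProb, runFrom, expect_pure, h]

open Classical in
lemma haltValue_nil (S : Set Data) (s : Store) :
    haltValue S ⟨[], s⟩ = if s 0 ∈ S then 1 else 0 := by
  simp [haltValue, haltProb_nil]

lemma timeFrom_nil (s : Store) : timeFrom ⟨[], s⟩ = 0 := by
  simp [timeFrom, liveProb, runFrom_nil, expect_pure]

/-- Truncating a run at time `t` loses at most the probability of not having halted by then. -/
lemma haltValue_le_add (S : Set Data) (c : Config) (t : ℕ) :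
    haltValue S c ≤ haltProb S t c + liveProb t c := by
  classical
  have key : ∀ r, haltProb S (t + r) c ≤ haltProb S t c + liveProb t c := by
    intro r
    have : ∀ r, runFrom c (t + r) = (runFrom c t).bind fun c' => runFrom c' r := by
      intro r
      induction r with
      | zero => simp [runFrom]
      | succ r ih =>
        rw [← add_assoc, runFrom, ih, PMF.bind_bind]
        rfl
    unfold haltProb liveProb
    rw [this, expect_bind, ← expect_add]
    refine expect_mono fun c' => ?_
    obtain ⟨K, s⟩ := c'
    by_cases hK : K = []
    · subst hK
      rw [runFrom_nil, expect_pure]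
      exact le_self_add
    · simp only [hK, ne_eq, not_false_eq_true, if_true]
      refine ((expect_mono (ψ := fun _ => 1) fun c => ?_).trans (expect_const _ _).le).trans
        le_add_self
      split_ifs <;> simp
  refine iSup_le fun r => ?_
  rcases le_total r t with h | h
  · exact (haltProb_mono S c h).trans le_self_add
  · obtain ⟨q, rfl⟩ := Nat.exists_eq_add_of_le h
    exact key q

/-- Markov's inequality: the survival probabilities decrease, so each of the first `t + 1` terms of
the expected time is at least the last of them. -/
lemma liveProb_mul_le (c : Config) (t : ℕ) : ((t + 1 : ℕ) : ℝ≥0∞) * liveProb t c ≤ timeFrom c := by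
  refine le_trans ?_ (ENNReal.sum_le_tsum (Finset.range (t + 1)))
  rw [← nsmul_eq_mul]
  refine le_trans (le_of_eq (by simp)) (Finset.card_nsmul_le_sum _ _ (liveProb t c) ?_)
  intro i hi
  exact liveProb_anti c (by simpa [Nat.lt_succ_iff] using hi)

/-! ### Specifications of programs -/

/-- `p` started with store `s` halts almost surely with a store distributed according to `μ`, after
an expected number of at most `T` steps. -/
def Spec (p : Prog) (s : Store) (μ : PMF Store) (T : ℝ≥0∞) : Prop :=
  ∀ K : List Prog,
    (∀ S, haltValue S ⟨p :: K, s⟩ = expect μ fun s' => haltValue S ⟨K, s'⟩) ∧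
      timeFrom ⟨p :: K, s⟩ ≤ T + expect μ fun s' => timeFrom ⟨K, s'⟩

lemma Spec.mono {p : Prog} {s : Store} {μ : PMF Store} {T T' : ℝ≥0∞} (h : Spec p s μ T)
    (hT : T ≤ T') : Spec p s μ T' := fun K =>
  ⟨(h K).1, (h K).2.trans (by gcongr)⟩

lemma Spec.assign (x : ℕ) (e : Expr) (s : Store) :
    Spec (.assign x e) s (PMF.pure (Function.update s x (e.eval s))) 1 := by
  intro K
  refine ⟨fun S => ?_, ?_⟩
  · rw [haltValue_eq_step, step, expect_pure, expect_pure]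
  · rw [timeFrom_eq_step (by simp), step, expect_pure, expect_pure]

lemma Spec.flip (x : ℕ) (s : Store) :
    Spec (.flip x) s
      ((PMF.uniformOfFintype Bool).map fun b => Function.update s x (Data.ofBool b)) 1 := by
  intro K
  refine ⟨fun S => ?_, ?_⟩
  · rw [haltValue_eq_step, step, expect_map, expect_map]
  · rw [timeFrom_eq_step (by simp), step, expect_map, expect_map]

/-- Since specifications quantify over the remaining commands, `p` is used with continuation `q ::
K` and `q` with `K`. The summand one pays for unfolding the sequence. -/
lemma Spec.seq {p q : Prog} {s : Store} {μ : PMF Store} {ν : Store → PMF Store} {T : ℝ≥0∞}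
    {T' : Store → ℝ≥0∞} (hp : Spec p s μ T) (hq : ∀ s' ∈ μ.support, Spec q s' (ν s') (T' s')) :
    Spec (.seq p q) s (μ.bind ν) (1 + T + expect μ T') := by
  intro K
  refine ⟨fun S => ?_, ?_⟩
  · rw [haltValue_eq_step, step, expect_pure, (hp _).1, expect_bind]
    exact expect_congr_on fun s' hs' => (hq s' hs' K).1 S
  · rw [timeFrom_eq_step (by simp), step, expect_pure, expect_bind, add_assoc, add_assoc]
    gcongr
    refine ((hp _).2).trans ?_
    gcongr
    rw [← expect_add]
    exact expect_mono_on fun s' hs' => (hq s' hs' K).2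

lemma Spec.ite {e : Expr} {p q : Prog} {s : Store} {μ : PMF Store} {T : ℝ≥0∞}
    (h : Spec (if (e.eval s).toBool then p else q) s μ T) : Spec (.ite e p q) s μ (1 + T) := by
  intro K
  refine ⟨fun S => ?_, ?_⟩
  · rw [haltValue_eq_step, step, expect_pure, (h K).1]
  · rw [timeFrom_eq_step (by simp), step, expect_pure, add_assoc]
    gcongr
    exact (h K).2

lemma Spec.loop_false {e : Expr} {p : Prog} {s : Store} (h : (e.eval s).toBool = false) :
    Spec (.loop e p) s (PMF.pure s) 1 := by
  intro K
  refine ⟨fun S => ?_, ?_⟩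
  · rw [haltValue_eq_step, step, expect_pure, expect_pure]
    simp [h]
  · rw [timeFrom_eq_step (by simp), step, expect_pure, expect_pure]
    simp [h]

lemma Spec.loop_true {e : Expr} {p : Prog} {s : Store} {μ : PMF Store} {ν : Store → PMF Store}
    {T : ℝ≥0∞} {T' : Store → ℝ≥0∞} (h : (e.eval s).toBool = true) (hp : Spec p s μ T)
    (hq : ∀ s' ∈ μ.support, Spec (.loop e p) s' (ν s') (T' s')) :
    Spec (.loop e p) s (μ.bind ν) (1 + T + expect μ T') := by
  intro K
  refine ⟨fun S => ?_, ?_⟩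
  · rw [haltValue_eq_step, step, expect_pure]
    simp only [h, if_true]
    rw [(hp _).1, expect_bind]
    exact expect_congr_on fun s' hs' => (hq s' hs' K).1 S
  · rw [timeFrom_eq_step (by simp), step, expect_pure, expect_bind, add_assoc, add_assoc]
    gcongr
    simp only [h, if_true]
    refine ((hp _).2).trans ?_
    gcongr
    rw [← expect_add]
    exact expect_mono_on fun s' hs' => (hq s' hs' K).2

lemma Spec.seq_pure {p q : Prog} {s s' : Store} {ν : PMF Store} {T T' : ℝ≥0∞}
    (hp : Spec p s (PMF.pure s') T) (hq : Spec q s' ν T') :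
    Spec (.seq p q) s ν (1 + T + T') := by
  have := Spec.seq (ν := fun _ => ν) (T' := fun _ => T') hp (by
    intro t ht
    rw [PMF.mem_support_pure_iff] at ht
    exact ht ▸ hq)
  rwa [PMF.pure_bind, expect_pure] at this

/-! ### Functions computed by programs -/

lemma bind_congr_on {β γ : Type*} {μ : PMF β} {f g : β → PMF γ} (h : ∀ x ∈ μ.support, f x = g x) :
    μ.bind f = μ.bind g := by
  ext y
  rw [PMF.bind_apply, PMF.bind_apply]
  refine tsum_congr fun x => ?_
  by_cases hx : μ x = 0
  · simp [hx]
  · rw [h x ((PMF.mem_support_iff _ _).2 hx)]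

/-- Started with store `s`, the program `p` leaves in register `b` a value with law `F`, keeps the
registers below `b`, and takes at most `T` steps on average. -/
def Impl (b : ℕ) (p : Prog) (s : Store) (F : PMF Data) (T : ℝ≥0∞) : Prop :=
  ∃ μ : PMF Store, Spec p s μ T ∧ μ.map (fun s' => s' b) = F ∧
    ∀ s' ∈ μ.support, ∀ y < b, s' y = s y

/-- The values `F a` can be computed from the data `e a` in expected time `T a`, by one program
that works relative to any base register. -/
def Comp {α : Type*} (e : α → Data) (F : α → PMF Data) (T : α → ℝ≥0∞) : Prop :=
  ∀ b : ℕ, ∃ p : Prog, ∀ a s, s b = e a → Impl b p s (F a) (T a)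

lemma Spec.assign_seq {x : ℕ} {ex : Expr} {q : Prog} {s : Store} {ν : PMF Store} {T : ℝ≥0∞}
    (h : Spec q (Function.update s x (ex.eval s)) ν T) :
    Spec (.seq (.assign x ex) q) s ν (2 + T) := by
  have := Spec.seq_pure (Spec.assign x ex s) h
  rwa [one_add_one_eq_two] at this

lemma Impl.mono {b : ℕ} {p : Prog} {s : Store} {F : PMF Data} {T T' : ℝ≥0∞}
    (h : Impl b p s F T) (hT : T ≤ T') : Impl b p s F T' := by
  obtain ⟨μ, h1, h2⟩ := h
  exact ⟨μ, h1.mono hT, h2⟩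

lemma Impl.assign_seq {b x : ℕ} {ex : Expr} {q : Prog} {s : Store} {F : PMF Data} {T : ℝ≥0∞}
    (hx : b ≤ x) (h : Impl b q (Function.update s x (ex.eval s)) F T) :
    Impl b (.seq (.assign x ex) q) s F (2 + T) := by
  obtain ⟨μ, h1, h2, h3⟩ := h
  refine ⟨μ, h1.assign_seq, h2, fun s' hs' y hy => ?_⟩
  rw [h3 s' hs' y hy, Function.update_of_ne (by omega)]

lemma Impl.assign (b : ℕ) (ex : Expr) (s : Store) :
    Impl b (.assign b ex) s (PMF.pure (ex.eval s)) 1 := by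
  refine ⟨_, Spec.assign b ex s, by simp [PMF.pure_map], fun s' hs' y hy => ?_⟩
  rw [PMF.mem_support_pure_iff] at hs'
  rw [hs', Function.update_of_ne (by omega)]

/-- Run `p` at a higher base, then continue depending on its result. -/
lemma Impl.seq {b c : ℕ} {p q : Prog} {s : Store} {F : PMF Data} {H : Data → PMF Data}
    {T : ℝ≥0∞} {T' : Data → ℝ≥0∞} (hc : b ≤ c) (hp : Impl c p s F T)
    (hq : ∀ s', (∀ y < c, s' y = s y) → s' c ∈ F.support → Impl b q s' (H (s' c)) (T' (s' c))) :
    Impl b (.seq p q) s (F.bind H) (1 + T + expect F T') := by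
  obtain ⟨μ, h1, h2, h3⟩ := hp
  have hF : ∀ s' ∈ μ.support, s' c ∈ F.support := by
    intro s' hs'
    rw [← h2, PMF.mem_support_map_iff]
    exact ⟨s', hs', rfl⟩
  -- The law after `q` is defined for every store, with a junk value outside the support of `μ`, so
  -- that `choose` produces a total function to bind with.
  have hall : ∀ s', ∃ ν : PMF Store, s' ∈ μ.support → Spec q s' ν (T' (s' c)) ∧
      ν.map (fun s'' => s'' b) = H (s' c) ∧ ∀ s'' ∈ ν.support, ∀ y < b, s'' y = s' y := by
    intro s'
    by_cases hs' : s' ∈ μ.support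
    · obtain ⟨ν, hν⟩ := hq s' (h3 s' hs') (hF s' hs')
      exact ⟨ν, fun _ => hν⟩
    · exact ⟨PMF.pure s', fun h => absurd h hs'⟩
  choose ν hν using hall
  refine ⟨μ.bind ν, ?_, ?_, ?_⟩
  · have := Spec.seq h1 (T' := fun s' => T' (s' c)) fun s' hs' => (hν s' hs').1
    rwa [← expect_map μ (fun s' => s' c) T', h2] at this
  · rw [PMF.map_bind, bind_congr_on (g := fun s' => H (s' c)) fun s' hs' => (hν s' hs').2.1, ← h2,
      PMF.bind_map]
    rfl
  · intro s'' hs'' y hy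
    obtain ⟨s', hs', h⟩ := (PMF.mem_support_bind_iff _ _ _).1 hs''
    rw [(hν s' hs').2.2 s'' h y hy, h3 s' hs' y (by omega)]

section Comp

variable {α γ : Type*} {e : α → Data}

lemma Comp.mono {F : α → PMF Data} {T T' : α → ℝ≥0∞} (h : Comp e F T) (hT : ∀ a, T a ≤ T' a) :
    Comp e F T' := by
  intro b
  obtain ⟨p, hp⟩ := h b
  exact ⟨p, fun a s hs => (hp a s hs).mono (hT a)⟩

lemma Comp.reindex {F : α → PMF Data} {T : α → ℝ≥0∞} (h : Comp e F T) (φ : γ → α) :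
    Comp (fun c => e (φ c)) (fun c => F (φ c)) (fun c => T (φ c)) := by
  intro b
  obtain ⟨p, hp⟩ := h b
  exact ⟨p, fun a s hs => hp (φ a) s hs⟩

/-- Values of expressions in the environment. -/
lemma Comp.expr (ex : Data → Data) (E : ℕ → Expr) (hE : ∀ b s, (E b).eval s = ex (s b)) :
    Comp e (fun a => PMF.pure (ex (e a))) (fun _ => 1) := by
  intro b
  refine ⟨.assign b (E b), fun a s hs => ?_⟩
  have := Impl.assign b (E b) s
  rwa [hE, hs] at this

lemma Comp.flip : Comp e (fun _ => (PMF.uniformOfFintype Bool).map Data.ofBool) (fun _ => 1) := by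
  intro b
  refine ⟨.flip b, fun a s hs => ⟨_, Spec.flip b s, ?_, ?_⟩⟩
  · rw [PMF.map_comp]
    congr 1
    funext x
    simp
  · intro s' hs' y hy
    obtain ⟨c, -, rfl⟩ := (PMF.mem_support_map_iff _ _ _).1 hs'
    rw [Function.update_of_ne (by omega)]

/-- Composition: the environment of the second program is extended by the first result. -/
lemma Comp.bind_of {F : α → PMF Data} {T : α → ℝ≥0∞} {e' : γ → Data} {G : γ → PMF Data}
    {T' : γ → ℝ≥0∞} {H : α → Data → PMF Data} {T'' : α → Data → ℝ≥0∞} (hF : Comp e F T)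
    (hG : Comp e' G T')
    (hl : ∀ a, ∀ x ∈ (F a).support, ∃ c, e' c = .cons x (e a) ∧ G c = H a x ∧ T' c ≤ T'' a x) :
    Comp e (fun a => (F a).bind (H a)) (fun a => 5 + T a + expect (F a) (T'' a)) := by
  intro b
  obtain ⟨p, hp⟩ := hF (b + 1)
  obtain ⟨q, hq⟩ := hG b
  -- The environment is copied upwards and `p` runs at base `b + 1`, which preserves register `b`;
  -- afterwards result and environment are paired in register `b`. Copying, sequencing and pairing
  -- account for the constant five.
  refine ⟨.seq (.assign (b + 1) (.var b)) (.seq p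
    (.seq (.assign b (.cons (.var (b + 1)) (.var b))) q)), fun a s hs => ?_⟩
  have h1 := Impl.assign_seq (b := b) (x := b + 1) (ex := .var b) (s := s) (by omega)
    (Impl.seq (c := b + 1) (H := H a) (T' := fun x => 2 + T'' a x) (by omega)
      (hp a (Function.update s (b + 1) (Expr.eval s (.var b))) (by simp [Expr.eval, hs]))
      (q := .seq (.assign b (.cons (.var (b + 1)) (.var b))) q) ?_)
  · refine h1.mono ?_
    rw [expect_add, expect_const]
    refine le_of_eq ?_
    ring
  · intro s' hs' hsup
    obtain ⟨c, hc1, hc2, hc3⟩ := hl a _ hsup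
    refine Impl.assign_seq le_rfl ?_
    rw [← hc2]
    refine (hq c _ ?_).mono hc3
    have : s' b = e a := by
      rw [hs' b (by omega), Function.update_of_ne (by omega), hs]
    simp [Expr.eval, this, hc1]

lemma Comp.bind {F : α → PMF Data} {T : α → ℝ≥0∞} {H : α → Data → PMF Data}
    {T' : α → Data → ℝ≥0∞} (hF : Comp e F T)
    (hG : Comp (fun t : α × Data => .cons t.2 (e t.1)) (fun t => H t.1 t.2) fun t => T' t.1 t.2) :
    Comp e (fun a => (F a).bind (H a)) (fun a => 5 + T a + expect (F a) (T' a)) :=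
  Comp.bind_of hF hG fun a x _ => ⟨(a, x), rfl, rfl, le_rfl⟩

/-- Extend the environment by a computed value. -/
lemma Comp.extend {φ : α → Data} {T : α → ℝ≥0∞} {G : α → PMF Data} {T' : α → ℝ≥0∞}
    (hF : Comp e (fun a => PMF.pure (φ a)) T) (hG : Comp (fun a => .cons (φ a) (e a)) G T') :
    Comp e G (fun a => 5 + T a + T' a) := by
  have := Comp.bind_of (H := fun a _ => G a) (T'' := fun a _ => T' a) hF hG fun a x hx => ⟨a, by
    rw [PMF.mem_support_pure_iff] at hx
    rw [hx], rfl, le_rfl⟩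
  simpa [PMF.pure_bind, expect_pure] using this

/-- Replace the environment by a computed value. -/
lemma Comp.comp {φ : α → Data} {T : α → ℝ≥0∞} {G : α → PMF Data} {T' : α → ℝ≥0∞}
    (hF : Comp e (fun a => PMF.pure (φ a)) T) (hG : Comp φ G T') :
    Comp e G (fun a => 1 + T a + T' a) := by
  intro b
  obtain ⟨p, hp⟩ := hF b
  obtain ⟨q, hq⟩ := hG b
  refine ⟨.seq p q, fun a s hs => ?_⟩
  have h := Impl.seq (H := fun _ => G a) (T' := fun _ => T' a) le_rfl (hp a s hs) (q := q) ?_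
  · rwa [PMF.pure_bind, expect_pure] at h
  · intro s' _ hsup
    rw [PMF.mem_support_pure_iff] at hsup
    exact hq a s' hsup

/-- Each branch is required only for the inputs that take it. Hence the common bound `T'` may be
small on inputs of the cheap branch, which the time analysis of the main loop needs. -/
lemma Comp.ite {φ : α → Data} {T : α → ℝ≥0∞} {F G : α → PMF Data} {T' : α → ℝ≥0∞}
    (hc : Comp e (fun a => PMF.pure (φ a)) T)
    (hF : Comp (fun a : {a // (φ a).toBool = true} => e a.1) (fun a => F a.1) (fun a => T' a.1))
    (hG : Comp (fun a : {a // (φ a).toBool = false} => e a.1) (fun a => G a.1) (fun a => T' a.1)) :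
    Comp e (fun a => if (φ a).toBool then F a else G a) (fun a => 4 + T a + T' a) := by
  intro b
  obtain ⟨p, hp⟩ := hc (b + 1)
  obtain ⟨q, hq⟩ := hF b
  obtain ⟨r, hr⟩ := hG b
  refine ⟨.seq (.assign (b + 1) (.var b)) (.seq p (.ite (.var (b + 1)) q r)), fun a s hs => ?_⟩
  have h1 := Impl.assign_seq (b := b) (x := b + 1) (ex := .var b) (s := s) (by omega)
    (Impl.seq (c := b + 1) (H := fun _ => if (φ a).toBool then F a else G a)
      (T' := fun _ => 1 + T' a) (by omega)
      (hp a (Function.update s (b + 1) (Expr.eval s (.var b))) (by simp [Expr.eval, hs]))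
      (q := .ite (.var (b + 1)) q r) ?_)
  · rw [PMF.pure_bind, expect_pure] at h1
    refine h1.mono (le_of_eq ?_)
    ring
  · intro s' hs' hsup
    rw [PMF.mem_support_pure_iff] at hsup
    have hb : s' b = e a := by
      rw [hs' b (by omega), Function.update_of_ne (by omega), hs]
    have key : Impl b (if ((Expr.var (b + 1)).eval s').toBool then q else r) s'
        (if (φ a).toBool then F a else G a) (T' a) := by
      simp only [Expr.eval, hsup]
      by_cases h : (φ a).toBool = true
      · simp only [h, if_true]
        exact hq ⟨a, h⟩ s' hb
      · have h' : (φ a).toBool = false := by simpa using h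
        simp only [h', Bool.false_eq_true, if_false]
        exact hr ⟨a, h'⟩ s' hb
    obtain ⟨μ, h1, h2⟩ := key
    exact ⟨μ, h1.ite, h2⟩

/-- Iteration of a random map with access to the number of the round. -/
def iterate {β : Type*} (F : ℕ → β → PMF β) : ℕ → ℕ → β → PMF β
  | 0, _, x => PMF.pure x
  | r + 1, i, x => (F i x).bind (iterate F r (i + 1))

lemma ofUnary_succ (n : ℕ) : Data.ofUnary (n + 1) = .cons .nil (Data.ofUnary n) := rfl

lemma ofUnary_zero : Data.ofUnary 0 = .nil := rfl

/-- The length of the right spine. -/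
def ulen : Data → ℕ
  | .nil => 0
  | .cons _ r => ulen r + 1

lemma ulen_ofUnary (n : ℕ) : ulen (.ofUnary n) = n := by
  induction n with
  | zero => rfl
  | succ n ih => rw [ofUnary_succ, ulen, ih]

lemma ulen_tl (x : Data) : ulen x.tl = ulen x - 1 := by
  cases x <;> rfl

lemma toBool_iff_ulen (x : Data) : x.toBool = true ↔ 0 < ulen x := by
  cases x <;> simp [Data.toBool, ulen]

/-- The loop rule.  `V` bounds the remaining time. -/
lemma Comp.natRec_of {N : α → ℕ} {cnt x0 : α → Data} {TN T0 : α → ℝ≥0∞}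
    {F : α → ℕ → Data → PMF Data} {e' : γ → Data} {G : γ → PMF Data} {T' : γ → ℝ≥0∞}
    (P : α → ℕ → Data → Prop) (T V : α → ℕ → Data → ℝ≥0∞)
    (hN : Comp e (fun a => PMF.pure (cnt a)) TN) (hcnt : ∀ a, ulen (cnt a) = N a)
    (h0 : Comp e (fun a => PMF.pure (x0 a)) T0) (hG : Comp e' G T')
    (hl : ∀ a i x, i < N a → P a i x → ∃ c, e' c = .cons (.ofUnary i) (.cons x (e a)) ∧
      G c = F a i x ∧ T' c ≤ T a i x)
    (hP0 : ∀ a, P a 0 (x0 a))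
    (hP : ∀ a i x, i < N a → P a i x → ∀ y ∈ (F a i x).support, P a (i + 1) y)
    (hV : ∀ a i x, i < N a → P a i x → 10 + T a i x + expect (F a i x) (V a (i + 1)) ≤ V a i x) :
    Comp e (fun a => iterate (F a) (N a) 0 (x0 a)) (fun a => 11 + TN a + T0 a + V a 0 (x0 a)) := by
  intro b
  obtain ⟨pN, hpN⟩ := hN (b + 1)
  obtain ⟨p0, hp0⟩ := h0 (b + 3)
  obtain ⟨pB, hpB⟩ := hG (b + 4)
  -- Register `b` keeps the environment, `b + 1` the counter that is consumed, `b + 2` the round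
  -- number, `b + 3` the state; the body works from `b + 4` on.
  set body : Prog := .seq (.assign (b + 4) (.cons (.var (b + 2)) (.cons (.var (b + 3)) (.var b))))
    (.seq pB (.seq (.assign (b + 3) (.var (b + 4))) (.seq (.assign (b + 2) (.cons .nil (.var (b + 2))))
      (.assign (b + 1) (.tl (.var (b + 1))))))) with hbody
  have hloop : ∀ a r i x s, i + r = N a → P a i x → s b = e a → ulen (s (b + 1)) = r →
      s (b + 2) = .ofUnary i → s (b + 3) = x →
      ∃ μ : PMF Store, Spec (.loop (.var (b + 1)) body) s μ (1 + V a i x) ∧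
        μ.map (fun s' => s' (b + 3)) = iterate (F a) r i x ∧
        ∀ s' ∈ μ.support, ∀ y < b + 1, s' y = s y := by
    intro a r
    induction r with
    | zero =>
      intro i x s hi hPx hb h1 h2 h3
      refine ⟨PMF.pure s, (Spec.loop_false ?_).mono le_self_add, ?_, ?_⟩
      · rw [Expr.eval, Bool.eq_false_iff]
        intro h
        rw [toBool_iff_ulen] at h
        omega
      · simp [PMF.pure_map, iterate, h3]
      · intro s' hs' y hy
        rw [PMF.mem_support_pure_iff] at hs'
        rw [hs']
    | succ r ih =>
      intro i x s hi hPx hb h1 h2 h3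
      obtain ⟨c, hc1, hc2, hc3⟩ := hl a i x (by omega) hPx
      set s1 := Function.update s (b + 4)
        (Expr.eval s (.cons (.var (b + 2)) (.cons (.var (b + 3)) (.var b)))) with hs1
      obtain ⟨μ, hμ1, hμ2, hμ3⟩ := hpB c s1 (by simp [hs1, Expr.eval, hc1, h2, h3, hb])
      set upd : Store → Store := fun s' =>
        Function.update (Function.update (Function.update s' (b + 3) (s' (b + 4))) (b + 2)
          (.cons .nil (s' (b + 2)))) (b + 1) (s' (b + 1)).tl with hupd
      have hbodySpec : Spec body s (μ.map upd) (8 + T' c) := by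
        have h := Spec.seq (T' := fun _ => 5) (ν := fun s' => PMF.pure (upd s')) hμ1
          (q := .seq (.assign (b + 3) (.var (b + 4)))
            (.seq (.assign (b + 2) (.cons .nil (.var (b + 2)))) (.assign (b + 1) (.tl (.var (b + 1))))))
          (by
            intro s' hs'
            have := Spec.assign_seq (Spec.assign_seq (Spec.assign (b + 1) (.tl (.var (b + 1)))
              (Function.update (Function.update s' (b + 3) (Expr.eval s' (.var (b + 4)))) (b + 2)
                (Expr.eval (Function.update s' (b + 3) (Expr.eval s' (.var (b + 4))))
                  (.cons .nil (.var (b + 2)))))))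
            have h5 : (2 : ℝ≥0∞) + (2 + 1) = 5 := by norm_num
            rw [h5] at this
            convert this using 2
            simp [hupd, Expr.eval])
        have h2 := Spec.assign_seq (x := b + 4)
          (ex := .cons (.var (b + 2)) (.cons (.var (b + 3)) (.var b))) h
        rw [expect_const] at h2
        refine h2.mono (le_of_eq ?_)
        ring
      have hFs : ∀ s' ∈ μ.support, s' (b + 4) ∈ (F a i x).support := by
        intro s' hs'
        rw [← hc2, ← hμ2, PMF.mem_support_map_iff]
        exact ⟨s', hs', rfl⟩
      have hs1b : ∀ y < b + 4, s1 y = s y := fun y hy => by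
        rw [hs1, Function.update_of_ne (by omega)]
      have hall : ∀ s' : Store, ∃ ν : PMF Store, s' ∈ μ.support →
          Spec (.loop (.var (b + 1)) body) (upd s') ν (1 + V a (i + 1) (s' (b + 4))) ∧
          ν.map (fun s' => s' (b + 3)) = iterate (F a) r (i + 1) (s' (b + 4)) ∧
          ∀ s'' ∈ ν.support, ∀ y < b + 1, s'' y = s y := by
        intro s'
        by_cases hs' : s' ∈ μ.support
        · obtain ⟨ν, hν1, hν2, hν3⟩ := ih (i + 1) (s' (b + 4)) (upd s') (by omega)
            (hP a i x (by omega) hPx _ (hFs s' hs'))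
            (by
              simp only [hupd]
              rw [Function.update_of_ne (by omega), Function.update_of_ne (by omega),
                Function.update_of_ne (by omega), hμ3 s' hs' b (by omega), hs1b b (by omega), hb])
            (by
              simp only [hupd]
              rw [Function.update_self, hμ3 s' hs' _ (by omega), hs1b _ (by omega), ulen_tl, h1]
              rfl)
            (by
              simp only [hupd]
              rw [Function.update_of_ne (by omega), Function.update_self,
                hμ3 s' hs' _ (by omega), hs1b _ (by omega), h2]
              rfl)
            (by
              simp only [hupd]
              rw [Function.update_of_ne (by omega), Function.update_of_ne (by omega),
                Function.update_self])
          refine ⟨ν, fun _ => ⟨hν1, hν2, fun s'' hs'' y hy => ?_⟩⟩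
          rw [hν3 s'' hs'' y hy]
          simp only [hupd]
          rw [Function.update_of_ne (by omega), Function.update_of_ne (by omega),
            Function.update_of_ne (by omega), hμ3 s' hs' y (by omega), hs1b y (by omega)]
        · exact ⟨PMF.pure s', fun h => absurd h hs'⟩
      choose ν hν using hall
      have hupdinj : ∀ s', upd s' (b + 3) = s' (b + 4) := by
        intro s'
        simp only [hupd]
        rw [Function.update_of_ne (by omega), Function.update_of_ne (by omega), Function.update_self]
      have hall2 : ∀ t : Store, ∃ ν' : PMF Store, t ∈ (μ.map upd).support →
          Spec (.loop (.var (b + 1)) body) t ν' (1 + V a (i + 1) (t (b + 3))) ∧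
          ν'.map (fun s' => s' (b + 3)) = iterate (F a) r (i + 1) (t (b + 3)) ∧
          ∀ s'' ∈ ν'.support, ∀ y < b + 1, s'' y = s y := by
        intro t
        by_cases ht : t ∈ (μ.map upd).support
        · obtain ⟨s', hs', rfl⟩ := (PMF.mem_support_map_iff _ _ _).1 ht
          rw [hupdinj]
          exact ⟨ν s', fun _ => hν s' hs'⟩
        · exact ⟨PMF.pure t, fun h => absurd h ht⟩
      choose ν' hν' using hall2
      have hmap : (μ.map upd).map (fun t => t (b + 3)) = F a i x := by
        rw [PMF.map_comp, ← hc2, ← hμ2]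
        congr 1
        funext s'
        exact hupdinj s'
      refine ⟨(μ.map upd).bind ν', ?_, ?_, ?_⟩
      · have h := Spec.loop_true (e := .var (b + 1)) (s := s)
          ((toBool_iff_ulen _).2 (by rw [Expr.eval, h1]; omega)) hbodySpec (T' := fun t => 1 + V a (i + 1) (t (b + 3)))
          fun t ht => (hν' t ht).1
        refine h.mono ?_
        rw [← expect_map (μ.map upd) (fun t => t (b + 3)) (fun d => 1 + V a (i + 1) d), hmap,
          expect_add, expect_const]
        refine le_trans ?_ (add_le_add_right (hV a i x (by omega) hPx) 1)
        calc 1 + (8 + T' c) + (1 + expect (F a i x) (V a (i + 1)))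
            ≤ 1 + (8 + T a i x) + (1 + expect (F a i x) (V a (i + 1))) := by gcongr
          _ ≤ 1 + (8 + T a i x) + (1 + expect (F a i x) (V a (i + 1))) + 1 := le_self_add
          _ = 1 + (10 + T a i x + expect (F a i x) (V a (i + 1))) := by ring
      · rw [PMF.map_bind, bind_congr_on (g := fun t => iterate (F a) r (i + 1) (t (b + 3)))
          fun t ht => (hν' t ht).2.1, iterate, ← hmap,
          PMF.bind_map (PMF.map upd μ)]
        rfl
      · intro s'' hs'' y hy
        obtain ⟨t, ht, h⟩ := (PMF.mem_support_bind_iff _ _ _).1 hs''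
        exact (hν' t ht).2.2 s'' h y hy
  refine ⟨.seq (.assign (b + 1) (.var b)) (.seq pN (.seq (.assign (b + 2) .nil)
    (.seq (.assign (b + 3) (.var b)) (.seq p0 (.seq (.loop (.var (b + 1)) body)
      (.assign b (.var (b + 3)))))))), fun a s hs => ?_⟩
  have hfin : ∀ s', s' b = e a → ulen (s' (b + 1)) = N a → s' (b + 2) = .nil →
      s' (b + 3) = x0 a → Impl b (.seq (.loop (.var (b + 1)) body) (.assign b (.var (b + 3)))) s'
        (iterate (F a) (N a) 0 (x0 a)) (3 + V a 0 (x0 a)) := by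
    intro s' h0 h1 h2 h3
    obtain ⟨μ, hμ1, hμ2, hμ3⟩ := hloop a (N a) 0 (x0 a) s' (by omega) (hP0 a) h0 h1 h2 h3
    refine ⟨_, (Spec.seq hμ1 (T' := fun _ => 1) fun t _ => Spec.assign b (.var (b + 3)) t).mono ?_,
      ?_, ?_⟩
    · rw [expect_const]
      refine le_of_eq ?_
      ring
    · rw [PMF.map_bind, ← hμ2]
      simp only [PMF.pure_map, Function.update_self, Expr.eval]
      rfl
    · intro s'' hs'' y hy
      obtain ⟨t, ht, h⟩ := (PMF.mem_support_bind_iff _ _ _).1 hs''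
      rw [PMF.mem_support_pure_iff] at h
      rw [h, Function.update_of_ne (by omega), hμ3 t ht y (by omega)]
  have hmain := Impl.assign_seq (b := b) (x := b + 1) (ex := .var b) (s := s) (by omega)
    (Impl.seq (c := b + 1) (H := fun _ => iterate (F a) (N a) 0 (x0 a))
      (T' := fun _ => 8 + T0 a + V a 0 (x0 a)) (by omega)
      (hpN a (Function.update s (b + 1) (Expr.eval s (.var b))) (by simp [Expr.eval, hs]))
      (q := .seq (.assign (b + 2) .nil)
        (.seq (.assign (b + 3) (.var b)) (.seq p0 (.seq (.loop (.var (b + 1)) body)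
        (.assign b (.var (b + 3))))))) ?_)
  · rw [PMF.pure_bind, expect_pure] at hmain
    refine hmain.mono (le_of_eq ?_)
    ring
  · intro s' hs' hsup
    rw [PMF.mem_support_pure_iff] at hsup
    have hb : s' b = e a := by
      rw [hs' b (by omega), Function.update_of_ne (by omega), hs]
    have h := Impl.assign_seq (b := b) (x := b + 2) (ex := .nil) (s := s') (by omega)
      (Impl.assign_seq (b := b) (x := b + 3) (ex := .var b) (by omega)
        (Impl.seq (b := b) (c := b + 3) (H := fun _ => iterate (F a) (N a) 0 (x0 a))
          (T' := fun _ => 3 + V a 0 (x0 a)) (by omega)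
          (hp0 a _ (by simp [Expr.eval, hb]))
          (q := .seq (.loop (.var (b + 1)) body) (.assign b (.var (b + 3)))) ?_))
    · rw [PMF.pure_bind, expect_pure] at h
      refine h.mono (le_of_eq ?_)
      ring
    · intro s'' hs'' hsup''
      rw [PMF.mem_support_pure_iff] at hsup''
      refine hfin s'' ?_ ?_ ?_ hsup''
      · rw [hs'' b (by omega)]
        simp [hb]
      · rw [hs'' (b + 1) (by omega)]
        simp [hsup, hcnt]
      · rw [hs'' (b + 2) (by omega)]
        simp [Expr.eval]

/-- The expected time of a loop, given the time of its rounds. -/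
def loopTime {β : Type*} (F : ℕ → β → PMF β) (T : ℕ → β → ℝ≥0∞) : ℕ → ℕ → β → ℝ≥0∞
  | 0, _, _ => 0
  | r + 1, i, x => 10 + T i x + expect (F i x) (loopTime F T r (i + 1))

/-- Indices below a bound. -/
abbrev Idx {α : Type*} (N : α → ℕ) : Type _ := {t : α × ℕ // t.2 < N t.1}

/-- A loop whose state ranges over an encoded type. -/
lemma Comp.natRec {β : Type*} {enc : β → Data} (henc : Function.Injective enc) {N : α → ℕ}
    {cnt : α → Data} {TN T0 : α → ℝ≥0∞} {x0 : α → β} {F : α → ℕ → β → PMF β}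
    {T : α → ℕ → β → ℝ≥0∞} (hN : Comp e (fun a => PMF.pure (cnt a)) TN)
    (hcnt : ∀ a, ulen (cnt a) = N a) (h0 : Comp e (fun a => PMF.pure (enc (x0 a))) T0)
    (hF : Comp (fun t : Idx N × β => .cons (.ofUnary t.1.1.2) (.cons (enc t.2) (e t.1.1.1)))
      (fun t => (F t.1.1.1 t.1.1.2 t.2).map enc) fun t => T t.1.1.1 t.1.1.2 t.2) :
    Comp e (fun a => (iterate (F a) (N a) 0 (x0 a)).map enc)
      fun a => 11 + TN a + T0 a + loopTime (F a) (T a) (N a) 0 (x0 a) := by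
  -- A left inverse of `enc` turns the map on `β` into one on trees; off the range of `enc` it is
  -- arbitrary, and the invariant below keeps the state inside the range.
  set dec : α → Data → β := fun a y => @Function.invFun _ _ ⟨x0 a⟩ enc y with hdec
  have hinv : ∀ a x, dec a (enc x) = x := by
    intro a x
    have : Nonempty β := ⟨x0 a⟩
    exact Function.leftInverse_invFun henc x
  have h := Comp.natRec_of (F := fun a i y => (F a i (dec a y)).map enc)
    (P := fun a i y => ∃ x, y = enc x) (T := fun a i y => T a i (dec a y))
    (V := fun a i y => loopTime (F a) (T a) (N a - i) i (dec a y)) hN hcnt h0 hF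
    (by
      rintro a i _ hi ⟨x, rfl⟩
      exact ⟨(⟨(a, i), hi⟩, x), rfl, by simp only [hinv], by simp only [hinv, le_refl]⟩)
    (fun a => ⟨_, rfl⟩)
    (by
      intro a i x hi hx y hy
      obtain ⟨z, -, rfl⟩ := (PMF.mem_support_map_iff _ _ _).1 hy
      exact ⟨_, rfl⟩)
    (by
      intro a i x hi hx
      have : N a - i = N a - (i + 1) + 1 := by omega
      rw [this, loopTime, expect_map]
      simp only [hinv, le_refl])
  have hres : ∀ a, ∀ r i x, iterate (fun i y => (F a i (dec a y)).map enc) r i (enc x)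
      = (iterate (F a) r i x).map enc := by
    intro a r
    induction r with
    | zero => intro i x; simp [iterate, PMF.pure_map]
    | succ r ih =>
      intro i x
      simp only [iterate]
      rw [hinv a, PMF.map_bind, PMF.bind_map]
      congr 1
      funext z
      exact ih (i + 1) z
  simpa only [hres, hinv, Nat.sub_zero] using h

/-- A potential argument: in every round `V` drops in expectation by at least the cost of the round.
-/
lemma loopTime_le {β : Type*} {F : ℕ → β → PMF β} {T V : ℕ → β → ℝ≥0∞} (r : ℕ) : ∀ (i : ℕ) (x : β),
    (∀ j x, i ≤ j → j < i + r → 10 + T j x + expect (F j x) (V (j + 1)) ≤ V j x) →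
    loopTime F T r i x ≤ V i x := by
  induction r with
  | zero => intro i x _; exact zero_le
  | succ r ih =>
    intro i x h
    rw [loopTime]
    refine le_trans ?_ (h i x le_rfl (by omega))
    gcongr
    exact expect_mono fun y => ih (i + 1) y fun j x h1 h2 => h j x (by omega) (by omega)

end Comp

/-! ### Polynomial time relative to a size parameter -/

/-- `f` is polynomially bounded in `M`. -/
def PolyB {α : Type*} (M f : α → ℕ) : Prop := ∃ d, ∀ a, f a ≤ (M a + 2) ^ d

/-- The values `F a` are computed from `e a` in time polynomial in `M a`. -/
def RP {α : Type*} (M : α → ℕ) (e : α → Data) (F : α → PMF Data) : Prop :=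
  ∃ T : α → ℕ, PolyB M T ∧ Comp e F (fun a => (T a : ℝ≥0∞))

/-- Deterministic functions with values in trees. -/
def DataP {α : Type*} (M : α → ℕ) (e φ : α → Data) : Prop := RP M e fun a => PMF.pure (φ a)

/-- Deterministic functions with polynomially bounded numbers as values, in unary. -/
def NatP {α : Type*} (M : α → ℕ) (e : α → Data) (f : α → ℕ) : Prop :=
  DataP M e (fun a => .ofUnary (f a)) ∧ PolyB M f

open Classical in
/-- Predicates decided in time polynomial in `M`. -/
def BoolP {α : Type*} (M : α → ℕ) (e : α → Data) (P : α → Prop) : Prop :=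
  DataP M e fun a => .ofBool (decide (P a))

section PolyB

variable {α γ : Type*} {M f g : α → ℕ}

lemma PolyB.of_le (hg : PolyB M g) (h : ∀ a, f a ≤ g a) : PolyB M f := by
  obtain ⟨d, hd⟩ := hg
  exact ⟨d, fun a => (h a).trans (hd a)⟩

lemma PolyB.self : PolyB M M := ⟨1, fun a => by simp⟩

/-- The base `M a + 2` is at least two, so exponents alone absorb constants. -/
lemma PolyB.const (c : ℕ) : PolyB M fun _ => c :=
  ⟨c, fun a => (Nat.lt_pow_self (by omega)).le⟩

lemma PolyB.mul (hf : PolyB M f) (hg : PolyB M g) : PolyB M fun a => f a * g a := by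
  obtain ⟨d, hd⟩ := hf
  obtain ⟨d', hd'⟩ := hg
  exact ⟨d + d', fun a => by rw [pow_add]; exact Nat.mul_le_mul (hd a) (hd' a)⟩

lemma PolyB.add (hf : PolyB M f) (hg : PolyB M g) : PolyB M fun a => f a + g a := by
  obtain ⟨d, hd⟩ := hf
  obtain ⟨d', hd'⟩ := hg
  refine ⟨d + d' + 1, fun a => ?_⟩
  have h1 : (M a + 2) ^ d ≤ (M a + 2) ^ (d + d') := Nat.pow_le_pow_right (by omega) (by omega)
  have h2 : (M a + 2) ^ d' ≤ (M a + 2) ^ (d + d') := Nat.pow_le_pow_right (by omega) (by omega)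
  calc f a + g a ≤ (M a + 2) ^ (d + d') * 2 := by linarith [hd a, hd' a]
    _ ≤ (M a + 2) ^ (d + d') * (M a + 2) := Nat.mul_le_mul_left _ (by omega)

lemma PolyB.pow (hf : PolyB M f) (c : ℕ) : PolyB M fun a => f a ^ c := by
  obtain ⟨d, hd⟩ := hf
  exact ⟨d * c, fun a => by rw [pow_mul]; exact Nat.pow_le_pow_left (hd a) c⟩

lemma PolyB.trans (hf : PolyB M f) (hM : PolyB g M) : PolyB g f := by
  obtain ⟨d, hd⟩ := hf
  exact ((hM.add (.const 2)).pow d).of_le hd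

lemma PolyB.reindex (hf : PolyB M f) (π : γ → α) : PolyB (fun c => M (π c)) fun c => f (π c) := by
  obtain ⟨d, hd⟩ := hf
  exact ⟨d, fun c => hd _⟩

end PolyB

/-- The environment extended by an index. -/
def withIdx {α : Type*} (e : α → Data) (N : α → ℕ) : Idx N → Data :=
  fun t => .cons (.ofUnary t.1.2) (e t.1.1)

section RP

variable {α γ : Type*} {M : α → ℕ} {e : α → Data} {F : α → PMF Data}

lemma RP.of_comp {T : α → ℝ≥0∞} {T' : α → ℕ} (h : Comp e F T) (hT : PolyB M T')
    (hle : ∀ a, T a ≤ T' a) : RP M e F := ⟨T', hT, h.mono hle⟩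

lemma RP.reindex (h : RP M e F) (π : γ → α) :
    RP (fun c => M (π c)) (fun c => e (π c)) fun c => F (π c) := by
  obtain ⟨T, hT, hc⟩ := h
  exact ⟨_, hT.reindex π, hc.reindex π⟩

lemma DataP.expr (ex : Data → Data) (E : ℕ → Expr) (hE : ∀ b s, (E b).eval s = ex (s b)) :
    DataP M e fun a => ex (e a) :=
  RP.of_comp (Comp.expr ex E hE) (.const 1) fun _ => by simp

lemma DataP.env : DataP M e e := DataP.expr id (fun b => .var b) fun _ _ => rfl

lemma RP.comp {φ : α → Data} (hφ : DataP M e φ) (hF : RP M φ F) : RP M e F := by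
  obtain ⟨T, hT, hc⟩ := hφ
  obtain ⟨T', hT', hc'⟩ := hF
  refine RP.of_comp (Comp.comp hc hc') (((PolyB.const 1).add hT).add hT') fun a => ?_
  push_cast
  rfl

lemma RP.extend {φ : α → Data} (hφ : DataP M e φ) (hF : RP M (fun a => .cons (φ a) (e a)) F) :
    RP M e F := by
  obtain ⟨T, hT, hc⟩ := hφ
  obtain ⟨T', hT', hc'⟩ := hF
  refine RP.of_comp (Comp.extend hc hc') (((PolyB.const 5).add hT).add hT') fun a => ?_
  push_cast
  rfl

/-- The size parameter depends on the input `a` only, so the second program has the same time bound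
for every random intermediate value, and the expectation over that value disappears. -/
lemma RP.bind {H : α → Data → PMF Data} (hF : RP M e F)
    (hH : RP (fun t : α × Data => M t.1) (fun t => .cons t.2 (e t.1)) fun t => H t.1 t.2) :
    RP M e fun a => (F a).bind (H a) := by
  obtain ⟨T, hT, hc⟩ := hF
  obtain ⟨T', ⟨d, hd⟩, hc'⟩ := hH
  refine RP.of_comp (Comp.bind (T' := fun a x => T' (a, x)) hc hc')
    (((PolyB.const 5).add hT).add ⟨d, fun a => le_rfl⟩) fun a => ?_
  push_cast
  gcongr
  refine (expect_mono (ψ := fun _ => (((M a + 2) ^ d : ℕ) : ℝ≥0∞)) fun x => ?_).trans ?_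
  · exact_mod_cast hd (a, x)
  · rw [expect_const]
    push_cast
    rfl

lemma RP.lift (h : RP M e F) {e' : γ → Data} (π : γ → α) (he : ∀ c, (e' c).tl = e (π c)) :
    RP (fun c => M (π c)) e' fun c => F (π c) :=
  RP.comp (φ := fun c => e (π c))
    (by simpa only [he] using
      DataP.expr (M := fun c => M (π c)) (e := e') Data.tl (fun b => .tl (.var b)) fun _ _ => rfl)
    (h.reindex π)

lemma RP.ite {φ : α → Data} {G : α → PMF Data} (hφ : DataP M e φ) (hF : RP M e F)
    (hG : RP M e G) : RP M e fun a => if (φ a).toBool then F a else G a := by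
  obtain ⟨T, hT, hc⟩ := hφ
  obtain ⟨T', hT', hc'⟩ := hF
  obtain ⟨T'', hT'', hc''⟩ := hG
  refine RP.of_comp (Comp.ite (T' := fun a => (T' a : ℝ≥0∞) + T'' a) hc
    ((hc'.reindex Subtype.val).mono fun _ => le_self_add)
    ((hc''.reindex Subtype.val).mono fun _ => le_add_self))
    (((PolyB.const 4).add hT).add (hT'.add hT'')) fun a => ?_
  push_cast
  rfl

lemma toBool_ofBool (b : Bool) : (Data.ofBool b).toBool = b := by
  cases b <;> rfl

lemma ofBool_injective : Function.Injective Data.ofBool := fun a b h => by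
  rw [← toBool_ofBool a, h, toBool_ofBool]

open Classical in
lemma RP.ite_prop {P : α → Prop} {G : α → PMF Data} (hP : BoolP M e P) (hF : RP M e F)
    (hG : RP M e G) : RP M e fun a => if P a then F a else G a := by
  have := RP.ite hP hF hG
  simpa only [toBool_ofBool, decide_eq_true_eq] using this

open Classical in
lemma DataP.ite {P : α → Prop} {φ ψ : α → Data} (hP : BoolP M e P) (hφ : DataP M e φ)
    (hψ : DataP M e ψ) : DataP M e fun a => if P a then φ a else ψ a := by
  have h := RP.ite_prop hP hφ hψ
  refine Eq.mp (congrArg (RP M e) (funext fun a => ?_)) h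
  by_cases ha : P a <;> simp [ha]

section Data

variable {φ ψ : α → Data}

lemma DataP.comp_expr (hφ : DataP M e φ) (ex : Data → Data) (E : ℕ → Expr)
    (hE : ∀ b s, (E b).eval s = ex (s b)) : DataP M e fun a => ex (φ a) :=
  RP.comp hφ (DataP.expr ex E hE)

lemma DataP.hd (hφ : DataP M e φ) : DataP M e fun a => (φ a).hd :=
  hφ.comp_expr Data.hd (fun b => .hd (.var b)) fun _ _ => rfl

lemma DataP.tl (hφ : DataP M e φ) : DataP M e fun a => (φ a).tl :=
  hφ.comp_expr Data.tl (fun b => .tl (.var b)) fun _ _ => rfl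

lemma DataP.nil : DataP M e fun _ => .nil := DataP.expr (fun _ => .nil) (fun _ => .nil) fun _ _ => rfl

lemma DataP.cons (hφ : DataP M e φ) (hψ : DataP M e ψ) : DataP M e fun a => .cons (φ a) (ψ a) := by
  refine RP.extend hφ (RP.extend (φ := ψ) (RP.lift hψ id fun _ => rfl) ?_)
  exact DataP.expr (e := fun a => .cons (ψ a) (.cons (φ a) (e a)))
    (fun x => .cons x.tl.hd x.hd) (fun b => .cons (.hd (.tl (.var b))) (.hd (.var b)))
    fun _ _ => rfl

lemma DataP.ofBool (b : Bool) : DataP M e fun _ => Data.ofBool b := by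
  cases b
  · exact DataP.nil
  · exact DataP.cons DataP.nil DataP.nil

lemma DataP.congr (h : DataP M e φ) (h' : ∀ a, φ a = ψ a) : DataP M e ψ := by
  rwa [funext h'] at h

end Data

lemma RP.flip : RP M e fun _ => (PMF.uniformOfFintype Bool).map Data.ofBool :=
  RP.of_comp Comp.flip (.const 1) fun _ => by simp

/-- Post-processing of a random value. -/
lemma RP.map {h : α → Data → Data} (hF : RP M e F)
    (hh : DataP (fun t : α × Data => M t.1) (fun t => .cons t.2 (e t.1)) fun t => h t.1 t.2) :
    RP M e fun a => (F a).map (h a) := RP.bind (H := fun a x => PMF.pure (h a x)) hF hh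

/-! ### Loops -/

/-- The sequence `st` prescribes all intermediate states. The invariant that the state equals `st a
i` means that the body has to be correct and fast only on states that occur. -/
lemma DataP.natRec {N : α → ℕ} (st : α → ℕ → Data) (hN : NatP M e N)
    (h0 : DataP M e fun a => st a 0)
    (hs : DataP (fun t : Idx N => M t.1.1)
      (fun t => .cons (.ofUnary t.1.2) (.cons (st t.1.1 t.1.2) (e t.1.1)))
      fun t => st t.1.1 (t.1.2 + 1)) :
    DataP M e fun a => st a (N a) := by
  obtain ⟨⟨TN, hTN, hcN⟩, hNb⟩ := hN
  obtain ⟨T0, hT0, hc0⟩ := h0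
  obtain ⟨T', ⟨d, hd⟩, hc'⟩ := hs
  have h := Comp.natRec_of (F := fun a i _ => PMF.pure (st a (i + 1)))
    (P := fun a i x => x = st a i) (T := fun a _ _ => (((M a + 2) ^ d : ℕ) : ℝ≥0∞))
    (V := fun a i _ => (((N a - i) * (10 + (M a + 2) ^ d) : ℕ) : ℝ≥0∞)) hcN
    (fun a => ulen_ofUnary _) hc0 hc'
    (by
      intro a i x hi hx
      exact ⟨⟨(a, i), hi⟩, by rw [hx], rfl, by exact_mod_cast hd ⟨(a, i), hi⟩⟩)
    (fun a => rfl)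
    (by
      intro a i x hi hx y hy
      rwa [PMF.mem_support_pure_iff] at hy)
    (by
      intro a i x hi hx
      rw [expect_pure]
      have : N a - i = N a - (i + 1) + 1 := by omega
      rw [this, add_mul, one_mul]
      push_cast
      refine le_of_eq ?_
      ring)
  have hres : ∀ a, ∀ r i, iterate (fun i (_ : Data) => PMF.pure (st a (i + 1))) r i (st a i)
      = PMF.pure (st a (i + r)) := by
    intro a r
    induction r with
    | zero => intro i; rfl
    | succ r ih =>
      intro i
      rw [iterate, PMF.pure_bind, ih (i + 1)]
      congr 2
      omega
  simp only [hres, zero_add] at h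
  refine RP.of_comp h (((PolyB.const 11).add hTN |>.add hT0).add
    (hNb.mul ((PolyB.const 10).add (((PolyB.self).add (.const 2)).pow d)))) fun a => ?_
  push_cast
  simp

/-- A loop with a random body; the state ranges over an encoded type. -/
lemma RP.natRec {β : Type*} {N : α → ℕ} {enc : β → Data} (henc : Function.Injective enc)
    {x0 : α → β} {G : α → ℕ → β → PMF β} (hN : NatP M e N) (h0 : DataP M e fun a => enc (x0 a))
    (hs : RP (fun t : Idx N × β => M t.1.1.1)
      (fun t => .cons (.ofUnary t.1.1.2) (.cons (enc t.2) (e t.1.1.1)))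
      fun t => (G t.1.1.1 t.1.1.2 t.2).map enc) :
    RP M e fun a => (iterate (G a) (N a) 0 (x0 a)).map enc := by
  obtain ⟨⟨TN, hTN, hcN⟩, hNb⟩ := hN
  obtain ⟨T0, hT0, hc0⟩ := h0
  obtain ⟨T', ⟨d, hd⟩, hc'⟩ := hs
  have h := Comp.natRec henc (F := G) (T := fun a _ _ => (((M a + 2) ^ d : ℕ) : ℝ≥0∞)) hcN
    (fun a => ulen_ofUnary _) hc0 (hc'.mono fun t => by exact_mod_cast hd t)
  refine RP.of_comp h (((PolyB.const 11).add hTN |>.add hT0).add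
    (hNb.mul ((PolyB.const 10).add (((PolyB.self).add (.const 2)).pow d)))) fun a => ?_
  have := loopTime_le (F := G a) (T := fun _ _ => (((M a + 2) ^ d : ℕ) : ℝ≥0∞))
    (V := fun i _ => (((N a - i) * (10 + (M a + 2) ^ d) : ℕ) : ℝ≥0∞)) (N a) 0 (x0 a) (by
      intro i x _ hi
      rw [expect_const]
      have : N a - i = N a - (i + 1) + 1 := by omega
      rw [this, add_mul, one_mul]
      push_cast
      refine le_of_eq ?_
      ring)
  simp only [Nat.sub_zero] at this
  push_cast at this ⊢
  gcongr

/-! ### Arithmetic -/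

variable {f g N : α → ℕ} {P Q : α → Prop} {φ : α → Data}

lemma RP.up (h : RP M e F) (N : α → ℕ) :
    RP (fun t : Idx N => M t.1.1) (withIdx e N) fun t => F t.1.1 :=
  h.lift (fun t : Idx N => t.1.1) fun _ => rfl

lemma DataP.up (h : DataP M e φ) (N : α → ℕ) :
    DataP (fun t : Idx N => M t.1.1) (withIdx e N) fun t => φ t.1.1 := RP.up h N

lemma NatP.up (h : NatP M e f) (N : α → ℕ) :
    NatP (fun t : Idx N => M t.1.1) (withIdx e N) fun t => f t.1.1 :=
  ⟨RP.up h.1 N, h.2.reindex _⟩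

lemma NatP.idx (hN : PolyB M N) :
    NatP (fun t : Idx N => M t.1.1) (withIdx e N) fun t => t.1.2 :=
  ⟨DataP.env.hd, (hN.reindex fun t : Idx N => t.1.1).of_le fun t => t.2.le⟩

lemma NatP.congr (h : NatP M e f) (h' : ∀ a, f a = g a) : NatP M e g := by
  rwa [funext h'] at h

lemma BoolP.congr (h : BoolP M e P) (h' : ∀ a, P a ↔ Q a) : BoolP M e Q := by
  rwa [funext fun a => propext (h' a)] at h

lemma NatP.zero : NatP M e fun _ => 0 := ⟨DataP.nil, .const 0⟩

lemma NatP.succ (h : NatP M e f) : NatP M e fun a => f a + 1 :=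
  ⟨DataP.cons DataP.nil h.1, h.2.add (.const 1)⟩

lemma NatP.const (c : ℕ) : NatP M e fun _ => c := by
  induction c with
  | zero => exact NatP.zero
  | succ c ih => exact ih.succ

lemma NatP.pred (h : NatP M e f) : NatP M e fun a => f a - 1 := by
  refine ⟨h.1.tl.congr fun a => ?_, h.2.of_le fun a => Nat.sub_le _ _⟩
  show (Data.ofUnary (f a)).tl = Data.ofUnary (f a - 1)
  cases f a <;> rfl

/-- Bounded recursion on numbers. -/
lemma NatP.natRec (st : α → ℕ → ℕ) (hN : NatP M e N) (h0 : NatP M e fun a => st a 0)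
    (hb : PolyB (fun t : Idx N => M t.1.1) fun t => st t.1.1 t.1.2)
    (hb' : PolyB M fun a => st a (N a))
    (hs : ∀ (e' : Idx N → Data), (∀ t, (e' t).tl = withIdx e N t) →
      NatP (fun t : Idx N => M t.1.1) e' (fun t => st t.1.1 t.1.2) →
      NatP (fun t : Idx N => M t.1.1) e' fun t => st t.1.1 (t.1.2 + 1)) :
    NatP M e fun a => st a (N a) := by
  refine ⟨DataP.natRec (fun a i => .ofUnary (st a i)) hN h0.1 ?_, hb'⟩
  have h1 := (hs (fun t => .cons (.ofUnary (st t.1.1 t.1.2)) (withIdx e N t)) (fun _ => rfl)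
    ⟨DataP.env.hd, hb⟩).1
  exact RP.comp (DataP.env.tl.hd.cons (DataP.env.hd.cons DataP.env.tl.tl)) h1

lemma NatP.add (hf : NatP M e f) (hg : NatP M e g) : NatP M e fun a => f a + g a := by
  refine NatP.natRec (fun a i => f a + i) hg hf ?_ (hf.2.add hg.2) fun e' _ h => h.succ
  exact ((hf.2.reindex _).add (hg.2.reindex _)).of_le fun t => Nat.add_le_add_left t.2.le _

lemma NatP.lift (h : NatP M e f) {e' : γ → Data} (π : γ → α) (he : ∀ c, (e' c).tl = e (π c)) :
    NatP (fun c => M (π c)) e' fun c => f (π c) := ⟨RP.lift h.1 π he, h.2.reindex π⟩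

lemma NatP.mul (hf : NatP M e f) (hg : NatP M e g) : NatP M e fun a => f a * g a := by
  refine NatP.natRec (fun a i => f a * i) hg NatP.zero ?_ (hf.2.mul hg.2) fun e' he h => ?_
  · exact ((hf.2.reindex _).mul (hg.2.reindex _)).of_le fun t => Nat.mul_le_mul_left _ t.2.le
  · exact (h.add ((hf.up g).lift id he)).congr fun t => by simp [mul_add]

lemma NatP.sub (hf : NatP M e f) (hg : NatP M e g) : NatP M e fun a => f a - g a := by
  refine NatP.natRec (fun a i => f a - i) hg hf ?_ (hf.2.of_le fun a => Nat.sub_le _ _)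
    fun e' he h => h.pred
  exact (hf.2.reindex _).of_le fun t => Nat.sub_le _ _

lemma NatP.pow (hf : NatP M e f) (hg : NatP M e g) (hb : PolyB M fun a => f a ^ g a) :
    NatP M e fun a => f a ^ g a := by
  -- An intermediate power can exceed the final one only for base zero, where the zeroth power is
  -- one; hence the extra unit.
  have hb1 : PolyB M fun a => f a ^ g a + 1 := hb.add (.const 1)
  refine NatP.natRec (fun a i => f a ^ i) hg (NatP.const 1) ?_ hb fun e' he h => ?_
  · refine (hb1.reindex fun t : Idx g => t.1.1).of_le fun t => ?_
    rcases Nat.eq_zero_or_pos (f t.1.1) with h0 | h0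
    · rw [h0]
      rcases Nat.eq_zero_or_pos t.1.2 with h1 | h1
      · simp [h1]
      · simp [Nat.ne_of_gt h1]
    · exact (Nat.pow_le_pow_right h0 t.2.le).trans (Nat.le_succ _)
  · exact (h.mul ((hf.up g).lift id he)).congr fun t => by simp [pow_succ]

lemma BoolP.of_toBool (hφ : DataP M e φ) : BoolP M e fun a => (φ a).toBool = true := by
  have := RP.ite hφ (DataP.ofBool (M := M) (e := e) true) (DataP.ofBool (M := M) (e := e) false)
  refine Eq.mp (congrArg (RP M e) (funext fun a => ?_)) this
  by_cases ha : (φ a).toBool = true <;> simp [ha]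

lemma toBool_ofUnary (n : ℕ) : (Data.ofUnary n).toBool = true ↔ 0 < n := by
  cases n
  · simp [ofUnary_zero, Data.toBool]
  · simp [ofUnary_succ, Data.toBool]

lemma BoolP.lt (hf : NatP M e f) (hg : NatP M e g) : BoolP M e fun a => f a < g a :=
  (BoolP.of_toBool (hg.sub hf).1).congr fun a => by
    rw [toBool_ofUnary]
    exact Nat.sub_pos_iff_lt

lemma BoolP.le (hf : NatP M e f) (hg : NatP M e g) : BoolP M e fun a => f a ≤ g a :=
  (BoolP.lt hf hg.succ).congr fun a => by omega

lemma BoolP.and (hP : BoolP M e P) (hQ : BoolP M e Q) : BoolP M e fun a => P a ∧ Q a := by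
  classical
  refine DataP.congr (DataP.ite hP hQ (DataP.ofBool false)) fun a => ?_
  by_cases h : P a <;> simp [h]

lemma BoolP.not (hP : BoolP M e P) : BoolP M e fun a => ¬ P a := by
  classical
  refine DataP.congr (DataP.ite hP (DataP.ofBool false) (DataP.ofBool true)) fun a => ?_
  by_cases h : P a <;> simp [h]

lemma BoolP.or (hP : BoolP M e P) (hQ : BoolP M e Q) : BoolP M e fun a => P a ∨ Q a :=
  (hP.not.and hQ.not).not.congr fun a => by tauto

lemma BoolP.eq (hf : NatP M e f) (hg : NatP M e g) : BoolP M e fun a => f a = g a :=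
  ((BoolP.le hf hg).and (BoolP.le hg hf)).congr fun a => by omega

lemma NatP.ite (hP : BoolP M e P) (hf : NatP M e f) (hg : NatP M e g) [DecidablePred P] :
    NatP M e fun a => if P a then f a else g a := by
  classical
  refine ⟨(DataP.ite hP hf.1 hg.1).congr fun a => ?_, (hf.2.add hg.2).of_le fun a => ?_⟩
  · by_cases h : P a <;> simp [h]
  · by_cases h : P a <;> simp [h]

lemma BoolP.ball {R : α → ℕ → Prop} (hN : NatP M e N)
    (hR : BoolP (fun t : Idx N => M t.1.1) (withIdx e N) fun t => R t.1.1 t.1.2) :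
    BoolP M e fun a => ∀ i < N a, R a i := by
  classical
  refine DataP.congr (DataP.natRec (fun a i => .ofBool (decide (∀ j < i, R a j))) hN
    ((DataP.ofBool true).congr fun a => by simp) ?_) fun a => by congr
  have hst := BoolP.of_toBool (DataP.env (M := fun t : Idx N => M t.1.1)
    (e := fun t : Idx N => .cons (.ofUnary t.1.2)
      (.cons (.ofBool (decide (∀ j < t.1.2, R t.1.1 j))) (e t.1.1)))).tl.hd
  have hR' := RP.comp (e := fun t : Idx N => .cons (.ofUnary t.1.2)
      (.cons (.ofBool (decide (∀ j < t.1.2, R t.1.1 j))) (e t.1.1)))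
      (DataP.env.hd.cons DataP.env.tl.tl) hR
  refine DataP.congr (BoolP.and hst hR') fun t => ?_
  congr 1
  simp only [Data.tl, Data.hd, toBool_ofBool, decide_eq_true_eq]
  rw [decide_eq_decide, Nat.forall_lt_succ_right]

lemma BoolP.bex {R : α → ℕ → Prop} (hN : NatP M e N)
    (hR : BoolP (fun t : Idx N => M t.1.1) (withIdx e N) fun t => R t.1.1 t.1.2) :
    BoolP M e fun a => ∃ i < N a, R a i :=
  (BoolP.ball (R := fun a i => ¬ R a i) hN hR.not).not.congr fun a => by push Not; rfl

lemma NatP.sum {h : α → ℕ → ℕ} (hN : NatP M e N)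
    (hh : NatP (fun t : Idx N => M t.1.1) (withIdx e N) fun t => h t.1.1 t.1.2) :
    NatP M e fun a => ∑ i ∈ Finset.range (N a), h a i := by
  obtain ⟨d, hd⟩ := hh.2
  have hbd : ∀ a, ∀ i ≤ N a, ∑ j ∈ Finset.range i, h a j ≤ N a * (M a + 2) ^ d := by
    intro a i hi
    refine (Finset.sum_le_card_nsmul _ _ ((M a + 2) ^ d) fun j hj => ?_).trans ?_
    · exact hd ⟨(a, j), (Finset.mem_range.1 hj).trans_le hi⟩
    · rw [Finset.card_range, smul_eq_mul]
      exact Nat.mul_le_mul_right _ hi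
  have hP : PolyB M fun a => N a * (M a + 2) ^ d := hN.2.mul ((PolyB.self.add (.const 2)).pow d)
  refine NatP.natRec (fun a i => ∑ j ∈ Finset.range i, h a j) hN
    (NatP.zero.congr fun a => by simp) ?_ (hP.of_le fun a => hbd a _ le_rfl) fun e' he hst => ?_
  · exact (hP.reindex fun t : Idx N => t.1.1).of_le fun t => hbd _ _ t.2.le
  · exact (hst.add (hh.lift id he)).congr fun t => by simp [Finset.sum_range_succ]

/-- The quotient is the number of `i < f a` with `(i + 1) * g a ≤ f a`. Divisor zero is treated
apart, since the count would then be `f a` instead of zero. -/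
lemma NatP.div (hf : NatP M e f) (hg : NatP M e g) : NatP M e fun a => f a / g a := by
  have hcount := NatP.sum (h := fun a i => if (i + 1) * g a ≤ f a then 1 else 0) hf
    (NatP.ite (BoolP.le ((NatP.idx hf.2).succ.mul (hg.up f)) (hf.up f)) (NatP.const 1)
      (NatP.const 0))
  refine (NatP.ite (BoolP.lt (NatP.const 0) hg) hcount (NatP.const 0)).congr fun a => ?_
  split_ifs with h
  · rw [← Finset.sum_filter, Finset.sum_const, smul_eq_mul, mul_one]
    have : (Finset.range (f a)).filter (fun i => (i + 1) * g a ≤ f a) = Finset.range (f a / g a) := by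
      ext i
      rw [Finset.mem_filter, Finset.mem_range, Finset.mem_range, ← Nat.le_div_iff_mul_le h,
        Nat.succ_le_iff]
      exact ⟨fun h => h.2, fun h' => ⟨h'.trans_le (Nat.div_le_self _ _), h'⟩⟩
    rw [this, Finset.card_range]
  · rw [Nat.eq_zero_of_not_pos h, Nat.div_zero]

lemma NatP.mod (hf : NatP M e f) (hg : NatP M e g) : NatP M e fun a => f a % g a :=
  (hf.sub (hg.mul (hf.div hg))).congr fun a => by
    have := Nat.div_add_mod (f a) (g a)
    omega

lemma NatP.min (hf : NatP M e f) (hg : NatP M e g) : NatP M e fun a => min (f a) (g a) :=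
  (NatP.ite (BoolP.le hf hg) hf hg).congr fun a => by rw [min_def]

/-! ### Lists -/

/-- The list itself is the loop counter: a loop consumes the right spine of its counter, whatever
the entries are. The state records the number of completed rounds. -/
lemma NatP.length (hφ : DataP M e φ) (hb : PolyB M fun a => ulen (φ a)) :
    NatP M e fun a => ulen (φ a) := by
  refine ⟨?_, hb⟩
  obtain ⟨T, hT, hc⟩ := hφ
  have h := Comp.natRec_of (e := e) (N := fun a => ulen (φ a)) (x0 := fun _ => .nil)
    (F := fun _ i _ => PMF.pure (.ofUnary (i + 1)))
    (P := fun _ i x => x = .ofUnary i) (T := fun _ _ _ => 1)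
    (V := fun a i _ => (((ulen (φ a) - i) * 11 : ℕ) : ℝ≥0∞)) hc (fun _ => rfl)
    (Comp.expr (fun _ => .nil) (fun _ => .nil) fun _ _ => rfl)
    (Comp.expr (e := fun t : α × ℕ => .cons (.ofUnary t.2) (.cons (.ofUnary t.2) (e t.1)))
      (fun x => .cons .nil x.hd) (fun b => .cons .nil (.hd (.var b))) fun _ _ => rfl)
    (by
      rintro a i _ hi rfl
      exact ⟨(a, i), rfl, rfl, le_rfl⟩)
    (fun a => rfl)
    (by
      intro a i x hi hx y hy
      rwa [PMF.mem_support_pure_iff] at hy)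
    (by
      intro a i x hi hx
      rw [expect_pure]
      have : ulen (φ a) - i = ulen (φ a) - (i + 1) + 1 := by omega
      rw [this, add_mul, one_mul]
      push_cast
      refine le_of_eq ?_
      ring)
  have hres : ∀ r i, iterate (fun i (_ : Data) => PMF.pure (.ofUnary (i + 1))) r i (.ofUnary i)
      = PMF.pure (.ofUnary (i + r)) := by
    intro r
    induction r with
    | zero => intro i; rfl
    | succ r ih =>
      intro i
      rw [iterate, PMF.pure_bind, ih (i + 1)]
      congr 2
      omega
  have h0 := fun a => hres (ulen (φ a)) 0
  simp only [ofUnary_zero, zero_add] at h0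
  simp only [h0] at h
  refine RP.of_comp h (((PolyB.const 11).add hT |>.add (.const 1)).add
    (hb.mul (.const 11))) fun a => ?_
  push_cast
  simp


/-- The entry with number `i` of a list. -/
def nth (i : ℕ) (x : Data) : Data := (Data.tl^[i] x).hd

lemma DataP.nth (hf : NatP M e f) (hφ : DataP M e φ) : DataP M e fun a => nth (f a) (φ a) := by
  refine DataP.hd (φ := fun a => Data.tl^[f a] (φ a)) ?_
  refine DataP.natRec (fun a i => Data.tl^[i] (φ a)) hf hφ ?_
  refine (DataP.env.tl.hd.tl).congr fun t => ?_
  rw [Function.iterate_succ_apply']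
  rfl

lemma nth_ofList (l : List Data) (i : ℕ) : nth i (.ofList l) = l.getD i .nil := by
  induction l generalizing i with
  | nil =>
    have : Data.tl^[i] .nil = Data.nil := by
      induction i with
      | zero => rfl
      | succ i ih => rw [Function.iterate_succ_apply']; rw [ih]; rfl
    simp [DSNHardness.nth, Data.ofList, this, Data.hd]
  | cons x l ih =>
    cases i with
    | zero => rfl
    | succ i =>
      rw [List.getD_cons_succ, ← ih]
      rfl

/-- The list of the values of `φ` below `N`. -/
def tabulate (N : ℕ) (φ : ℕ → Data) : Data := .ofList ((List.range N).map φ)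

lemma DataP.tabulate {φ : α → ℕ → Data} (hN : NatP M e N)
    (hφ : DataP (fun t : Idx N => M t.1.1) (withIdx e N) fun t => φ t.1.1 t.1.2) :
    DataP M e fun a => tabulate (N a) (φ a) := by
  -- Lists grow at the head, so after `i` rounds the state holds the last `i` values, and round `i`
  -- evaluates `φ` at `N a - i - 1`.
  have key := DataP.natRec
    (fun a i => Data.ofList ((List.range i).map fun j => φ a (N a - i + j))) hN DataP.nil ?_
  · simpa [DSNHardness.tabulate] using key
  · set e' : Idx N → Data := fun t => .cons (.ofUnary t.1.2)
      (.cons (Data.ofList ((List.range t.1.2).map fun j => φ t.1.1 (N t.1.1 - t.1.2 + j)))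
        (e t.1.1)) with he'
    have hi : NatP (fun t : Idx N => M t.1.1) e' fun t => t.1.2 :=
      ⟨DataP.env.hd, (NatP.idx (e := e) hN.2).2⟩
    have hN' : NatP (fun t : Idx N => M t.1.1) e' fun t => N t.1.1 :=
      ⟨RP.comp DataP.env.tl.tl (hN.1.reindex fun t : Idx N => t.1.1), hN.2.reindex _⟩
    have hidx := (hN'.sub hi).pred
    have hcall := RP.comp (hidx.1.cons DataP.env.tl.tl)
      (hφ.reindex fun t : Idx N => (⟨(t.1.1, N t.1.1 - t.1.2 - 1), by
        have := t.2
        show N t.1.1 - t.1.2 - 1 < N t.1.1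
        omega⟩ : Idx N))
    refine DataP.congr (DataP.cons hcall DataP.env.tl.hd) fun t => ?_
    have ht := t.2
    rw [List.range_succ_eq_map, List.map_cons, List.map_map]
    show Data.cons _ _ = Data.cons _ _
    congr 1
    · simp only [he', Data.tl, Data.hd]
      congr 1
      refine List.map_congr_left fun j _ => ?_
      simp only [Function.comp]
      congr 1
      omega

end RP

/-! ### Running a program with a clock -/

/-- The law of a `while` loop that is left once the clock has run down; every round costs one
unit.  `n` is the maximal number of rounds. -/
def loopLaw (e : Expr) (D : Store → ℕ → PMF (Store × ℕ)) : ℕ → Store → ℕ → PMF (Store × ℕ)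
  | 0, s, m => PMF.pure (s, m)
  | n + 1, s, m =>
      if (e.eval s).toBool = true ∧ 0 < m then
        (D s m).bind fun r => loopLaw e D n r.1 (r.2 - 1)
      else PMF.pure (s, m)

/-- The law of the final store and the final clock of a program run with a clock. -/
def clockLaw : Prog → Store → ℕ → PMF (Store × ℕ)
  | .assign x e, s, m => PMF.pure (Function.update s x (e.eval s), m)
  | .flip x, s, m =>
      (PMF.uniformOfFintype Bool).map fun b => (Function.update s x (Data.ofBool b), m)
  | .seq p q, s, m => (clockLaw p s m).bind fun r => clockLaw q r.1 r.2
  | .ite e p q, s, m => if (e.eval s).toBool then clockLaw p s m else clockLaw q s m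
  | .loop e p, s, m => loopLaw e (clockLaw p) m s m

lemma loopLaw_clock_le {e : Expr} {D : Store → ℕ → PMF (Store × ℕ)}
    (hD : ∀ s m, ∀ r ∈ (D s m).support, r.2 ≤ m) (n : ℕ) :
    ∀ s m, ∀ r ∈ (loopLaw e D n s m).support, r.2 ≤ m := by
  induction n with
  | zero =>
    intro s m r hr
    rw [loopLaw, PMF.mem_support_pure_iff] at hr
    rw [hr]
  | succ n ih =>
    intro s m r hr
    rw [loopLaw] at hr
    split_ifs at hr with h
    · obtain ⟨r', hr', h2⟩ := (PMF.mem_support_bind_iff _ _ _).1 hr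
      have h3 := ih _ _ _ h2
      have h4 := hD _ _ _ hr'
      omega
    · rw [PMF.mem_support_pure_iff] at hr
      rw [hr]

lemma clockLaw_clock_le (p : Prog) : ∀ s m, ∀ r ∈ (clockLaw p s m).support, r.2 ≤ m := by
  induction p with
  | assign x e =>
    intro s m r hr
    rw [clockLaw, PMF.mem_support_pure_iff] at hr
    rw [hr]
  | flip x =>
    intro s m r hr
    rw [clockLaw] at hr
    obtain ⟨c, -, rfl⟩ := (PMF.mem_support_map_iff _ _ _).1 hr
    rfl
  | seq p q hp hq =>
    intro s m r hr
    rw [clockLaw] at hr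
    obtain ⟨r', hr', h2⟩ := (PMF.mem_support_bind_iff _ _ _).1 hr
    exact (hq _ _ _ h2).trans (hp _ _ _ hr')
  | ite e p q hp hq =>
    intro s m r hr
    rw [clockLaw] at hr
    split_ifs at hr
    · exact hp _ _ _ hr
    · exact hq _ _ _ hr
  | loop e p hp => exact fun s m => loopLaw_clock_le hp m s m

/-- As long as the clock has more than `d + t` units left, `Φ` bounds the probability of halting
within `t` steps. -/
def Dominates (S : Set Data) (d T : ℕ) (K : List Prog) (Φ : Store → ℕ → ℝ≥0∞) : Prop :=
  ∀ t ≤ T, ∀ s m, t + d ≤ m → haltProb S t ⟨K, s⟩ ≤ Φ s m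

/-- Induction on the program. The offset `d` reserves clock units for the decrements that are still
due when the bodies of enclosing loops end. Entering a loop body costs one real step, and this step
pays for raising `d` by one; hence a run of `t` steps never exhausts a clock of `t + d` units. -/
lemma Dominates.cons {S : Set Data} (p : Prog) : ∀ {d T : ℕ} {K : List Prog}
    {Φ : Store → ℕ → ℝ≥0∞}, Dominates S d T K Φ →
    Dominates S d T (p :: K) fun s m => expect (clockLaw p s m) fun r => Φ r.1 r.2 := by
  induction p with
  | assign x e =>
    intro d T K Φ h t ht s m hm
    cases t with
    | zero => rw [haltProb_zero]; exact zero_le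
    | succ t =>
      show haltProb S (t + 1) _ ≤ expect (clockLaw _ s m) _
      rw [haltProb_succ, step, expect_pure, clockLaw, expect_pure]
      exact h t (by omega) _ _ (by omega)
  | flip x =>
    intro d T K Φ h t ht s m hm
    cases t with
    | zero => rw [haltProb_zero]; exact zero_le
    | succ t =>
      show haltProb S (t + 1) _ ≤ expect (clockLaw _ s m) _
      rw [haltProb_succ, step, expect_map, clockLaw, expect_map]
      exact expect_mono fun c => h t (by omega) _ _ (by omega)
  | seq p q hp hq =>
    intro d T K Φ h t ht s m hm
    cases t with
    | zero => rw [haltProb_zero]; exact zero_le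
    | succ t =>
      show haltProb S (t + 1) _ ≤ expect (clockLaw _ s m) _
      rw [haltProb_succ, step, expect_pure, clockLaw, expect_bind]
      exact hp (hq h) t (by omega) _ _ (by omega)
  | ite e p q hp hq =>
    intro d T K Φ h t ht s m hm
    cases t with
    | zero => rw [haltProb_zero]; exact zero_le
    | succ t =>
      show haltProb S (t + 1) _ ≤ expect (clockLaw _ s m) _
      rw [haltProb_succ, step, expect_pure, clockLaw]
      split_ifs
      · exact hp h t (by omega) _ _ (by omega)
      · exact hq h t (by omega) _ _ (by omega)
  | loop e p hp =>
    intro d T K Φ h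
    -- The cap `n` on the number of rounds is kept apart from the clock `m`, since an inner loop may
    -- lower the clock by any amount. As every round takes a real step, `t ≤ n` is enough.
    have key : ∀ t ≤ T, ∀ n, t ≤ n → ∀ s m, t + d ≤ m →
        haltProb S t ⟨.loop e p :: K, s⟩ ≤
          expect (loopLaw e (clockLaw p) n s m) fun r => Φ r.1 r.2 := by
      intro t
      induction t using Nat.strong_induction_on with
      | _ t ih =>
        intro ht n hn s m hm
        cases t with
        | zero => rw [haltProb_zero]; exact zero_le
        | succ t =>
          obtain ⟨n, rfl⟩ : ∃ n', n = n' + 1 := ⟨n - 1, by omega⟩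
          rw [haltProb_succ, step, expect_pure, loopLaw]
          by_cases he : (e.eval s).toBool = true
          · rw [if_pos he, if_pos (show _ ∧ _ from ⟨he, by omega⟩), expect_bind]
            refine hp (d := d + 1) (T := t) (K := .loop e p :: K)
              (Φ := fun s m => expect (loopLaw e (clockLaw p) n s (m - 1)) fun r => Φ r.1 r.2)
              ?_ t le_rfl s m (by omega)
            intro t' ht' s' m' hm'
            exact ih t' (by omega) (by omega) n (by omega) s' (m' - 1) (by omega)
          · rw [if_neg he, if_neg (show ¬ (_ ∧ _) from fun h => he h.1), expect_pure]
            exact h t (by omega) _ _ (by omega)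
    intro t ht s m hm
    exact key t ht m (by omega) s m hm

/-! ### Compiling the clock -/

/-- Rename the variables. -/
def shiftExpr (c : ℕ) : Expr → Expr
  | .var x => .var (c + x)
  | .nil => .nil
  | .cons a b => .cons (shiftExpr c a) (shiftExpr c b)
  | .hd a => .hd (shiftExpr c a)
  | .tl a => .tl (shiftExpr c a)

/-- A strict bound for the variables of an expression. -/
def exprBound : Expr → ℕ
  | .var x => x + 1
  | .nil => 0
  | .cons a b => max (exprBound a) (exprBound b)
  | .hd a => exprBound a
  | .tl a => exprBound a

/-- A strict bound for the variables of a program. -/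
def progBound : Prog → ℕ
  | .assign x e => max (x + 1) (exprBound e)
  | .flip x => x + 1
  | .seq p q => max (progBound p) (progBound q)
  | .ite e p q => max (exprBound e) (max (progBound p) (progBound q))
  | .loop e p => max (exprBound e) (progBound p)

/-- Set the flag (register `t + 1`) if the condition holds and the clock (register `t`) has not run
down. -/
def setFlag (t : ℕ) (e : Expr) : Prog :=
  -- The clock itself is copied into the flag: a tree counts as true exactly when its right spine is
  -- nonempty.
  .ite (shiftExpr (t + 2) e) (.assign (t + 1) (.var t)) (.assign (t + 1) .nil)

/-- The body of a clocked loop. -/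
def clockedBody (t : ℕ) (e : Expr) (p : Prog) : Prog :=
  .seq p (.seq (.assign t (.tl (.var t))) (setFlag t e))

/-- The program with a clock in register `t`, a flag in register `t + 1` and its own variables
from register `t + 2` on. -/
def clocked (t : ℕ) : Prog → Prog
  | .assign x e => .assign (t + 2 + x) (shiftExpr (t + 2) e)
  | .flip x => .flip (t + 2 + x)
  | .seq p q => .seq (clocked t p) (clocked t q)
  | .ite e p q => .ite (shiftExpr (t + 2) e) (clocked t p) (clocked t q)
  | .loop e p => .seq (setFlag t e) (.loop (.var (t + 1)) (clockedBody t e (clocked t p)))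

/-- The store and the clock that are represented in the registers. -/
def represented (t V : ℕ) (s : Store) : Store × ℕ :=
  (fun x => if x < V then s (t + 2 + x) else .nil, ulen (s t))

lemma eval_shiftExpr {t V : ℕ} (s : Store) {e : Expr} (he : exprBound e ≤ V) :
    (shiftExpr (t + 2) e).eval s = e.eval (represented t V s).1 := by
  induction e with
  | var x =>
    simp only [exprBound] at he
    have : x < V := by omega
    simp [shiftExpr, Expr.eval, represented, this]
  | nil => rfl
  | cons a b ha hb =>
    simp only [exprBound, max_le_iff] at he
    simp only [shiftExpr, Expr.eval, ha he.1, hb he.2]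
  | hd a ha => simp only [shiftExpr, Expr.eval, ha he]
  | tl a ha => simp only [shiftExpr, Expr.eval, ha he]

lemma represented_update {t V x : ℕ} (hx : x < V) (s : Store) (y : Data) :
    represented t V (Function.update s (t + 2 + x) y) =
      (Function.update (represented t V s).1 x y, (represented t V s).2) := by
  unfold represented
  refine Prod.ext ?_ ?_
  · funext z
    by_cases hz : z = x
    · subst hz
      simp [hx]
    · simp only [Function.update_of_ne hz]
      rw [Function.update_of_ne (by omega)]
  · simp only
    rw [Function.update_of_ne (by omega)]

lemma represented_flag {t V : ℕ} (s : Store) (y : Data) :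
    represented t V (Function.update s (t + 1) y) = represented t V s := by
  unfold represented
  refine Prod.ext ?_ ?_
  · funext z
    simp only
    rw [Function.update_of_ne (by omega)]
  · simp only
    rw [Function.update_of_ne (by omega)]

lemma represented_clock {t V : ℕ} (s : Store) :
    represented t V (Function.update s t (s t).tl) =
      ((represented t V s).1, (represented t V s).2 - 1) := by
  unfold represented
  refine Prod.ext ?_ ?_
  · funext z
    simp only
    rw [Function.update_of_ne (by omega)]
  · simp [ulen_tl]

/-- `p` started with `s` ends with a represented store and clock of law `D`, keeping the
registers below `t`. -/
def ClockSpec (t V : ℕ) (p : Prog) (s : Store) (D : PMF (Store × ℕ)) (T : ℝ≥0∞) : Prop :=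
  ∃ μ : PMF Store, Spec p s μ T ∧ μ.map (represented t V) = D ∧
    ∀ s' ∈ μ.support, ∀ y < t, s' y = s y

lemma ClockSpec.mono {t V : ℕ} {p : Prog} {s : Store} {D : PMF (Store × ℕ)} {T T' : ℝ≥0∞}
    (h : ClockSpec t V p s D T) (hT : T ≤ T') : ClockSpec t V p s D T' := by
  obtain ⟨μ, h1, h2⟩ := h
  exact ⟨μ, h1.mono hT, h2⟩

/-- The law of what follows depends only on the represented store and clock, so binding commutes
with the push-forward along `represented`. The predicate `Q` carries information that is not
represented, namely that the flag of a loop is correct. -/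
lemma ClockSpec.bind_aux {t V : ℕ} {q : Prog} {s : Store} {μ : PMF Store} {D : PMF (Store × ℕ)}
    {E : Store × ℕ → PMF (Store × ℕ)} {T' : ℝ≥0∞} {Q : Store → Prop} (h2 : μ.map (represented t V) = D)
    (h3 : ∀ s' ∈ μ.support, ∀ y < t, s' y = s y) (hQ : ∀ s' ∈ μ.support, Q s')
    (hq : ∀ s', represented t V s' ∈ D.support → Q s' → ClockSpec t V q s' (E (represented t V s')) T') :
    ∃ ν : Store → PMF Store, (∀ s' ∈ μ.support, Spec q s' (ν s') T') ∧
      (μ.bind ν).map (represented t V) = D.bind E ∧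
      ∀ s' ∈ (μ.bind ν).support, ∀ y < t, s' y = s y := by
  have hall : ∀ s', ∃ ν : PMF Store, s' ∈ μ.support → Spec q s' ν T' ∧
      ν.map (represented t V) = E (represented t V s') ∧
      ∀ s'' ∈ ν.support, ∀ y < t, s'' y = s' y := by
    intro s'
    by_cases hs' : s' ∈ μ.support
    · obtain ⟨ν, hν⟩ := hq s' (by
        rw [← h2, PMF.mem_support_map_iff]
        exact ⟨s', hs', rfl⟩) (hQ s' hs')
      exact ⟨ν, fun _ => hν⟩
    · exact ⟨PMF.pure s', fun h => absurd h hs'⟩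
  choose ν hν using hall
  refine ⟨ν, fun s' hs' => (hν s' hs').1, ?_, ?_⟩
  · rw [PMF.map_bind, bind_congr_on (g := fun s' => E (represented t V s'))
      fun s' hs' => (hν s' hs').2.1, ← h2, PMF.bind_map]
    rfl
  · intro s'' hs'' y hy
    obtain ⟨s', hs', h⟩ := (PMF.mem_support_bind_iff _ _ _).1 hs''
    rw [(hν s' hs').2.2 s'' h y hy, h3 s' hs' y hy]

lemma ClockSpec.seq {t V : ℕ} {p q : Prog} {s : Store} {D : PMF (Store × ℕ)}
    {E : Store × ℕ → PMF (Store × ℕ)} {T T' : ℝ≥0∞} (hp : ClockSpec t V p s D T)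
    (hq : ∀ s', represented t V s' ∈ D.support → ClockSpec t V q s' (E (represented t V s')) T') :
    ClockSpec t V (.seq p q) s (D.bind E) (1 + T + T') := by
  obtain ⟨μ, h1, h2, h3⟩ := hp
  obtain ⟨ν, hν1, hν2, hν3⟩ := ClockSpec.bind_aux (Q := fun _ => True) h2 h3 (fun _ _ => trivial)
    fun s' h _ => hq s' h
  refine ⟨μ.bind ν, ?_, hν2, hν3⟩
  have := Spec.seq h1 hν1
  rwa [expect_const] at this

lemma Spec.setFlag (t : ℕ) (e : Expr) (s : Store) :
    Spec (setFlag t e) s (PMF.pure (Function.update s (t + 1)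
      (if ((shiftExpr (t + 2) e).eval s).toBool then s t else .nil))) 2 := by
  have h : (2 : ℝ≥0∞) = 1 + 1 := by norm_num
  rw [h]
  refine Spec.ite ?_
  split_ifs
  · exact Spec.assign _ _ _
  · exact Spec.assign _ _ _

/-- Induction on the program. The clock never grows and a loop makes at most as many rounds as the
clock has units, so each construct raises the exponent by an amount that depends on the program text
alone. -/
lemma clocked_spec (p : Prog) : ∃ d : ℕ, ∀ t V, progBound p ≤ V → ∀ s : Store,
    ClockSpec t V (clocked t p) s (clockLaw p (represented t V s).1 (represented t V s).2)
      (((ulen (s t) + 2) ^ d : ℕ) : ℝ≥0∞) := by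
  induction p with
  | assign x e =>
    refine ⟨0, fun t V hV s => ?_⟩
    simp only [progBound, max_le_iff] at hV
    refine ⟨_, (Spec.assign _ _ _).mono (by simp), ?_, ?_⟩
    · rw [PMF.pure_map, represented_update (by omega), clockLaw, eval_shiftExpr s hV.2]
    · intro s' hs' y hy
      rw [PMF.mem_support_pure_iff] at hs'
      rw [hs', Function.update_of_ne (by omega)]
  | flip x =>
    refine ⟨0, fun t V hV s => ?_⟩
    simp only [progBound] at hV
    refine ⟨_, (Spec.flip _ _).mono (by simp), ?_, ?_⟩
    · rw [PMF.map_comp, clockLaw]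
      congr 1
      funext c
      exact represented_update (by omega) s _
    · intro s' hs' y hy
      obtain ⟨c, -, rfl⟩ := (PMF.mem_support_map_iff _ _ _).1 hs'
      rw [Function.update_of_ne (by omega)]
  | seq p q hp hq =>
    obtain ⟨d, hd⟩ := hp
    obtain ⟨d', hd'⟩ := hq
    refine ⟨d + d' + 2, fun t V hV s => ?_⟩
    simp only [progBound, max_le_iff] at hV
    replace hd := hd t V hV.1
    replace hd' := hd' t V hV.2
    refine (ClockSpec.seq (E := fun r => clockLaw q r.1 r.2)
      (T' := (((ulen (s t) + 2) ^ d' : ℕ) : ℝ≥0∞)) (hd s) fun s' hs' => (hd' s').mono ?_).mono ?_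
    · have := clockLaw_clock_le p _ _ _ hs'
      have h2 : ulen (s' t) ≤ ulen (s t) := this
      exact_mod_cast Nat.pow_le_pow_left (by omega) _
    · have h1 : (ulen (s t) + 2) ^ d ≤ (ulen (s t) + 2) ^ (d + d') :=
        Nat.pow_le_pow_right (by omega) (by omega)
      have h2 : (ulen (s t) + 2) ^ d' ≤ (ulen (s t) + 2) ^ (d + d') :=
        Nat.pow_le_pow_right (by omega) (by omega)
      have h3 : 1 ≤ (ulen (s t) + 2) ^ (d + d') := Nat.one_le_pow _ _ (by omega)
      have h4 : 4 ≤ (ulen (s t) + 2) ^ 2 :=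
        (by norm_num : 4 = 2 ^ 2) ▸ Nat.pow_le_pow_left (by omega) 2
      have : 1 + (ulen (s t) + 2) ^ d + (ulen (s t) + 2) ^ d' ≤ (ulen (s t) + 2) ^ (d + d' + 2) := by
        rw [pow_add _ (d + d')]
        nlinarith
      exact_mod_cast this
  | ite e p q hp hq =>
    obtain ⟨d, hd⟩ := hp
    obtain ⟨d', hd'⟩ := hq
    refine ⟨d + d' + 1, fun t V hV s => ?_⟩
    simp only [progBound, max_le_iff] at hV
    replace hd := hd t V hV.2.1
    replace hd' := hd' t V hV.2.2
    have h1 : (ulen (s t) + 2) ^ d ≤ (ulen (s t) + 2) ^ (d + d') :=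
      Nat.pow_le_pow_right (by omega) (by omega)
    have h2 : (ulen (s t) + 2) ^ d' ≤ (ulen (s t) + 2) ^ (d + d') :=
      Nat.pow_le_pow_right (by omega) (by omega)
    have h3 : 1 + (ulen (s t) + 2) ^ (d + d') ≤ (ulen (s t) + 2) ^ (d + d' + 1) := by
      have : 1 ≤ (ulen (s t) + 2) ^ (d + d') := Nat.one_le_pow _ _ (by omega)
      rw [pow_succ]
      nlinarith
    have hcase : ClockSpec t V (if ((shiftExpr (t + 2) e).eval s).toBool then clocked t p
        else clocked t q) s (clockLaw (.ite e p q) (represented t V s).1 (represented t V s).2)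
        (((ulen (s t) + 2) ^ (d + d') : ℕ) : ℝ≥0∞) := by
      rw [eval_shiftExpr s hV.1, clockLaw]
      split_ifs
      · exact (hd s).mono (by exact_mod_cast h1)
      · exact (hd' s).mono (by exact_mod_cast h2)
    obtain ⟨μ, hμ, hrest⟩ := hcase
    exact ⟨μ, (Spec.ite hμ).mono (by exact_mod_cast h3), hrest⟩
  | loop e p hp =>
    obtain ⟨d, hd⟩ := hp
    refine ⟨d + 6, fun t V hV s => ?_⟩
    simp only [progBound, max_le_iff] at hV
    replace hd := hd t V hV.2
    have hflag : ∀ s : Store, (Function.update s (t + 1)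
        (if ((shiftExpr (t + 2) e).eval s).toBool then s t else .nil) (t + 1)).toBool = true ↔
        (e.eval (represented t V s).1).toBool = true ∧ 0 < ulen (s t) := by
      intro s
      rw [Function.update_self, eval_shiftExpr s hV.1]
      split_ifs with h
      · rw [toBool_iff_ulen]
        simp [h]
      · exact ⟨fun h' => absurd h' (by simp [Data.toBool]), fun h' => absurd h'.1 h⟩
    -- `B` bounds the cost of a single round and stays fixed, while `n` counts the remaining rounds
    -- and is the variable of the induction.
    have hloop : ∀ B n (s : Store), ulen (s t) ≤ n → n ≤ B →
        ((s (t + 1)).toBool = true ↔ (e.eval (represented t V s).1).toBool = true ∧ 0 < ulen (s t)) →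
        ClockSpec t V (.loop (.var (t + 1)) (clockedBody t e (clocked t p))) s
          (loopLaw e (clockLaw p) n (represented t V s).1 (represented t V s).2)
          (((n + 1) * (10 + (B + 2) ^ d) : ℕ) : ℝ≥0∞) := by
      intro B n
      induction n with
      | zero =>
        intro s hs _ hfl
        refine ⟨PMF.pure s, (Spec.loop_false ?_).mono ?_, ?_, ?_⟩
        · rw [Expr.eval, Bool.eq_false_iff]
          intro h
          have := (hfl.1 h).2
          omega
        · push_cast
          refine le_trans ?_ (le_mul_of_one_le_left zero_le (by simp))
          refine le_trans ?_ le_self_add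
          norm_num
        · rw [PMF.pure_map]
          rfl
        · intro s' hs' y _
          rw [PMF.mem_support_pure_iff] at hs'
          rw [hs']
      | succ n ih =>
        intro s hs hB hfl
        by_cases hcond : (s (t + 1)).toBool = true
        · have hc := hfl.1 hcond
          rw [loopLaw, if_pos (show _ ∧ 0 < (represented t V s).2 from hc)]
          obtain ⟨μ, hμ1, hμ2, hμ3⟩ := hd s
          set upd : Store → Store := fun s' =>
            Function.update (Function.update s' t (s' t).tl) (t + 1)
              (if ((shiftExpr (t + 2) e).eval (Function.update s' t (s' t).tl)).toBool then
                (Function.update s' t (s' t).tl) t else .nil) with hupd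
          have hrep : ∀ s', represented t V (upd s') =
              ((represented t V s').1, (represented t V s').2 - 1) := by
            intro s'
            simp only [hupd]
            rw [represented_flag, represented_clock]
          have hbody : Spec (clockedBody t e (clocked t p)) s (μ.map upd)
              (5 + (((ulen (s t) + 2) ^ d : ℕ) : ℝ≥0∞)) := by
            have h1 : ∀ s' ∈ μ.support, Spec (.seq (.assign t (.tl (.var t))) (setFlag t e)) s'
                (PMF.pure (upd s')) (2 + 2) := by
              intro s' _
              have := Spec.assign_seq (x := t) (ex := .tl (.var t)) (s := s')
                (Spec.setFlag t e (Function.update s' t (s' t).tl))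
              exact this
            have h2 := Spec.seq hμ1 h1
            rw [expect_const] at h2
            refine h2.mono (le_of_eq ?_)
            ring
          have hmap : (μ.map upd).map (represented t V) =
              (clockLaw p (represented t V s).1 (represented t V s).2).map
                fun r => (r.1, r.2 - 1) := by
            rw [← hμ2, PMF.map_comp, PMF.map_comp]
            congr 1
            funext s'
            exact hrep s'
          have hframe : ∀ s' ∈ (μ.map upd).support, ∀ y < t, s' y = s y := by
            intro s' hs' y hy
            obtain ⟨s0, hs0, rfl⟩ := (PMF.mem_support_map_iff _ _ _).1 hs'
            simp only [hupd]
            rw [Function.update_of_ne (by omega), Function.update_of_ne (by omega), hμ3 s0 hs0 y hy]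
          have hQ : ∀ s' ∈ (μ.map upd).support, ((s' (t + 1)).toBool = true ↔
              (e.eval (represented t V s').1).toBool = true ∧ 0 < ulen (s' t)) := by
            intro s' hs'
            obtain ⟨s0, hs0, rfl⟩ := (PMF.mem_support_map_iff _ _ _).1 hs'
            have := hflag (Function.update s0 t (s0 t).tl)
            simp only [hupd, represented_flag]
            rw [this]
            rw [Function.update_of_ne (show t ≠ t + 1 by omega)]
          obtain ⟨ν, hν1, hν2, hν3⟩ := ClockSpec.bind_aux (t := t) (V := V)
            (q := .loop (.var (t + 1)) (clockedBody t e (clocked t p)))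
            (E := fun r => loopLaw e (clockLaw p) n r.1 r.2)
            (T' := (((n + 1) * (10 + (B + 2) ^ d) : ℕ) : ℝ≥0∞)) hmap hframe hQ (by
              intro s' hs' hq
              refine ih s' ?_ (by omega) hq
              obtain ⟨r, hr, hr2⟩ := (PMF.mem_support_map_iff _ _ _).1 hs'
              have h1 := clockLaw_clock_le p _ _ r hr
              have h2 : ulen (s' t) = r.2 - 1 := (congrArg Prod.snd hr2).symm
              have h3 : (represented t V s).2 = ulen (s t) := rfl
              have h4 := hc.2
              omega)
          refine ⟨_, (Spec.loop_true (by simpa [Expr.eval] using hcond) hbody hν1).mono ?_, ?_, hν3⟩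
          · rw [expect_const]
            have h1 : (ulen (s t) + 2) ^ d ≤ (B + 2) ^ d := Nat.pow_le_pow_left (by omega) _
            have : 1 + (5 + (ulen (s t) + 2) ^ d) + (n + 1) * (10 + (B + 2) ^ d) ≤
                (n + 1 + 1) * (10 + (B + 2) ^ d) := by nlinarith
            exact_mod_cast this
          · rw [hν2, PMF.bind_map]
            rfl
        · have hc := fun h => hcond (hfl.2 h)
          rw [loopLaw, if_neg (show ¬ (_ ∧ 0 < (represented t V s).2) from hc)]
          refine ⟨PMF.pure s, (Spec.loop_false ?_).mono ?_, PMF.pure_map _ _, ?_⟩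
          · simpa [Expr.eval] using hcond
          · push_cast
            refine le_trans ?_ (le_mul_of_one_le_left zero_le (by simp))
            refine le_trans ?_ le_self_add
            norm_num
          · intro s' hs' y _
            rw [PMF.mem_support_pure_iff] at hs'
            rw [hs']
    rw [clocked, clockLaw]
    set s1 := Function.update s (t + 1)
      (if ((shiftExpr (t + 2) e).eval s).toBool then s t else .nil) with hs1
    have hrep : represented t V s1 = represented t V s := represented_flag s _
    have ht : s1 t = s t := by rw [hs1, Function.update_of_ne (by omega)]
    obtain ⟨μ, hμ1, hμ2, hμ3⟩ := hloop (ulen (s t)) (ulen (s t)) s1 (by rw [ht]) le_rfl (by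
      rw [hrep, ht]
      exact hflag s)
    refine ⟨μ, (Spec.seq_pure (Spec.setFlag t e s) hμ1).mono ?_, ?_, ?_⟩
    · have h3 : 1 ≤ (ulen (s t) + 2) ^ d := Nat.one_le_pow _ _ (by omega)
      have h4 : 32 ≤ (ulen (s t) + 2) ^ 5 :=
        (by norm_num : 32 = 2 ^ 5) ▸ Nat.pow_le_pow_left (by omega) 5
      have : 1 + 2 + (ulen (s t) + 1) * (10 + (ulen (s t) + 2) ^ d) ≤ (ulen (s t) + 2) ^ (d + 6) := by
        calc 1 + 2 + (ulen (s t) + 1) * (10 + (ulen (s t) + 2) ^ d)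
            ≤ (ulen (s t) + 2) * (14 * (ulen (s t) + 2) ^ d) := by nlinarith
          _ ≤ (ulen (s t) + 2) * ((ulen (s t) + 2) ^ 5 * (ulen (s t) + 2) ^ d) := by
              gcongr
              omega
          _ = (ulen (s t) + 2) ^ (d + 6) := by ring
      exact_mod_cast this
    · rw [hμ2, hrep]
      rfl
    · intro s' hs' y hy
      rw [hμ3 s' hs' y hy, hs1, Function.update_of_ne (by omega)]

/-- A program that clears registers. -/
lemma exists_clear (n : ℕ) : ∃ T : ℕ, ∀ c, ∃ p : Prog, ∀ s : Store, ∃ s' : Store,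
    Spec p s (PMF.pure s') T ∧ (∀ i < n, s' (c + i) = .nil) ∧
      ∀ y, (∀ i < n, y ≠ c + i) → s' y = s y := by
  induction n with
  | zero =>
    refine ⟨1, fun c => ⟨.assign c (.var c), fun s => ⟨s, ?_, by simp, by simp⟩⟩⟩
    have := Spec.assign c (.var c) s
    simpa [Expr.eval] using this
  | succ n ih =>
    obtain ⟨T, h⟩ := ih
    refine ⟨1 + T + 1, fun c => ?_⟩
    obtain ⟨p, h⟩ := h c
    refine ⟨.seq p (.assign (c + n) .nil), fun s => ?_⟩
    obtain ⟨s', h1, h2, h3⟩ := h s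
    refine ⟨_, (Spec.seq_pure h1 (Spec.assign (c + n) .nil s')).mono (by push_cast; rfl), ?_, ?_⟩
    · intro i hi
      rcases Nat.lt_succ_iff_lt_or_eq.1 hi with h | h
      · rw [Function.update_of_ne (by omega), h2 i h]
      · simp [h, Expr.eval]
    · intro y hy
      rw [Function.update_of_ne (hy n (by omega)), h3 y fun i hi => hy i (by omega)]

/-- The law of the output of `A` on input `x` with a clock of `m` units. -/
def outputLaw (A : Prog) (x : Data) (m : ℕ) : PMF Data :=
  (clockLaw A (Function.update (fun _ => Data.nil) 0 x) m).map fun r => r.1 0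

-- A clock of `m` units does not interfere with the first `m` steps, so the clocked program is at
-- least as likely to produce an output in `S` as `A` is within `m` steps.
open Classical in
lemma haltProb_le_outputLaw (A : Prog) (x : Data) (m : ℕ) (S : Set Data) :
    haltProb S m (init A x) ≤ expect (outputLaw A x m) fun y => if y ∈ S then 1 else 0 := by
  have h : Dominates S 0 m [] fun s _ => if s 0 ∈ S then 1 else 0 := by
    intro t _ s m' _
    rw [haltProb_nil]
  rw [outputLaw, expect_map]
  exact h.cons A m le_rfl _ m (by omega)

/-- The clock sits in register `b + 1`, the flag in `b + 2`, and variable zero of `A`, both input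
and output, in `b + 3`. The other variables are cleared first because the surrounding program may
have left values there. -/
lemma comp_outputLaw (A : Prog) : ∃ d : ℕ,
    Comp (fun t : Data × ℕ => .cons t.1 (.ofUnary t.2)) (fun t => outputLaw A t.1 t.2)
      fun t => (((t.2 + 2) ^ d : ℕ) : ℝ≥0∞) := by
  set V := progBound A + 1 with hV
  obtain ⟨d, hd⟩ := clocked_spec A
  obtain ⟨T, hT⟩ := exists_clear V
  refine ⟨d + T + 10, fun b => ?_⟩
  replace hd := hd (b + 1) V (by omega)
  obtain ⟨q, hq⟩ := hT (b + 4)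
  refine ⟨.seq q (.seq (.assign (b + 1) (.tl (.var b))) (.seq (.assign (b + 3) (.hd (.var b)))
    (.seq (clocked (b + 1) A) (.assign b (.var (b + 3)))))), fun t s hs => ?_⟩
  obtain ⟨s1, h1, h2, h3⟩ := hq s
  have hs1 : s1 b = s b := h3 b fun i _ => by omega
  set s2 := Function.update (Function.update s1 (b + 1) (s1 b).tl) (b + 3) (s1 b).hd with hs2
  obtain ⟨μ, hμ1, hμ2, hμ3⟩ := hd s2
  have hrep : represented (b + 1) V s2 = (Function.update (fun _ => Data.nil) 0 t.1, t.2) := by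
    unfold represented
    refine Prod.ext ?_ ?_
    · funext x
      simp only [hs2]
      cases x with
      | zero => simp [hV, hs1, hs, Data.hd]
      | succ x =>
        rw [Function.update_of_ne (by omega), Function.update_of_ne (by omega),
          Function.update_of_ne (by omega)]
        split_ifs with hx
        · have := h2 x (by omega)
          rw [← this]
          congr 1
          omega
        · rfl
    · simp only [hs2]
      rw [Function.update_of_ne (by omega), Function.update_self, hs1, hs, Data.tl, ulen_ofUnary]
  rw [hrep] at hμ2
  have hfin := Spec.seq hμ1 fun s' _ => Spec.assign b (.var (b + 3)) s'
  have hall := Spec.seq_pure h1 (Spec.assign_seq (x := b + 1) (ex := .tl (.var b))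
    (Spec.assign_seq (x := b + 3) (ex := .hd (.var b)) (ν := μ.bind fun s' =>
      PMF.pure (Function.update s' b (Expr.eval s' (.var (b + 3)))))
      (T := 1 + (((ulen (s2 (b + 1)) + 2) ^ d : ℕ) : ℝ≥0∞) + 1)
      (q := .seq (clocked (b + 1) A) (.assign b (.var (b + 3)))) (by
        rw [expect_const] at hfin
        have : Function.update (Function.update s1 (b + 1) (Expr.eval s1 (.tl (.var b)))) (b + 3)
            (Expr.eval (Function.update s1 (b + 1) (Expr.eval s1 (.tl (.var b)))) (.hd (.var b)))
            = s2 := by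
          simp [hs2, Expr.eval]
        rw [this]
        exact hfin)))
  have hlen : ulen (s2 (b + 1)) = t.2 := by
    simp only [hs2]
    rw [Function.update_of_ne (by omega), Function.update_self, hs1, hs, Data.tl, ulen_ofUnary]
  rw [hlen] at hall
  refine ⟨_, hall.mono ?_, ?_, ?_⟩
  · have e1 : (t.2 + 2) ^ d ≤ (t.2 + 2) ^ (d + T) := Nat.pow_le_pow_right (by omega) (by omega)
    have e2 : T ≤ (t.2 + 2) ^ (d + T) :=
      (Nat.lt_pow_self (by omega)).le.trans (Nat.pow_le_pow_right (by omega) (by omega))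
    have e3 : 1 ≤ (t.2 + 2) ^ (d + T) := Nat.one_le_pow _ _ (by omega)
    have e4 : 1024 ≤ (t.2 + 2) ^ 10 :=
      (by norm_num : 1024 = 2 ^ 10) ▸ Nat.pow_le_pow_left (by omega) 10
    have : 1 + T + (2 + (2 + (1 + (t.2 + 2) ^ d + 1))) ≤ (t.2 + 2) ^ (d + T + 10) := by
      rw [pow_add _ (d + T)]
      nlinarith
    show _ ≤ (((t.2 + 2) ^ (d + T + 10) : ℕ) : ℝ≥0∞)
    exact_mod_cast this
  · show _ = outputLaw A t.1 t.2
    rw [PMF.map_bind, outputLaw, ← hμ2, PMF.map_comp]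
    simp only [PMF.pure_map, Function.update_self, Expr.eval]
    rw [← PMF.bind_pure_comp]
    congr 1
  · intro s' hs' y hy
    obtain ⟨s0, hs0, h⟩ := (PMF.mem_support_bind_iff _ _ _).1 hs'
    rw [PMF.mem_support_pure_iff] at h
    rw [h, Function.update_of_ne (by omega), hμ3 s0 hs0 y (by omega)]
    simp only [hs2]
    rw [Function.update_of_ne (by omega), Function.update_of_ne (by omega), h3 y fun i _ => by omega]

lemma RP.outputLaw {α : Type*} {M : α → ℕ} {e x : α → Data} {m : α → ℕ} (A : Prog)
    (hx : DataP M e x) (hm : NatP M e m) : RP M e fun a => outputLaw A (x a) (m a) := by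
  obtain ⟨d, hd⟩ := comp_outputLaw A
  refine RP.comp (hx.cons hm.1) (RP.of_comp (hd.reindex fun a => (x a, m a))
    ((hm.2.add (.const 2)).pow d) fun a => le_rfl)

/-! ### The instances of Directed Steiner Network built from a graph

The vertices `0, …, n - 1` of the graph are divided into `2 * l * l` consecutive blocks of length
`m`.  A left vertex of colour `i` is a choice of one vertex in each of the blocks number
`i * l, …, i * l + l - 1`; right vertices use the blocks from number `l * l` on.  Such a choice is
coded by a number below `m ^ l`. -/

/-- The length of the blocks. -/
def blockLen (n l : ℕ) : ℕ := n / (2 * l * l)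

/-- The number of choices for one colour. -/
def numChoices (n l : ℕ) : ℕ := blockLen n l ^ l

/-- The `c`-th vertex of the choice `σ` for colour `i`. -/
def point (m l i c σ : ℕ) : ℕ := (i * l + c) * m + σ / m ^ c % m

/-- Lookup in a matrix of truth values. -/
def entry (x : Data) (u v : ℕ) : Prop := (nth v (nth u x)).toBool = true

/-- The `c`-th vertex of the left choice is adjacent to all vertices of the right choice. -/
def JoinedAt (gm : Data) (m l q r r' c : ℕ) : Prop :=
  ∀ c' < l, entry gm (point m l (r / q) c (r % q)) (point m l (l + r' / q) c' (r' % q))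

/-- All vertices of the left choice are adjacent to all vertices of the right choice. -/
def Joined (gm : Data) (m l q r r' : ℕ) : Prop := ∀ c < l, JoinedAt gm m l q r r' c

/-- The arcs of weight one: from a source to the left vertices of its colour and from a right vertex
to the sink of its colour.  Vertices congruent to `0`, `1`, `2`, `3` modulo `4` are sources, left
vertices, right vertices and sinks. -/
def ArcOne (q u v : ℕ) : Prop :=
  (u % 4 = 0 ∧ v % 4 = 1 ∧ u / 4 / q = v / 4 / q) ∨ (u % 4 = 2 ∧ v % 4 = 3 ∧ u / 4 / q = v / 4 / q)

/-- The arcs of weight zero. -/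
def ArcZero (gm : Data) (m l q u v : ℕ) : Prop :=
  u % 4 = 1 ∧ v % 4 = 2 ∧ Joined gm m l q (u / 4) (v / 4)

open Classical in
/-- The weight of a pair of vertices. -/
def weightOf (gm : Data) (m l q u v : ℕ) : Option ℕ :=
  if ArcOne q u v then some 1 else if ArcZero gm m l q u v then some 0 else none

/-- A row of the weight matrix. -/
def weightRow (gm : Data) (m l q N u : ℕ) : Data :=
  tabulate N fun v => DSN.Instance.encodeWeight (weightOf gm m l q u v)

/-- The number of vertices of the instance. -/
def numVert (n l k : ℕ) : ℕ := 4 * (k * numChoices n l)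

/-- The encoding of the instance. -/
def instData (n l k : ℕ) (gm : Data) : Data :=
  .cons
    (tabulate (numVert n l k)
      (weightRow gm (blockLen n l) l (numChoices n l) (numVert n l k)))
    (tabulate (k * k) fun i => .cons (.ofUnary (4 * (i / k * numChoices n l)))
      (.ofUnary (4 * (i % k * numChoices n l) + 3)))

/-- A number that is at least the binary logarithm of `n`. -/
def lam (n : ℕ) : ℕ := Nat.log 2 n + 1

open Classical in
/-- The weight of the chosen arcs leaving `u`. -/
def rowCost (q N : ℕ) (y : Data) (u : ℕ) : ℕ :=
  ∑ v ∈ Finset.range N, if entry y u v ∧ ArcOne q u v then 1 else 0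

/-- The cheapness condition in the test of an output. -/
def Cheap (n l k : ℕ) (y : Data) : Prop :=
  (∑ u ∈ Finset.range (numVert n l k), rowCost (numChoices n l) (numVert n l k) y u) *
    (32 * lam n) ≤ k * k * l

/-- There is a path from `s` to `t` over `u` whose first and last arcs are chosen. -/
def LinkVia (gm y : Data) (m l q N s t u : ℕ) : Prop :=
  ∃ v < N, (entry y s u ∧ ArcOne q s u) ∧ ArcZero gm m l q u v ∧ (entry y v t ∧ ArcOne q v t)

/-- There is a path from `s` to `t` whose first and last arcs are chosen. -/
def Link (gm y : Data) (m l q N s t : ℕ) : Prop := ∃ u < N, LinkVia gm y m l q N s t u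

/-- The source of colour `i` is linked to all sinks. -/
def LinkAll (gm y : Data) (m l q N k i : ℕ) : Prop :=
  ∀ j < k, Link gm y m l q N (4 * (i * q)) (4 * (j * q) + 3)

/-- The connectivity condition in the test of an output. -/
def Connects (n l k : ℕ) (gm y : Data) : Prop :=
  ∀ i < k, LinkAll gm y (blockLen n l) l (numChoices n l) (numVert n l k) k i

/-- The test of an output. -/
def Verified (n l k : ℕ) (gm y : Data) : Prop := Cheap n l k y ∧ Connects n l k gm y

/-! ### The distinguisher -/

/-- The size parameter of a stage. -/
def stageSize (n l : ℕ) : ℕ := (n + 2) ^ (l + 2)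

open Classical in
/-- Run the algorithm once, with a clock, and test its output. -/
def attempt (A : Prog) (d n l k : ℕ) (gm : Data) : PMF Bool :=
  (outputLaw A (instData n l k gm) (stageSize n l ^ d)).map fun y => decide (Verified n l k gm y)

/-- For all `k ≤ l`, make `n` attempts. -/
def search (A : Prog) (d n l : ℕ) (gm : Data) : PMF Bool :=
  iterate (fun i b => if b = true then PMF.pure true else attempt A d n l (i / n + 1) gm)
    (l * n) 0 false

/-- A list of random bits. -/
def randBits (N : ℕ) : PMF Data :=
  iterate (fun _ x => ((PMF.uniformOfFintype Bool).map Data.ofBool).bind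
    fun b => PMF.pure (.cons b x)) N 0 .nil

open Classical in
/-- The number with the binary digits found from position `o` on. -/
def number (y : Data) (b o : ℕ) : ℕ :=
  ∑ i ∈ Finset.range b, if (nth (o + i) y).toBool = true then 2 ^ i else 0

/-- The number of bits of the labels. -/
def labelLen (n : ℕ) : ℕ := 2 * lam n

/-- The random set of vertices: those whose label is below a random threshold. -/
def InSample (n : ℕ) (thr labels : Data) (v : ℕ) : Prop :=
  number labels (labelLen n) (v * labelLen n) < number thr (labelLen n) 0

/-- The sampled set meets all blocks. -/
def Hits (n l : ℕ) (thr labels : Data) : Prop :=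
  ∀ β < 2 * l * l, ∃ r < blockLen n l, InSample n thr labels (β * blockLen n l + r)

open Classical in
/-- The adjacency matrix of a random graph with a clique planted on the sampled set. -/
def sampleMatrix (n : ℕ) (edges thr labels : Data) : Data :=
  tabulate n fun u => tabulate n fun v => .ofBool (decide (u ≠ v ∧
    ((nth (min u v * n + max u v) edges).toBool = true ∨
      (InSample n thr labels u ∧ InSample n thr labels v))))

open Classical in
/-- One test: search in a random graph with a planted clique. -/
def testRun (A : Prog) (d n l : ℕ) : PMF Bool :=
  (randBits (n * n)).bind fun edges => (randBits (labelLen n)).bind fun thr =>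
    (randBits (n * labelLen n)).bind fun labels =>
      if Hits n l thr labels then search A d n l (sampleMatrix n edges thr labels)
      else PMF.pure true

/-- Repeated tests. -/
def testRuns (A : Prog) (d n l : ℕ) : PMF Bool :=
  iterate (fun _ b => if b = true then testRun A d n l else PMF.pure false) (n ^ 5) 0 true

/-- One stage: accept if the search succeeds, reject if it fails but all tests succeed. -/
def stage (A : Prog) (d n l : ℕ) (gm : Data) : PMF (Option Bool) :=
  (search A d n l gm).bind fun c =>
    if c = true then PMF.pure (some true)
    else (testRuns A d n l).map fun t => if t = true then some false else none

/-- The stages are run until one of them decides. -/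
def mainStep (A : Prog) (d n : ℕ) (gm : Data) (i : ℕ) : Option Bool → PMF (Option Bool)
  | some b => PMF.pure (some b)
  | none => stage A d n (i + 1) gm

/-- The law of the verdict. -/
def mainLaw (A : Prog) (d n : ℕ) (gm : Data) : PMF (Option Bool) :=
  iterate (mainStep A d n gm) (lam n) 0 none

/-- The encoding of verdicts. -/
def encVerdict : Option Bool → Data
  | none => .nil
  | some b => .cons .nil (.ofBool b)

lemma encVerdict_injective : Function.Injective encVerdict := by
  intro a b h
  cases a <;> cases b <;> simp_all [encVerdict]
  exact ofBool_injective h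

/-! ### Its computation -/

section Computation

variable {α : Type*} {M : α → ℕ} {e : α → Data}

lemma BoolP.entry {x : α → Data} {u v : α → ℕ} (hx : DataP M e x) (hu : NatP M e u)
    (hv : NatP M e v) : BoolP M e fun a => entry (x a) (u a) (v a) :=
  BoolP.of_toBool (DataP.nth hv (DataP.nth hu hx))

/-- The digit is extracted by repeated division by `m a`; computing `m a ^ c a` would require a
polynomial bound on this power. -/
lemma NatP.point {m l i c σ : α → ℕ} (hm : NatP M e m) (hl : NatP M e l) (hi : NatP M e i)
    (hc : NatP M e c) (hσ : NatP M e σ) :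
    NatP M e fun a => point (m a) (l a) (i a) (c a) (σ a) := by
  have hdiv : NatP M e fun a => σ a / m a ^ c a := by
    refine NatP.natRec (fun a i => σ a / m a ^ i) hc (hσ.congr fun a => by simp) ?_
      (hσ.2.of_le fun a => Nat.div_le_self _ _) fun e' he h => ?_
    · exact (hσ.2.reindex _).of_le fun t => Nat.div_le_self _ _
    · exact (h.div ((hm.up c).lift id he)).congr fun t => by
        rw [Nat.div_div_eq_div_mul, pow_succ]
        rfl
  exact (((hi.mul hl).add hc).mul hm).add (hdiv.mod hm)

lemma BoolP.joinedAt {gm : α → Data} {m l q r r' c : α → ℕ} (hg : DataP M e gm)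
    (hm : NatP M e m) (hl : NatP M e l) (hq : NatP M e q) (hr : NatP M e r) (hr' : NatP M e r')
    (hc : NatP M e c) :
    BoolP M e fun a => JoinedAt (gm a) (m a) (l a) (q a) (r a) (r' a) (c a) :=
  BoolP.ball hl (BoolP.entry (hg.up l)
    (NatP.point (hm.up l) (hl.up l) ((hr.div hq).up l) (hc.up l) ((hr.mod hq).up l))
    (NatP.point (hm.up l) (hl.up l) ((hl.add (hr'.div hq)).up l) (NatP.idx hl.2)
      ((hr'.mod hq).up l)))

lemma BoolP.joined {gm : α → Data} {m l q r r' : α → ℕ} (hg : DataP M e gm) (hm : NatP M e m)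
    (hl : NatP M e l) (hq : NatP M e q) (hr : NatP M e r) (hr' : NatP M e r') :
    BoolP M e fun a => Joined (gm a) (m a) (l a) (q a) (r a) (r' a) :=
  BoolP.ball hl (BoolP.joinedAt (hg.up l) (hm.up l) (hl.up l) (hq.up l) (hr.up l) (hr'.up l)
    (NatP.idx hl.2))

lemma BoolP.arcOne {q u v : α → ℕ} (hq : NatP M e q) (hu : NatP M e u) (hv : NatP M e v) :
    BoolP M e fun a => ArcOne (q a) (u a) (v a) := by
  have hc : BoolP M e fun a => u a / 4 / q a = v a / 4 / q a :=
    BoolP.eq ((hu.div (.const 4)).div hq) ((hv.div (.const 4)).div hq)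
  exact ((BoolP.eq (hu.mod (.const 4)) (.const 0)).and
      ((BoolP.eq (hv.mod (.const 4)) (.const 1)).and hc)).or
    ((BoolP.eq (hu.mod (.const 4)) (.const 2)).and ((BoolP.eq (hv.mod (.const 4)) (.const 3)).and hc))

lemma BoolP.arcZero {gm : α → Data} {m l q u v : α → ℕ} (hg : DataP M e gm) (hm : NatP M e m)
    (hl : NatP M e l) (hq : NatP M e q) (hu : NatP M e u) (hv : NatP M e v) :
    BoolP M e fun a => ArcZero (gm a) (m a) (l a) (q a) (u a) (v a) :=
  (BoolP.eq (hu.mod (.const 4)) (.const 1)).and ((BoolP.eq (hv.mod (.const 4)) (.const 2)).and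
    (BoolP.joined hg hm hl hq (hu.div (.const 4)) (hv.div (.const 4))))

lemma DataP.const (x : Data) : DataP M e fun _ => x := by
  induction x with
  | nil => exact DataP.nil
  | cons l r hl hr => exact DataP.cons hl hr

variable {gm y : α → Data} {n l k : α → ℕ}

lemma NatP.blockLen (hn : NatP M e n) (hl : NatP M e l) :
    NatP M e fun a => blockLen (n a) (l a) := hn.div (((NatP.const 2).mul hl).mul hl)

lemma NatP.numChoices (hn : NatP M e n) (hl : NatP M e l) (hb : PolyB M fun a => n a ^ l a) :
    NatP M e fun a => numChoices (n a) (l a) :=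
  (hn.blockLen hl).pow hl (hb.of_le fun _ => Nat.pow_le_pow_left (Nat.div_le_self _ _) _)

lemma NatP.numVert (hn : NatP M e n) (hl : NatP M e l) (hk : NatP M e k)
    (hb : PolyB M fun a => n a ^ l a) : NatP M e fun a => numVert (n a) (l a) (k a) :=
  (NatP.const 4).mul (hk.mul (hn.numChoices hl hb))

lemma DataP.weightRow {m q N u : α → ℕ} (hg : DataP M e gm) (hm : NatP M e m) (hl : NatP M e l)
    (hq : NatP M e q) (hN : NatP M e N) (hu : NatP M e u) :
    DataP M e fun a => weightRow (gm a) (m a) (l a) (q a) (N a) (u a) := by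
  classical
  refine DataP.tabulate hN ?_
  have h1 := BoolP.arcOne (hq.up N) (hu.up N) (NatP.idx hN.2)
  have h0 := BoolP.arcZero (hg.up N) (hm.up N) (hl.up N) (hq.up N) (hu.up N) (NatP.idx hN.2)
  refine (DataP.ite h1 (DataP.const (DSN.Instance.encodeWeight (some 1)))
    (DataP.ite h0 (DataP.const (DSN.Instance.encodeWeight (some 0)))
      (DataP.const (DSN.Instance.encodeWeight none)))).congr fun t => ?_
  unfold weightOf
  split_ifs <;> rfl

lemma DataP.instData (hg : DataP M e gm) (hn : NatP M e n) (hl : NatP M e l) (hk : NatP M e k)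
    (hb : PolyB M fun a => n a ^ l a) : DataP M e fun a => instData (n a) (l a) (k a) (gm a) := by
  have hq := hn.numChoices hl hb
  have hm := hn.blockLen hl
  have hN := hn.numVert hl hk hb
  refine DataP.cons (DataP.tabulate hN (DataP.weightRow (hg.up _) (hm.up _) (hl.up _) (hq.up _)
    (hN.up _) (NatP.idx hN.2))) (DataP.tabulate (hk.mul hk) ?_)
  have hi := NatP.idx (e := e) (hk.mul hk).2
  exact DataP.cons ((NatP.const 4).mul ((hi.div (hk.up _)).mul (hq.up _))).1
    (((NatP.const 4).mul ((hi.mod (hk.up _)).mul (hq.up _))).add (NatP.const 3)).1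

/-- The loop raises its state as long as twice the current power of two does not exceed `n a`. Since
the state is capped at the logarithm, the powers stay polynomially bounded. -/
lemma NatP.lam (hn : NatP M e n) : NatP M e fun a => lam (n a) := by
  have hlog : NatP M e fun a => Nat.log 2 (n a) := by
    have hmin : ∀ a : ℕ, Nat.log 2 a ≤ a := fun a => Nat.log_le_self 2 a
    have h2 : ∀ a i : ℕ, 2 ^ Min.min i (Nat.log 2 a) ≤ a + 1 := by
      intro a i
      rcases Nat.eq_zero_or_pos a with h | h
      · simp [h]
      · exact ((Nat.pow_le_pow_right (by omega) (min_le_right _ _)).trans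
          (Nat.pow_log_le_self 2 (by omega))).trans (Nat.le_succ _)
    refine (NatP.natRec (fun a i => Min.min i (Nat.log 2 (n a))) hn (NatP.zero.congr fun a => by simp)
      ?_ (hn.2.of_le fun a => min_le_left _ _) fun e' he h => ?_).congr fun a => min_eq_right (hmin _)
    · exact (hn.2.reindex _).of_le fun t => (min_le_left _ _).trans t.2.le
    · have hn' := (hn.up n).lift id he
      have hpow := (NatP.const 2).pow h (((hn.2.reindex fun t : Idx n => t.1.1).add (.const 1)).of_le
        fun t => h2 _ _)
      refine (NatP.ite (BoolP.le (hpow.mul (.const 2)) hn') h.succ h).congr fun t => ?_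
      have key : ∀ a i : ℕ, (if 2 ^ Min.min i (Nat.log 2 a) * 2 ≤ a then Min.min i (Nat.log 2 a) + 1
          else Min.min i (Nat.log 2 a)) = Min.min (i + 1) (Nat.log 2 a) := by
        intro a i
        rw [← pow_succ]
        rcases Nat.eq_zero_or_pos a with h | h
        · simp [h]
        · have hiff := Nat.le_log_iff_pow_le (b := 2) (by omega) (x := Min.min i (Nat.log 2 a) + 1)
            (y := a) (by omega)
          split_ifs with h'
          · rw [← hiff] at h'
            omega
          · rw [← hiff] at h'
            omega
      exact key _ _
  exact hlog.succ

lemma NatP.rowCost {q N u : α → ℕ} (hy : DataP M e y) (hq : NatP M e q) (hN : NatP M e N)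
    (hu : NatP M e u) : NatP M e fun a => rowCost (q a) (N a) (y a) (u a) := by
  classical
  exact NatP.sum hN (NatP.ite ((BoolP.entry (hy.up N) (hu.up N) (NatP.idx hN.2)).and
    (BoolP.arcOne (hq.up N) (hu.up N) (NatP.idx hN.2))) (NatP.const 1) (NatP.const 0))

lemma BoolP.linkVia {m q N s t u : α → ℕ} (hg : DataP M e gm) (hy : DataP M e y) (hm : NatP M e m)
    (hl : NatP M e l) (hq : NatP M e q) (hN : NatP M e N) (hs : NatP M e s) (ht : NatP M e t)
    (hu : NatP M e u) :
    BoolP M e fun a => LinkVia (gm a) (y a) (m a) (l a) (q a) (N a) (s a) (t a) (u a) :=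
  BoolP.bex hN (((BoolP.entry (hy.up N) (hs.up N) (hu.up N)).and
      (BoolP.arcOne (hq.up N) (hs.up N) (hu.up N))).and
    ((BoolP.arcZero (hg.up N) (hm.up N) (hl.up N) (hq.up N) (hu.up N) (NatP.idx hN.2)).and
      ((BoolP.entry (hy.up N) (NatP.idx hN.2) (ht.up N)).and
        (BoolP.arcOne (hq.up N) (NatP.idx hN.2) (ht.up N)))))

lemma BoolP.link {m q N s t : α → ℕ} (hg : DataP M e gm) (hy : DataP M e y) (hm : NatP M e m)
    (hl : NatP M e l) (hq : NatP M e q) (hN : NatP M e N) (hs : NatP M e s) (ht : NatP M e t) :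
    BoolP M e fun a => Link (gm a) (y a) (m a) (l a) (q a) (N a) (s a) (t a) :=
  BoolP.bex hN (BoolP.linkVia (hg.up N) (hy.up N) (hm.up N) (hl.up N) (hq.up N) (hN.up N)
    (hs.up N) (ht.up N) (NatP.idx hN.2))

lemma BoolP.linkAll {m q N i : α → ℕ} (hg : DataP M e gm) (hy : DataP M e y) (hm : NatP M e m)
    (hl : NatP M e l) (hq : NatP M e q) (hN : NatP M e N) (hk : NatP M e k) (hi : NatP M e i) :
    BoolP M e fun a => LinkAll (gm a) (y a) (m a) (l a) (q a) (N a) (k a) (i a) :=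
  BoolP.ball hk (BoolP.link (hg.up k) (hy.up k) (hm.up k) (hl.up k) (hq.up k) (hN.up k)
    (((NatP.const 4).mul (hi.mul hq)).up k)
    (((NatP.const 4).mul ((NatP.idx hk.2).mul (hq.up k))).add (NatP.const 3)))

lemma BoolP.verified (hg : DataP M e gm) (hy : DataP M e y) (hn : NatP M e n) (hl : NatP M e l)
    (hk : NatP M e k) (hb : PolyB M fun a => n a ^ l a) :
    BoolP M e fun a => Verified (n a) (l a) (k a) (gm a) (y a) := by
  have hq := hn.numChoices hl hb
  have hm := hn.blockLen hl
  have hN := hn.numVert hl hk hb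
  exact BoolP.and (BoolP.le (NatP.mul (NatP.sum hN (NatP.rowCost (hy.up _) (hq.up _) (hN.up _)
      (NatP.idx hN.2))) ((NatP.const 32).mul hn.lam)) ((hk.mul hk).mul hl))
    (BoolP.ball hk (BoolP.linkAll (hg.up k) (hy.up k) (hm.up k) (hl.up k) (hq.up k) (hN.up k)
      (hk.up k) (NatP.idx hk.2)))

end Computation

section Computation

variable {α : Type*} {M : α → ℕ} {e : α → Data} {gm y : α → Data} {n l k : α → ℕ}

lemma RP.congr {F G : α → PMF Data} (h : RP M e F) (h' : ∀ a, F a = G a) : RP M e G := by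
  rwa [funext h'] at h

lemma NatP.liftTl {f : α → ℕ} (h : NatP M e f) {β : Type*} {x : α × β → Data} :
    NatP (fun t : α × β => M t.1) (fun t => .cons (x t) (e t.1)) fun t => f t.1 :=
  h.lift Prod.fst fun _ => rfl

lemma DataP.liftTl {φ : α → Data} (h : DataP M e φ) {β : Type*} {x : α × β → Data} :
    DataP (fun t : α × β => M t.1) (fun t => .cons (x t) (e t.1)) fun t => φ t.1 :=
  RP.lift h Prod.fst fun _ => rfl

/-- Lift to the environment of the body of a loop. -/
lemma RP.liftLoop {F : α → PMF Data} (h : RP M e F) {N : α → ℕ} {β : Type*} {enc : β → Data} :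
    RP (fun t : Idx N × β => M t.1.1.1)
      (fun t => .cons (.ofUnary t.1.1.2) (.cons (enc t.2) (e t.1.1.1))) fun t => F t.1.1.1 :=
  RP.comp (φ := fun t : Idx N × β => e t.1.1.1) DataP.env.tl.tl
    (h.reindex fun t : Idx N × β => t.1.1.1)

lemma DataP.liftLoop {φ : α → Data} (h : DataP M e φ) {N : α → ℕ} {β : Type*} {enc : β → Data} :
    DataP (fun t : Idx N × β => M t.1.1.1)
      (fun t => .cons (.ofUnary t.1.1.2) (.cons (enc t.2) (e t.1.1.1))) fun t => φ t.1.1.1 :=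
  RP.liftLoop h

lemma NatP.liftLoop {f : α → ℕ} (h : NatP M e f) {N : α → ℕ} {β : Type*} {enc : β → Data} :
    NatP (fun t : Idx N × β => M t.1.1.1)
      (fun t => .cons (.ofUnary t.1.1.2) (.cons (enc t.2) (e t.1.1.1))) fun t => f t.1.1.1 :=
  ⟨DataP.liftLoop h.1, h.2.reindex _⟩

lemma NatP.idxLoop {N : α → ℕ} (hN : PolyB M N) {β : Type*} {enc : β → Data} :
    NatP (fun t : Idx N × β => M t.1.1.1)
      (fun t => .cons (.ofUnary t.1.1.2) (.cons (enc t.2) (e t.1.1.1))) fun t => t.1.1.2 :=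
  ⟨DataP.env.hd, (hN.reindex fun t : Idx N × β => t.1.1.1).of_le fun t => t.1.2.le⟩

lemma BoolP.stateLoop {N : α → ℕ} :
    BoolP (fun t : Idx N × Bool => M t.1.1.1)
      (fun t => .cons (.ofUnary t.1.1.2) (.cons (.ofBool t.2) (e t.1.1.1))) fun t => t.2 = true :=
  (BoolP.of_toBool DataP.env.tl.hd).congr fun t => by simp [Data.tl, Data.hd, toBool_ofBool]

lemma stageSize_bounds (n l : ℕ) : n ≤ stageSize n l ∧ l ≤ stageSize n l ∧ n ^ l ≤ stageSize n l := by
  have h0 : 1 ≤ (n + 2) ^ (l + 1) := Nat.one_le_pow _ _ (by omega)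
  have h1 : (n + 2) ^ (l + 2) = (n + 2) ^ (l + 1) * (n + 2) := pow_succ _ _
  refine ⟨?_, ?_, ?_⟩
  · unfold stageSize
    nlinarith
  · exact (Nat.lt_pow_self (by omega : 1 < n + 2)).le.trans
      (Nat.pow_le_pow_right (by omega) (by omega))
  · exact (Nat.pow_le_pow_left (by omega) l).trans (Nat.pow_le_pow_right (by omega) (by omega))

lemma NatP.stageSize (hn : NatP M e n) (hl : NatP M e l)
    (hb : PolyB M fun a => stageSize (n a) (l a)) : NatP M e fun a => stageSize (n a) (l a) :=
  (hn.add (.const 2)).pow (hl.add (.const 2)) hb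

lemma RP.attempt (A : Prog) (d : ℕ) (hg : DataP M e gm) (hn : NatP M e n) (hl : NatP M e l)
    (hk : NatP M e k) (hb : PolyB M fun a => stageSize (n a) (l a)) :
    RP M e fun a => (attempt A d (n a) (l a) (k a) (gm a)).map Data.ofBool := by
  classical
  have hb' : PolyB M fun a => n a ^ l a := hb.of_le fun a => (stageSize_bounds _ _).2.2
  have h1 := RP.outputLaw A (DataP.instData hg hn hl hk hb')
    ((hn.stageSize hl hb).pow (NatP.const d) (hb.pow d))
  have h2 := RP.map (h := fun a y => .ofBool (decide (Verified (n a) (l a) (k a) (gm a) y))) h1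
    (BoolP.verified hg.liftTl DataP.env.hd hn.liftTl hl.liftTl hk.liftTl (hb'.reindex _))
  refine h2.congr fun a => ?_
  rw [DSNHardness.attempt, PMF.map_comp]
  rfl

lemma RP.search (A : Prog) (d : ℕ) (hg : DataP M e gm) (hn : NatP M e n) (hl : NatP M e l)
    (hb : PolyB M fun a => stageSize (n a) (l a)) :
    RP M e fun a => (search A d (n a) (l a) (gm a)).map Data.ofBool := by
  have hN : NatP M e fun a => l a * n a := hl.mul hn
  refine RP.natRec ofBool_injective hN (DataP.ofBool false) ?_
  refine (RP.ite_prop BoolP.stateLoop (DataP.ofBool true) (RP.attempt A d hg.liftLoop hn.liftLoop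
    hl.liftLoop ((NatP.idxLoop hN.2).div hn.liftLoop).succ (hb.reindex _))).congr fun t => ?_
  split_ifs <;> simp [PMF.pure_map]

lemma RP.randBits {N : α → ℕ} (hN : NatP M e N) : RP M e fun a => randBits (N a) := by
  have := RP.natRec (enc := id) Function.injective_id (x0 := fun _ : α => Data.nil)
    (G := fun _ _ x => ((PMF.uniformOfFintype Bool).map Data.ofBool).bind
      fun b => PMF.pure (.cons b x)) hN DataP.nil
    ((RP.bind (H := fun (t : Idx N × Data) b => PMF.pure (.cons b t.2)) RP.flip
      (DataP.env.hd.cons DataP.env.tl.tl.hd)).congr fun t => by rw [PMF.map_id])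
  simp only [PMF.map_id] at this
  exact this

lemma NatP.number {b o : α → ℕ} (hy : DataP M e y) (hb : NatP M e b) (ho : NatP M e o)
    (hp : PolyB M fun a => 2 ^ b a) : NatP M e fun a => number (y a) (b a) (o a) := by
  classical
  refine NatP.sum hb (NatP.ite (BoolP.of_toBool (DataP.nth ((ho.up b).add (NatP.idx hb.2))
    (hy.up b))) ((NatP.const 2).pow (NatP.idx hb.2) ?_) (NatP.const 0))
  exact (hp.reindex fun t : Idx b => t.1.1).of_le fun t => Nat.pow_le_pow_right (by omega) t.2.le

lemma two_pow_lam_le (n : ℕ) : 2 ^ lam n ≤ 2 * n + 2 := by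
  rcases Nat.eq_zero_or_pos n with h | h
  · simp [h, lam]
  · rw [lam, pow_succ]
    have := Nat.pow_log_le_self 2 (x := n) (by omega)
    omega

lemma two_pow_labelLen (hn : PolyB M n) : PolyB M fun a => 2 ^ labelLen (n a) := by
  refine ((((PolyB.const 2).mul hn).add (.const 2)).pow 2).of_le fun a => ?_
  rw [labelLen, mul_comm, pow_mul]
  exact Nat.pow_le_pow_left (two_pow_lam_le _) 2

lemma NatP.labelLen (hn : NatP M e n) : NatP M e fun a => labelLen (n a) := (NatP.const 2).mul hn.lam

lemma BoolP.inSample {thr labels : α → Data} {v : α → ℕ} (hn : NatP M e n) (ht : DataP M e thr)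
    (hlab : DataP M e labels) (hv : NatP M e v) :
    BoolP M e fun a => InSample (n a) (thr a) (labels a) (v a) :=
  BoolP.lt (NatP.number hlab hn.labelLen (hv.mul hn.labelLen) (two_pow_labelLen hn.2))
    (NatP.number ht hn.labelLen (NatP.const 0) (two_pow_labelLen hn.2))

lemma BoolP.hits {thr labels : α → Data} (hn : NatP M e n) (hl : NatP M e l) (ht : DataP M e thr)
    (hlab : DataP M e labels) : BoolP M e fun a => Hits (n a) (l a) (thr a) (labels a) := by
  have hm := hn.blockLen hl
  have hone : ∀ {γ : Type _} {M : γ → ℕ} {e : γ → Data} {n m β : γ → ℕ} {thr labels : γ → Data},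
      NatP M e n → NatP M e m → DataP M e thr → DataP M e labels → NatP M e β →
      BoolP M e fun a => ∃ r < m a, InSample (n a) (thr a) (labels a) (β a * m a + r) :=
    fun {_ _ _ _ m _ _ _} hn hm ht hlab hβ => BoolP.bex hm (BoolP.inSample (hn.up m) (ht.up m)
      (hlab.up m) (((hβ.mul hm).up m).add (NatP.idx hm.2)))
  have h2 : NatP M e fun a => 2 * l a * l a := ((NatP.const 2).mul hl).mul hl
  exact BoolP.ball h2 (hone (hn.up _) (hm.up _) (ht.up _) (hlab.up _) (NatP.idx h2.2))

lemma NatP.max {f g : α → ℕ} (hf : NatP M e f) (hg : NatP M e g) :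
    NatP M e fun a => max (f a) (g a) :=
  (NatP.ite (BoolP.le hf hg) hg hf).congr fun a => by rw [max_def]

lemma DataP.sampleMatrix {edges thr labels : α → Data} (hn : NatP M e n) (he : DataP M e edges)
    (ht : DataP M e thr) (hlab : DataP M e labels) :
    DataP M e fun a => sampleMatrix (n a) (edges a) (thr a) (labels a) := by
  classical
  have hrow : ∀ {γ : Type _} {M : γ → ℕ} {e : γ → Data} {n u : γ → ℕ} {edges thr labels : γ → Data},
      NatP M e n → NatP M e u → DataP M e edges → DataP M e thr → DataP M e labels →
      DataP M e fun a => DSNHardness.tabulate (n a) fun v => Data.ofBool (decide (u a ≠ v ∧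
        ((DSNHardness.nth (Min.min (u a) v * n a + Max.max (u a) v) (edges a)).toBool = true ∨
          (InSample (n a) (thr a) (labels a) (u a) ∧ InSample (n a) (thr a) (labels a) v)))) := by
    intro γ M e n u edges thr labels hn hu he ht hlab
    have hv := NatP.idx (e := e) hn.2
    have hu' := hu.up n
    have hb := (BoolP.eq hu' hv).not.and ((BoolP.of_toBool
      (DataP.nth (((hu'.min hv).mul (hn.up n)).add (hu'.max hv)) (he.up n))).or
      ((BoolP.inSample (hn.up n) (ht.up n) (hlab.up n) hu').and
        (BoolP.inSample (hn.up n) (ht.up n) (hlab.up n) hv)))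
    exact DataP.tabulate hn (DataP.congr hb fun t => congrArg Data.ofBool (decide_eq_decide.2 Iff.rfl))
  exact DataP.tabulate hn (hrow (hn.up n) (NatP.idx hn.2) (he.up n) (ht.up n) (hlab.up n))

lemma RP.testRun (A : Prog) (d : ℕ) (hn : NatP M e n) (hl : NatP M e l)
    (hb : PolyB M fun a => stageSize (n a) (l a)) :
    RP M e fun a => (testRun A d (n a) (l a)).map Data.ofBool := by
  classical
  let H : α → Data → Data → Data → PMF Data := fun a edges thr labels =>
    if Hits (n a) (l a) thr labels then
      (DSNHardness.search A d (n a) (l a)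
        (DSNHardness.sampleMatrix (n a) edges thr labels)).map Data.ofBool
    else PMF.pure (.ofBool true)
  have h3 : RP (fun t : ((α × Data) × Data) × Data => M t.1.1.1)
      (fun t => .cons t.2 (.cons t.1.2 (.cons t.1.1.2 (e t.1.1.1))))
      fun t => H t.1.1.1 t.1.1.2 t.1.2 t.2 := by
    have hn3 := ((hn.liftTl (x := fun t : α × Data => t.2)).liftTl
      (x := fun t : (α × Data) × Data => t.2)).liftTl (x := fun t : ((α × Data) × Data) × Data => t.2)
    have hl3 := ((hl.liftTl (x := fun t : α × Data => t.2)).liftTl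
      (x := fun t : (α × Data) × Data => t.2)).liftTl (x := fun t : ((α × Data) × Data) × Data => t.2)
    exact RP.ite_prop (BoolP.hits hn3 hl3 DataP.env.tl.hd DataP.env.hd)
      (RP.search A d (DataP.sampleMatrix hn3 DataP.env.tl.tl.hd DataP.env.tl.hd DataP.env.hd) hn3 hl3
        (hb.reindex fun t : ((α × Data) × Data) × Data => t.1.1.1)) (DataP.ofBool true)
  have h2 : RP (fun t : (α × Data) × Data => M t.1.1) (fun t => .cons t.2 (.cons t.1.2 (e t.1.1)))
      fun t => (DSNHardness.randBits (n t.1.1 * DSNHardness.labelLen (n t.1.1))).bind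
        (H t.1.1 t.1.2 t.2) := by
    have hn2 := (hn.liftTl (x := fun t : α × Data => t.2)).liftTl
      (x := fun t : (α × Data) × Data => t.2)
    exact RP.bind (H := fun t : (α × Data) × Data => H t.1.1 t.1.2 t.2)
      (RP.randBits (hn2.mul hn2.labelLen)) h3
  have h1 : RP (fun t : α × Data => M t.1) (fun t => .cons t.2 (e t.1))
      fun t => (DSNHardness.randBits (DSNHardness.labelLen (n t.1))).bind fun thr =>
        (DSNHardness.randBits (n t.1 * DSNHardness.labelLen (n t.1))).bind (H t.1 t.2 thr) :=
    RP.bind (H := fun (t : α × Data) thr =>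
      (DSNHardness.randBits (n t.1 * DSNHardness.labelLen (n t.1))).bind (H t.1 t.2 thr))
      (RP.randBits (hn.liftTl (x := fun t : α × Data => t.2)).labelLen) h2
  have h := RP.bind (H := fun a edges => (DSNHardness.randBits (DSNHardness.labelLen (n a))).bind
    fun thr => (DSNHardness.randBits (n a * DSNHardness.labelLen (n a))).bind (H a edges thr))
    (RP.randBits (hn.mul hn)) h1
  refine h.congr fun a => ?_
  simp only [DSNHardness.testRun, PMF.map_bind]
  congr 1; funext edges; congr 1; funext thr; congr 1; funext labels
  simp only [H]
  split_ifs <;> simp [PMF.pure_map]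

lemma RP.testRuns (A : Prog) (d : ℕ) (hn : NatP M e n) (hl : NatP M e l)
    (hb : PolyB M fun a => stageSize (n a) (l a)) :
    RP M e fun a => (testRuns A d (n a) (l a)).map Data.ofBool := by
  have hN : NatP M e fun a => n a ^ 5 := hn.pow (NatP.const 5) (hn.2.pow 5)
  refine RP.natRec ofBool_injective hN (DataP.ofBool true) ?_
  refine (RP.ite_prop BoolP.stateLoop (RP.testRun A d hn.liftLoop hl.liftLoop (hb.reindex _))
    (DataP.ofBool false)).congr fun t => ?_
  split_ifs <;> simp [PMF.pure_map]

lemma RP.stage (A : Prog) (d : ℕ) (hg : DataP M e gm) (hn : NatP M e n) (hl : NatP M e l)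
    (hb : PolyB M fun a => stageSize (n a) (l a)) :
    RP M e fun a => (stage A d (n a) (l a) (gm a)).map encVerdict := by
  have h1 := RP.map (h := fun _ y => if y.toBool = true then encVerdict (some false)
      else encVerdict none) (RP.testRuns A d hn hl hb)
    (RP.congr (RP.ite (DataP.env.hd) (DataP.const (encVerdict (some false)))
      (DataP.const (encVerdict none))) fun t => by
        by_cases h : t.2.toBool = true <;> simp [Data.hd, h])
  have h2 := RP.bind (H := fun a y => if y.toBool = true then PMF.pure (encVerdict (some true))
      else ((DSNHardness.testRuns A d (n a) (l a)).map Data.ofBool).map fun y =>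
        if y.toBool = true then encVerdict (some false) else encVerdict none)
    (RP.search A d hg hn hl hb)
    (RP.ite DataP.env.hd (DataP.const (encVerdict (some true))) (h1.lift Prod.fst fun _ => rfl))
  refine h2.congr fun a => ?_
  rw [DSNHardness.stage, PMF.map_bind, PMF.bind_map]
  congr 1
  funext c
  simp only [Function.comp, toBool_ofBool]
  split_ifs
  · rw [PMF.pure_map]
  · rw [PMF.map_comp, PMF.map_comp]
    congr 1
    funext t
    simp only [Function.comp, toBool_ofBool]
    split_ifs <;> rfl

end Computation

/-! ### The program of the distinguisher -/

/-- The time spent in a round of the main loop. -/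
def roundTime (D n i : ℕ) : Option Bool → ℝ≥0∞
  | some _ => D
  | none => (((stageSize n (i + 1) + 2) ^ D : ℕ) : ℝ≥0∞)

lemma ulen_ofList (l : List Data) : ulen (.ofList l) = l.length := by
  induction l with
  | nil => rfl
  | cons x l ih => simp [Data.ofList, ulen, ih]

lemma ulen_encodeGraph {n : ℕ} (G : SimpleGraph (Fin n)) : ulen (PlantedClique.encodeGraph G) = n := by
  simp [PlantedClique.encodeGraph, Data.ofMatrix, ulen_ofList]

lemma loopTime_mono {β : Type*} {F : ℕ → β → PMF β} {T T' : ℕ → β → ℝ≥0∞}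
    (h : ∀ i x, T i x ≤ T' i x) (r i : ℕ) (x : β) : loopTime F T r i x ≤ loopTime F T' r i x := by
  induction r generalizing i x with
  | zero => exact le_rfl
  | succ r ih =>
    rw [loopTime, loopTime]
    exact add_le_add (add_le_add le_rfl (h _ _)) (expect_mono fun y => ih _ _)

/-- A program whose output has a computable law. -/
lemma Comp.exists_prog {α : Type*} {e : α → Data} {F : α → PMF Data} {T : α → ℝ≥0∞}
    (h : Comp e F T) : ∃ B : Prog, ∀ a, (∀ x, outputProb B (e a) {x} = F a x) ∧
      expectedTime B (e a) ≤ T a := by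
  classical
  obtain ⟨p, hp⟩ := h 0
  refine ⟨p, fun a => ?_⟩
  obtain ⟨μ, h1, h2, -⟩ := hp a (Function.update (fun _ => Data.nil) 0 (e a)) (by simp)
  refine ⟨fun x => ?_, ?_⟩
  · rw [outputProb_eq, init, (h1 []).1, ← h2, PMF.map_apply]
    refine tsum_congr fun s => ?_
    simp only [haltValue_nil]
    by_cases hx : s 0 = x
    · simp [hx]
    · simp [hx, Ne.symm hx]
  · rw [expectedTime_eq, init]
    refine ((h1 []).2).trans ?_
    simp [timeFrom_nil, expect_const]

/-- The time is recorded state by state: a round after the verdict costs a constant. A bound uniform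
in the state would charge the most expensive stage to every run and give only `n^{O(log n)}`. -/
lemma comp_mainStep (A : Prog) (d : ℕ) : ∃ D : ℕ,
    Comp (fun t : Idx (fun a : Σ n, SimpleGraph (Fin n) => lam a.1) × Option Bool =>
        .cons (.ofUnary t.1.1.2) (.cons (encVerdict t.2) (PlantedClique.encodeGraph t.1.1.1.2)))
      (fun t => (mainStep A d t.1.1.1.1 (PlantedClique.encodeGraph t.1.1.1.2) t.1.1.2 t.2).map
        encVerdict)
      fun t => roundTime D t.1.1.1.1 t.1.1.2 t.2 := by
  set γ := Idx (fun a : Σ n, SimpleGraph (Fin n) => lam a.1) × Option Bool with hγ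
  set e : γ → Data := fun t =>
    .cons (.ofUnary t.1.1.2) (.cons (encVerdict t.2) (PlantedClique.encodeGraph t.1.1.1.2)) with he
  have hs : ∃ T : γ → ℕ, PolyB (fun t : γ => stageSize t.1.1.1.1 (t.1.1.2 + 1)) T ∧
      Comp e (fun t => (stage A d t.1.1.1.1 (t.1.1.2 + 1)
        (PlantedClique.encodeGraph t.1.1.1.2)).map encVerdict) fun t => (T t : ℝ≥0∞) := by
    have hself := PolyB.self (M := fun t : γ => stageSize t.1.1.1.1 (t.1.1.2 + 1))
    have hn : NatP (fun t : γ => stageSize t.1.1.1.1 (t.1.1.2 + 1)) e fun t => t.1.1.1.1 :=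
      (NatP.length (e := e) (DataP.env.tl.tl) (hself.of_le fun t => by
        simp only [he, Data.tl, ulen_encodeGraph]
        exact (stageSize_bounds _ _).1)).congr fun t => by
          simp only [he, Data.tl, ulen_encodeGraph]
    have hl : NatP (fun t : γ => stageSize t.1.1.1.1 (t.1.1.2 + 1)) e fun t => t.1.1.2 + 1 :=
      ⟨(DataP.cons DataP.nil DataP.env.hd : DataP _ e _), hself.of_le fun t =>
        (stageSize_bounds _ _).2.1⟩
    exact RP.stage A d DataP.env.tl.tl hn hl hself
  obtain ⟨T, ⟨D, hD⟩, hT⟩ := hs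
  refine ⟨D + 6, ?_⟩
  have h := Comp.ite (e := e) (φ := fun t => encVerdict t.2) (T := fun _ => 1)
    (F := fun t => PMF.pure (encVerdict t.2))
    (G := fun t => (stage A d t.1.1.1.1 (t.1.1.2 + 1)
        (PlantedClique.encodeGraph t.1.1.1.2)).map encVerdict)
    (T' := fun t => match t.2 with
      | some _ => 1
      | none => (T t : ℝ≥0∞))
    (Comp.expr (fun x => x.tl.hd) (fun b => .hd (.tl (.var b))) fun _ _ => rfl)
    ((Comp.expr (fun x => x.tl.hd) (fun b => .hd (.tl (.var b))) fun _ _ => rfl).mono ?_)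
    ((hT.reindex Subtype.val).mono ?_)
  · have hF : (fun t : γ => (mainStep A d t.1.1.1.1 (PlantedClique.encodeGraph t.1.1.1.2) t.1.1.2
        t.2).map encVerdict) = fun t => if (encVerdict t.2).toBool = true
        then PMF.pure (encVerdict t.2) else (stage A d t.1.1.1.1 (t.1.1.2 + 1)
          (PlantedClique.encodeGraph t.1.1.1.2)).map encVerdict := by
      funext t
      obtain ⟨t, v⟩ := t
      cases v <;> simp [mainStep, encVerdict, Data.toBool, PMF.pure_map]
    rw [hF]
    refine h.mono fun t => ?_
    obtain ⟨t, v⟩ := t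
    cases v with
    | some v =>
      simp only [roundTime]
      norm_num
    | none =>
      have h1 := hD (t, none)
      simp only [roundTime]
      have h2 : 4 + 1 + T (t, none) ≤ (stageSize t.1.1.1 (t.1.2 + 1) + 2) ^ (D + 6) := by
        simp only at h1
        generalize stageSize t.1.1.1 (t.1.2 + 1) = s at *
        have h3 : 1 ≤ (s + 2) ^ D := Nat.one_le_pow _ _ (by omega)
        have h4 : 2 ^ 6 ≤ (s + 2) ^ 6 := Nat.pow_le_pow_left (by omega) _
        rw [pow_add]
        nlinarith
      exact_mod_cast h2
  · rintro ⟨⟨t, v⟩, hv⟩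
    cases v with
    | some b => exact le_rfl
    | none => exact absurd hv (by simp [encVerdict, Data.toBool])
  · rintro ⟨⟨t, v⟩, hv⟩
    cases v with
    | some b => exact absurd hv (by simp [encVerdict, Data.toBool])
    | none => exact le_rfl

lemma exists_distinguisher (A : Prog) (d : ℕ) : ∃ (B : Prog) (D : ℕ), ∀ n (G : SimpleGraph (Fin n)),
    outputProb B (PlantedClique.encodeGraph G) {Data.ofBool true} =
      mainLaw A d n (PlantedClique.encodeGraph G) (some true) ∧
    expectedTime B (PlantedClique.encodeGraph G) ≤ (((n + 2) ^ D : ℕ) : ℝ≥0∞) +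
      loopTime (mainStep A d n (PlantedClique.encodeGraph G)) (roundTime D n) (lam n) 0 none := by
  obtain ⟨D₁, h1⟩ := comp_mainStep A d
  set α := Σ n, SimpleGraph (Fin n) with hα
  set e : α → Data := fun a => PlantedClique.encodeGraph a.2 with he
  have hn : NatP (fun a : α => a.1) e fun a => a.1 :=
    (NatP.length (e := e) (DataP.env) (PolyB.self.of_le fun t => by
      simp only [he, ulen_encodeGraph, le_refl])).congr fun t => by simp only [he, ulen_encodeGraph]
  obtain ⟨TN, ⟨D₂, hD₂⟩, hTN⟩ := hn.lam.1
  have h2 := Comp.natRec (e := e) encVerdict_injective (x0 := fun _ => none)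
    (F := fun a : α => mainStep A d a.1 (PlantedClique.encodeGraph a.2))
    (T := fun a i x => roundTime D₁ a.1 i x) (T0 := fun _ => 1) hTN (fun a => ulen_ofUnary _)
    (Comp.expr (fun _ => .nil) (fun b => .nil) fun _ _ => rfl) h1
  -- Taking the second component removes the tag of the verdict. An undecided run outputs `nil`,
  -- which is also the encoding of rejection.
  have h3 := Comp.bind (H := fun _ x => PMF.pure x.tl) (T' := fun _ _ => 1) h2
    (Comp.expr (fun x => x.hd.tl) (fun b => .tl (.hd (.var b))) fun _ _ => rfl)
  obtain ⟨B, hB⟩ := h3.exists_prog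
  refine ⟨B, D₁ + D₂ + 6, fun n G => ⟨?_, ?_⟩⟩
  · rw [(hB ⟨n, G⟩).1]
    change ((PMF.map encVerdict (mainLaw A d n (PlantedClique.encodeGraph G))).bind
      (PMF.pure ∘ Data.tl)) _ = _
    rw [PMF.bind_pure_comp, PMF.map_comp, PMF.map_apply, tsum_eq_single (some true)]
    · simp [encVerdict, Data.tl]
    · intro v hv
      rw [if_neg]
      rcases v with _ | _ | _ <;> simp_all [encVerdict, Data.tl, Data.ofBool]
  · refine (hB ⟨n, G⟩).2.trans ?_
    simp only [expect_const]
    have h4 : (TN ⟨n, G⟩ : ℝ≥0∞) + 18 ≤ (((n + 2) ^ (D₁ + D₂ + 6) : ℕ) : ℝ≥0∞) := by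
      have h5 := hD₂ ⟨n, G⟩
      simp only at h5
      have h6 : TN ⟨n, G⟩ + 18 ≤ (n + 2) ^ (D₁ + D₂ + 6) := by
        have h3 : 1 ≤ (n + 2) ^ D₂ := Nat.one_le_pow _ _ (by omega)
        have h3' : 1 ≤ (n + 2) ^ D₁ := Nat.one_le_pow _ _ (by omega)
        have h4 : 2 ^ 6 ≤ (n + 2) ^ 6 := Nat.pow_le_pow_left (by omega) _
        calc TN ⟨n, G⟩ + 18 ≤ 1 * (n + 2) ^ D₂ * 2 ^ 6 := by omega
          _ ≤ (n + 2) ^ D₁ * (n + 2) ^ D₂ * (n + 2) ^ 6 := by gcongr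
          _ = _ := by rw [pow_add, pow_add]
      exact_mod_cast h6
    have h7 : loopTime (mainStep A d n (PlantedClique.encodeGraph G)) (roundTime D₁ n) (lam n) 0 none
        ≤ loopTime (mainStep A d n (PlantedClique.encodeGraph G)) (roundTime (D₁ + D₂ + 6) n)
          (lam n) 0 none := by
      refine loopTime_mono (fun i x => ?_) _ _ _
      cases x with
      | some b =>
        simp only [roundTime]
        exact_mod_cast (by omega)
      | none =>
        simp only [roundTime]
        exact_mod_cast Nat.pow_le_pow_right (by omega) (by omega)
    calc _ = ((TN ⟨n, G⟩ : ℝ≥0∞) + 18) + loopTime (mainStep A d n (PlantedClique.encodeGraph G))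
          (roundTime D₁ n) (lam n) 0 none := by ring
      _ ≤ _ := add_le_add h4 h7

/-! ### Dense structures forced by cheap solutions -/

section Combinatorics

variable {ι W V : Type*} [Fintype ι] [DecidableEq W] [DecidableEq V]

/-- A graph (given by its edges, with endpoints `u` and `v`) of average degree at least `2 * C`
contains a nonempty subgraph of minimum degree at least `C`. -/
lemma exists_minDegree (u v : ι → W) (C : ℕ) (X₀ : Finset W) (hne : X₀.Nonempty)
    (h₀ : ∀ e, u e ∈ X₀ ∧ v e ∈ X₀) (hC : C * X₀.card ≤ Fintype.card ι) :
    ∃ X ⊆ X₀, X.Nonempty ∧ ∀ w ∈ X, C ≤ (Finset.univ.filter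
      fun e => (u e = w ∧ v e ∈ X) ∨ (v e = w ∧ u e ∈ X)).card := by
  classical
  let E : Finset W → ℕ := fun X => (Finset.univ.filter fun e => u e ∈ X ∧ v e ∈ X).card
  let 𝒳 := X₀.powerset.filter fun X => X.Nonempty ∧ C * X.card ≤ E X
  have h𝒳 : X₀ ∈ 𝒳 := by
    simp only [𝒳, Finset.mem_filter, Finset.mem_powerset]
    refine ⟨subset_rfl, hne, ?_⟩
    simp only [E]
    rwa [Finset.filter_true_of_mem fun e _ => h₀ e]
  -- In a smallest nonempty set spanning at least `C` edges per vertex, every degree is at least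
  -- `C`: deleting a vertex of smaller degree would keep the inequality, even strictly, and hence
  -- leave a nonempty set.
  obtain ⟨X, hX, hmin⟩ := Finset.exists_min_image 𝒳 Finset.card ⟨_, h𝒳⟩
  simp only [𝒳, Finset.mem_filter, Finset.mem_powerset] at hX
  refine ⟨X, hX.1, hX.2.1, fun w hw => ?_⟩
  by_contra! hlt
  set D := Finset.univ.filter fun e => (u e = w ∧ v e ∈ X) ∨ (v e = w ∧ u e ∈ X) with hD
  have hle : E X ≤ E (X.erase w) + D.card := by
    refine (Finset.card_le_card ?_).trans (Finset.card_union_le _ _)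
    intro e he
    simp only [Finset.mem_filter, Finset.mem_univ, true_and, Finset.mem_union, Finset.mem_erase,
      hD] at he ⊢
    tauto
  have hcard : (X.erase w).card + 1 = X.card := Finset.card_erase_add_one hw
  have hlt' : C * (X.erase w).card < E (X.erase w) := by
    have := hX.2.2
    rw [← hcard] at this
    nlinarith
  have hne' : (X.erase w).Nonempty := by
    by_contra hemp
    rw [Finset.not_nonempty_iff_eq_empty] at hemp
    simp [hemp, E] at hlt'
  have := hmin (X.erase w) (by
    simp only [𝒳, Finset.mem_filter, Finset.mem_powerset]
    exact ⟨(Finset.erase_subset _ _).trans hX.1, hne', hlt'.le⟩)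
  omega

/-- A maximal family of disjoint `h`-subsets of the sets `S w`, `w ∈ X`. -/
lemma exists_disjoint_family (S : W → Finset V) (X : Finset W) (l h : ℕ) (hh : 2 * h ≤ l + 1)
    (hS : ∀ w ∈ X, (S w).card = l) :
    ∃ (A : Finset W) (Y : W → Finset V), A ⊆ X ∧ (∀ a ∈ A, Y a ⊆ S a ∧ (Y a).card = h) ∧
      (∀ a ∈ A, ∀ b ∈ A, a ≠ b → Disjoint (Y a) (Y b)) ∧
      ∀ w ∈ X, h ≤ (S w ∩ A.biUnion Y).card := by
  classical
  let Good : Finset W → (W → Finset V) → Prop := fun A Y =>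
    (∀ a ∈ A, Y a ⊆ S a ∧ (Y a).card = h) ∧ ∀ a ∈ A, ∀ b ∈ A, a ≠ b → Disjoint (Y a) (Y b)
  let 𝒜 := X.powerset.filter fun A => ∃ Y, Good A Y
  have h𝒜 : ∅ ∈ 𝒜 := by
    simp only [𝒜, Finset.mem_filter, Finset.mem_powerset]
    exact ⟨Finset.empty_subset _, fun _ => ∅, by simp [Good]⟩
  obtain ⟨A, hA, hmax⟩ := Finset.exists_max_image 𝒜 Finset.card ⟨_, h𝒜⟩
  simp only [𝒜, Finset.mem_filter, Finset.mem_powerset] at hA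
  obtain ⟨hAX, Y, hY1, hY2⟩ := hA
  refine ⟨A, Y, hAX, hY1, hY2, fun w hw => ?_⟩
  by_cases hwA : w ∈ A
  · rw [← (hY1 w hwA).2]
    exact Finset.card_le_card (Finset.subset_inter (hY1 w hwA).1 (Finset.subset_biUnion_of_mem Y hwA))
  · by_contra! hlt
    -- If fewer than `h` points of `S w` were covered, at least `l - h + 1 ≥ h` would be free, and a
    -- further member would fit.
    have hsd := Finset.card_sdiff_add_card_inter (S w) (A.biUnion Y)
    rw [hS w hw] at hsd
    obtain ⟨Z, hZ, hZc⟩ := Finset.exists_subset_card_eq (s := S w \ A.biUnion Y) (n := h) (by omega)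
    have hdis : ∀ b ∈ A, Disjoint Z (Y b) := fun b hb =>
      Finset.disjoint_left.2 fun x hx hxb => by
        have := Finset.mem_sdiff.1 (hZ hx)
        exact this.2 (Finset.mem_biUnion.2 ⟨b, hb, hxb⟩)
    have hne : ∀ b ∈ A, b ≠ w := fun b hb hbw => hwA (hbw ▸ hb)
    have := hmax (insert w A) (by
      simp only [𝒜, Finset.mem_filter, Finset.mem_powerset]
      refine ⟨Finset.insert_subset hw hAX, Function.update Y w Z, ?_, ?_⟩
      · intro a ha
        rcases Finset.mem_insert.1 ha with rfl | ha
        · simpa using ⟨hZ.trans Finset.sdiff_subset, hZc⟩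
        · simpa [Function.update_of_ne (hne a ha)] using hY1 a ha
      · intro a ha b hb hab
        rcases Finset.mem_insert.1 ha with ha' | ha' <;> rcases Finset.mem_insert.1 hb with hb' | hb'
        · exact absurd (ha'.trans hb'.symm) hab
        · simpa [ha', Function.update_of_ne (hne b hb')] using hdis b hb'
        · simpa [hb', Function.update_of_ne (hne a ha')] using (hdis a ha').symm
        · simpa [Function.update_of_ne (hne a ha'), Function.update_of_ne (hne b hb')]
            using hY2 a ha' b hb' hab)
    rw [Finset.card_insert_of_notMem hwA] at this
    omega

/-- `G` contains `μ` disjoint sets of `h` vertices, each completely joined to `r` vertices in the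
union of these sets. -/
def HasDense (G : SimpleGraph V) (μ h r : ℕ) : Prop :=
  ∃ (p : Fin μ × Fin h → V) (N : Fin μ → Fin r → Fin μ × Fin h), Function.Injective p ∧
    (∀ a, Function.Injective (N a)) ∧ ∀ a x z, G.Adj (p (a, x)) (p (N a z))

/-- Pass to minimum degree `C` and take a maximal disjoint family of `h`-subsets with union `P`. By
maximality every set `S w` of the subgraph has at least `h` points in `P`. The other ends of the
edges at a member `a` have pairwise disjoint sets, all completely joined to `S a`, so together they
contribute at least `C * h` neighbours inside `P`. That the neighbours are found in `P`, and not
merely in `V`, keeps the later count of configurations small. -/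
lemma exists_hasDense (G : SimpleGraph V) (u v : ι → W) (S : W → Finset V) (C l h : ℕ) (h1 : 1 ≤ h)
    (hh : 2 * h ≤ l + 1) (X₀ : Finset W) (hne : X₀.Nonempty) (h₀ : ∀ e, u e ∈ X₀ ∧ v e ∈ X₀)
    (hC : C * X₀.card ≤ Fintype.card ι) (hS : ∀ w ∈ X₀, (S w).card = l)
    (huv : ∀ e e', u e ≠ v e')
    (hdu : ∀ e e', e ≠ e' → u e = u e' → Disjoint (S (v e)) (S (v e')))
    (hdv : ∀ e e', e ≠ e' → v e = v e' → Disjoint (S (u e)) (S (u e')))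
    (hadj : ∀ e, ∀ x ∈ S (u e), ∀ y ∈ S (v e), G.Adj x y) :
    ∃ μ, 1 ≤ μ ∧ μ ≤ X₀.card ∧ HasDense G μ h (C * h) := by
  classical
  obtain ⟨X, hX, hXne, hdeg⟩ := exists_minDegree u v C X₀ hne h₀ hC
  obtain ⟨A, Y, hAX, hY, hYd, hP⟩ := exists_disjoint_family S X l h hh fun w hw => hS w (hX hw)
  set P := A.biUnion Y with hPdef
  refine ⟨A.card, ?_, Finset.card_le_card (hAX.trans hX), ?_⟩
  · obtain ⟨w, hw⟩ := hXne
    have := hP w hw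
    obtain ⟨x, hx⟩ := Finset.card_pos.1 (show 0 < (S w ∩ P).card by omega)
    obtain ⟨a, ha, -⟩ := Finset.mem_biUnion.1 (Finset.mem_inter.1 hx).2
    exact Finset.card_pos.2 ⟨a, ha⟩
  let α : Fin A.card ≃ A := A.equivFin.symm
  let η : ∀ a : A, Fin h ≃ Y a.1 := fun a => ((Y a.1).equivFinOfCardEq (hY a.1 a.2).2).symm
  let p : Fin A.card × Fin h → V := fun t => (η (α t.1) t.2).1
  have hpY : ∀ t, p t ∈ Y (α t.1).1 := fun t => (η (α t.1) t.2).2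
  have hp : Function.Injective p := by
    rintro ⟨a, x⟩ ⟨b, y⟩ hab
    have hab' : a = b := by
      by_contra hne
      have hd := hYd _ (α a).2 _ (α b).2 fun h => hne (α.injective (Subtype.ext h))
      exact Finset.disjoint_left.1 hd (hpY (a, x)) (hab ▸ hpY (b, y))
    subst hab'
    have : x = y := (η (α a)).injective (Subtype.ext hab)
    rw [this]
  have hpsurj : ∀ x ∈ P, ∃ t, p t = x := by
    intro x hx
    obtain ⟨a, ha, hxa⟩ := Finset.mem_biUnion.1 hx
    refine ⟨(α.symm ⟨a, ha⟩, (η (α (α.symm ⟨a, ha⟩))).symm ⟨x, by simpa using hxa⟩), ?_⟩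
    simp [p]
  have hN : ∀ a : A, ∃ N : Finset V, N.card = C * h ∧ N ⊆ P ∧ ∀ x ∈ S a.1, ∀ y ∈ N, G.Adj x y := by
    rintro ⟨a, ha⟩
    set D := Finset.univ.filter fun e => (u e = a ∧ v e ∈ X) ∨ (v e = a ∧ u e ∈ X) with hD
    -- The end of the edge `e` that differs from `a`.
    let o : ι → W := fun e => if u e = a then v e else u e
    have ho : ∀ e ∈ D, o e ∈ X ∧ ∀ x ∈ S a, ∀ y ∈ S (o e), G.Adj x y := by
      intro e he
      rcases (Finset.mem_filter.1 he).2 with ⟨h1, h2⟩ | ⟨h1, h2⟩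
      · simp only [o, h1, if_true]
        exact ⟨h2, fun x hx y hy => hadj e x (h1 ▸ hx) y hy⟩
      · have h3 : u e ≠ a := fun h => huv e e (h.trans h1.symm)
        simp only [o, h3, if_false]
        exact ⟨h2, fun x hx y hy => (hadj e y hy x (h1 ▸ hx)).symm⟩
    have hdis : ∀ e ∈ D, ∀ e' ∈ D, e ≠ e' → Disjoint (S (o e) ∩ P) (S (o e') ∩ P) := by
      intro e he e' he' hee
      refine Disjoint.mono Finset.inter_subset_left Finset.inter_subset_left ?_
      rcases (Finset.mem_filter.1 he).2 with ⟨h1, -⟩ | ⟨h1, -⟩ <;>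
        rcases (Finset.mem_filter.1 he').2 with ⟨h2, -⟩ | ⟨h2, -⟩
      · simpa only [o, h1, h2, if_true] using hdu e e' hee (h1.trans h2.symm)
      · exact absurd (h1.trans h2.symm) (huv e e')
      · exact absurd (h2.trans h1.symm) (huv e' e)
      · have h3 : u e ≠ a := fun h => huv e e (h.trans h1.symm)
        have h4 : u e' ≠ a := fun h => huv e' e' (h.trans h2.symm)
        simpa only [o, h3, h4, if_false] using hdv e e' hee (h1.trans h2.symm)
    have hcard : C * h ≤ (D.biUnion fun e => S (o e) ∩ P).card := by
      rw [Finset.card_biUnion hdis]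
      calc C * h ≤ D.card * h := Nat.mul_le_mul_right _ (hdeg a (hAX ha))
        _ ≤ _ := by
          rw [← smul_eq_mul]
          exact Finset.card_nsmul_le_sum _ _ _ fun e he => hP _ (ho e he).1
    obtain ⟨N, hN, hNc⟩ := Finset.exists_subset_card_eq hcard
    refine ⟨N, hNc, fun x hx => ?_, fun x hx y hy => ?_⟩
    · obtain ⟨e, -, he⟩ := Finset.mem_biUnion.1 (hN hx)
      exact (Finset.mem_inter.1 he).2
    · obtain ⟨e, he, hey⟩ := Finset.mem_biUnion.1 (hN hy)
      exact (ho e he).2 x hx y (Finset.mem_inter.1 hey).1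
  choose N hNc hNP hNadj using hN
  let ν : ∀ a : A, Fin (C * h) ≃ N a := fun a => ((N a).equivFinOfCardEq (hNc a)).symm
  choose q hq using hpsurj
  refine ⟨p, fun a z => q _ (hNP (α a) (ν (α a) z).2), hp, fun a z z' hzz => ?_, fun a x z => ?_⟩
  · have := congrArg p hzz
    simp only [hq] at this
    exact (ν (α a)).injective (Subtype.ext this)
  · simp only [hq]
    exact hNadj _ _ ((hY _ (α a).2).1 (hpY (a, x))) _ (ν (α a) z).2

end Combinatorics

/-! ### From verified outputs to dense structures -/

lemma entry_encodeGraph {n : ℕ} (G : SimpleGraph (Fin n)) {u v : ℕ} (hu : u < n) (hv : v < n) :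
    entry (PlantedClique.encodeGraph G) u v ↔ G.Adj ⟨u, hu⟩ ⟨v, hv⟩ := by
  classical
  rw [entry, PlantedClique.encodeGraph, Data.ofMatrix, nth_ofList, List.getD_eq_getElem _ _ (by simpa),
    List.getElem_ofFn, nth_ofList, List.getD_eq_getElem _ _ (by simpa), List.getElem_ofFn,
    toBool_ofBool]
  simp

lemma point_lt {m l i c σ n : ℕ} (hm : 0 < m) (hi : i < 2 * l) (hc : c < l) (hn : 2 * l * l * m ≤ n) :
    point m l i c σ < n := by
  have h1 : σ / m ^ c % m < m := Nat.mod_lt _ hm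
  have h2 : i * l + c + 1 ≤ 2 * l * l := by nlinarith
  have h3 := Nat.mul_le_mul_right m h2
  unfold point
  nlinarith

lemma point_div {m l i c σ : ℕ} (hm : 0 < m) : point m l i c σ / m = i * l + c := by
  rw [point, Nat.mul_comm, Nat.mul_add_div hm, Nat.div_eq_of_lt (Nat.mod_lt _ hm), add_zero]

lemma point_div_div {m l i c σ : ℕ} (hm : 0 < m) (hc : c < l) : point m l i c σ / m / l = i := by
  rw [point_div hm, Nat.mul_comm, Nat.mul_add_div (by omega), Nat.div_eq_of_lt hc, add_zero]

open Classical in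
/-- The set of vertices of the choice `σ` for colour `i`. -/
def pointSet (n m l i σ : ℕ) : Finset (Fin n) :=
  Finset.univ.filter fun x => ∃ c < l, x.val = point m l i c σ

lemma card_pointSet {n m l i σ : ℕ} (hm : 0 < m) (hi : i < 2 * l) (hn : 2 * l * l * m ≤ n) :
    (pointSet n m l i σ).card = l := by
  classical
  have : pointSet n m l i σ = (Finset.univ : Finset (Fin l)).image
      fun c => ⟨point m l i c σ, point_lt hm hi c.2 hn⟩ := by
    ext x
    simp only [pointSet, Finset.mem_filter, Finset.mem_univ, true_and, Finset.mem_image]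
    constructor
    · rintro ⟨c, hc, h⟩
      exact ⟨⟨c, hc⟩, Fin.ext h.symm⟩
    · rintro ⟨c, rfl⟩
      exact ⟨c, c.2, rfl⟩
  rw [this, Finset.card_image_of_injective, Finset.card_univ, Fintype.card_fin]
  intro c c' h
  have h1 := congrArg (fun x : Fin n => x.val / m) h
  simp only [point_div hm] at h1
  exact Fin.ext (by omega)

/-- The colour of a point can be read off from the number of its block, so choices for different
colours use different blocks. -/
lemma disjoint_pointSet {n m l i i' σ σ' : ℕ} (hm : 0 < m) (hi : i ≠ i') :
    Disjoint (pointSet n m l i σ) (pointSet n m l i' σ') := by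
  classical
  refine Finset.disjoint_left.2 fun x hx hx' => hi ?_
  simp only [pointSet, Finset.mem_filter, Finset.mem_univ, true_and] at hx hx'
  obtain ⟨c, hc, h⟩ := hx
  obtain ⟨c', hc', h'⟩ := hx'
  have h2 := point_div_div (i := i') (σ := σ') hm hc'
  exact (point_div_div (i := i) (σ := σ) hm hc).symm.trans (by rw [← h, h', h2])

lemma blockLen_mul_le (n l : ℕ) : 2 * l * l * blockLen n l ≤ n := Nat.mul_div_le _ _

/-- The set of vertices of a left or right vertex of the instance. -/
def vertexSet (n l w : ℕ) : Finset (Fin n) :=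
  pointSet n (blockLen n l) l ((if w % 4 = 1 then 0 else l) + w / 4 / numChoices n l)
    (w / 4 % numChoices n l)

/-- An output that passes the test exhibits a dense structure. -/
lemma Verified.hasDense {n l k : ℕ} {G : SimpleGraph (Fin n)} {y : Data} (hk : 1 ≤ k) (hkl : k ≤ l)
    (hl : l ≤ lam n) (hv : Verified n l k (PlantedClique.encodeGraph G) y) :
    ∃ μ C, 1 ≤ μ ∧ μ ≤ l * l ∧ C ≤ l * l ∧ 8 * lam n ≤ C * ((l + 1) / 2) ∧
      HasDense G μ ((l + 1) / 2) (C * ((l + 1) / 2)) := by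
  classical
  obtain ⟨hcheap, hconn⟩ := hv
  set m := blockLen n l with hm
  set q := numChoices n l with hq
  set N := numVert n l k with hN
  have hqpos : 0 < q := by
    obtain ⟨u, hu, -⟩ := hconn 0 hk 0 hk
    rcases Nat.eq_zero_or_pos q with h | h
    · simp [numVert, ← hq, h] at hu
    · exact h
  have hmpos : 0 < m := by
    rcases Nat.eq_zero_or_pos m with h | h
    · rw [hq, numChoices, ← hm, h, zero_pow (by omega)] at hqpos
      omega
    · exact h
  have hsrc : ∀ i, 4 * (i * q) / 4 / q = i := fun i => by
    rw [Nat.mul_div_cancel_left _ (by omega), Nat.mul_div_cancel _ hqpos]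
  have hsnk : ∀ i, (4 * (i * q) + 3) / 4 / q = i := fun i => by
    rw [show (4 * (i * q) + 3) / 4 = i * q by omega, Nat.mul_div_cancel _ hqpos]
  -- For each pair of colours the free arc of one link is selected. These `k * k` arcs are the edges
  -- of the graph to which `exists_hasDense` is applied.
  have hex : ∀ e : Fin k × Fin k, ∃ t : ℕ × ℕ, t.1 < N ∧ t.2 < N ∧
      (entry y (4 * (e.1 * q)) t.1 ∧ ArcOne q (4 * (e.1 * q)) t.1) ∧
      ArcZero (PlantedClique.encodeGraph G) m l q t.1 t.2 ∧
      (entry y t.2 (4 * (e.2 * q) + 3) ∧ ArcOne q t.2 (4 * (e.2 * q) + 3)) := by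
    intro e
    obtain ⟨u, hu, v, hv, h1, h2, h3⟩ := hconn e.1 e.1.2 e.2 e.2.2
    exact ⟨(u, v), hu, hv, h1, h2, h3⟩
  choose t ht1 ht2 hs hz hd using hex
  have hu4 : ∀ e, (t e).1 % 4 = 1 := fun e => (hz e).1
  have hv4 : ∀ e, (t e).2 % 4 = 2 := fun e => (hz e).2.1
  have hucol : ∀ e, (t e).1 / 4 / q = e.1 := by
    intro e
    rcases (hs e).2 with ⟨-, -, h⟩ | ⟨h, -⟩
    · rw [← h, hsrc]
    · omega
  have hvcol : ∀ e, (t e).2 / 4 / q = e.2 := by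
    intro e
    rcases (hd e).2 with ⟨h, -⟩ | ⟨-, -, h⟩
    · have := hv4 e
      omega
    · rw [h, hsnk]
  set U := Finset.univ.image fun e => (t e).1 with hU
  set Z := Finset.univ.image fun e => (t e).2 with hZ
  have hUZ : Disjoint U Z := by
    refine Finset.disjoint_left.2 fun w hw hw' => ?_
    obtain ⟨e, -, rfl⟩ := Finset.mem_image.1 hw
    obtain ⟨e', -, h⟩ := Finset.mem_image.1 hw'
    have := hu4 e
    have := hv4 e'
    omega
  -- Each left or right vertex in use is charged to its own chosen arc of weight one, which joins it
  -- to the source or sink of its colour.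
  have hcost : (U ∪ Z).card ≤ ∑ a ∈ Finset.range N, rowCost q N y a := by
    have hlt4 : ∀ i < k, 4 * (i * q) + 3 < N := by
      intro i hi
      have := Nat.mul_le_mul_right q (show i + 1 ≤ k from hi)
      rw [hN, numVert, ← hq]
      nlinarith
    have hsum : ∑ a ∈ Finset.range N, rowCost q N y a =
        ((Finset.range N ×ˢ Finset.range N).filter fun z => entry y z.1 z.2 ∧ ArcOne q z.1 z.2).card := by
      rw [Finset.card_filter, Finset.sum_product]
      rfl
    rw [hsum]
    refine Finset.card_le_card_of_injOn
      (fun w => if w % 4 = 1 then (4 * (w / 4 / q * q), w) else (w, 4 * (w / 4 / q * q) + 3)) ?_ ?_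
    · intro w hw
      simp only [Finset.coe_filter, Finset.mem_product, Finset.mem_range, Set.mem_ofPred_eq]
      rcases Finset.mem_union.1 hw with hw | hw
      · obtain ⟨e, -, rfl⟩ := Finset.mem_image.1 hw
        simp only [hu4, if_true, hucol]
        have := hlt4 _ e.1.2
        exact ⟨⟨by omega, ht1 e⟩, hs e⟩
      · obtain ⟨e, -, rfl⟩ := Finset.mem_image.1 hw
        simp only [hv4, hvcol]
        exact ⟨⟨ht2 e, hlt4 _ e.2.2⟩, hd e⟩
    · intro w hw w' hw' hww
      simp only at hww
      rcases Finset.mem_union.1 hw with hw | hw <;> rcases Finset.mem_union.1 hw' with hw' | hw' <;>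
        obtain ⟨e, -, rfl⟩ := Finset.mem_image.1 hw <;>
        obtain ⟨e', -, rfl⟩ := Finset.mem_image.1 hw' <;>
        simp only [hu4, hv4, if_true, Prod.mk.injEq] at hww
      · exact hww.2
      · have := hv4 e'
        simp at hww
        omega
      · have := hv4 e
        simp at hww
        omega
      · simp at hww
        exact hww.1
  have hcheap' : (U ∪ Z).card * (32 * lam n) ≤ k * k * l :=
    (Nat.mul_le_mul_right _ hcost).trans hcheap
  set x := (U ∪ Z).card with hx
  have hxpos : 0 < x := Finset.card_pos.2 ⟨(t (⟨0, hk⟩, ⟨0, hk⟩)).1, by simp [hU]⟩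
  have hlam : 0 < lam n := by simp [lam]
  have hxk : 32 * x ≤ k * k := by
    refine Nat.le_of_mul_le_mul_right (c := lam n) ?_ hlam
    calc 32 * x * lam n = x * (32 * lam n) := by ring
      _ ≤ k * k * l := hcheap'
      _ ≤ _ := Nat.mul_le_mul_left _ hl
  have hkk : k * k ≤ l * l := Nat.mul_le_mul hkl hkl
  have hCx : k * k / x * x ≤ k * k := Nat.div_mul_le_self _ _
  -- Rounding down to `C = k * k / x` loses at most a factor two, because the quotient is at least
  -- one.
  have hCle : k * k ≤ 2 * (k * k / x) * x := by
    have h1 : 1 ≤ k * k / x := by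
      rw [Nat.le_div_iff_mul_le hxpos]
      omega
    have h2 := Nat.lt_div_mul_add (a := k * k) hxpos
    nlinarith
  -- Cheapness `x * 32λ ≤ k²l` together with `C ≥ k²/(2x)` gives `C * l ≥ 16λ`; a set of `⌈l/2⌉`
  -- vertices keeps half of this.
  have hC8 : 8 * lam n ≤ k * k / x * ((l + 1) / 2) := by
    have h1 : 16 * lam n ≤ k * k / x * l := by
      refine Nat.le_of_mul_le_mul_right (c := 2 * x) ?_ (by omega)
      calc 16 * lam n * (2 * x) = x * (32 * lam n) := by ring
        _ ≤ k * k * l := hcheap'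
        _ ≤ 2 * (k * k / x) * x * l := Nat.mul_le_mul_right _ hCle
        _ = _ := by ring
    have h2 : l ≤ 2 * ((l + 1) / 2) := by omega
    have h3 := Nat.mul_le_mul_left (k * k / x) h2
    nlinarith
  suffices hsuff : ∃ μ, 1 ≤ μ ∧ μ ≤ x ∧ HasDense G μ ((l + 1) / 2) (k * k / x * ((l + 1) / 2)) by
    obtain ⟨μ, hμ1, hμ2, hμ⟩ := hsuff
    exact ⟨μ, k * k / x, hμ1, by omega, (Nat.div_le_self _ _).trans hkk, hC8, hμ⟩
  refine exists_hasDense G (fun e => (t e).1) (fun e => (t e).2)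
    (vertexSet n l) (k * k / x) l ((l + 1) / 2) (by omega) (by omega) (U ∪ Z)
    (Finset.card_pos.1 hxpos) (fun e => by simp [hU, hZ]) (by simpa using hCx) ?_ ?_ ?_ ?_ ?_
  · intro w hw
    refine card_pointSet hmpos ?_ (blockLen_mul_le n l)
    rcases Finset.mem_union.1 hw with hw | hw
    · obtain ⟨e, -, rfl⟩ := Finset.mem_image.1 hw
      rw [if_pos (hu4 e), hucol]
      omega
    · obtain ⟨e, -, rfl⟩ := Finset.mem_image.1 hw
      rw [if_neg (by rw [hv4]; omega), hvcol]
      omega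
  · intro e e' h
    have h1 := hu4 e
    have h2 := hv4 e'
    omega
  · intro e e' hee h
    refine disjoint_pointSet hmpos ?_
    rw [if_neg (by rw [hv4]; omega), if_neg (by rw [hv4]; omega), hvcol, hvcol]
    intro h'
    have h1 : (e.1 : ℕ) = e'.1 := by rw [← hucol, ← hucol, h]
    exact hee (Prod.ext (Fin.ext h1) (Fin.ext (by omega)))
  · intro e e' hee h
    refine disjoint_pointSet hmpos ?_
    rw [if_pos (hu4 _), if_pos (hu4 _), hucol, hucol]
    intro h'
    have h1 : (e.2 : ℕ) = e'.2 := by rw [← hvcol, ← hvcol, h]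
    exact hee (Prod.ext (Fin.ext (by omega)) (Fin.ext h1))
  · intro e a ha b hb
    simp only [vertexSet, pointSet, Finset.mem_filter, Finset.mem_univ, true_and, hu4, hv4, if_true,
      zero_add] at ha hb
    obtain ⟨c, hc, hac⟩ := ha
    obtain ⟨c', hc', hbc⟩ := hb
    have := (hz e).2.2 c hc c' hc'
    rw [if_neg (by omega)] at hbc
    rw [← hq, ← hm] at hac hbc
    rw [← hac, ← hbc, entry_encodeGraph G a.2 b.2] at this
    exact this

/-! ### Probabilities of events -/

section Prob

variable {β γ : Type*}

open Classical in
/-- The probability of an event. -/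
def prob (μ : PMF β) (P : β → Prop) : ℝ≥0∞ := expect μ fun x => if P x then 1 else 0

lemma prob_mono_on {μ : PMF β} {P Q : β → Prop} (h : ∀ x ∈ μ.support, P x → Q x) :
    prob μ P ≤ prob μ Q :=
  expect_mono_on fun x hx => by
    by_cases hP : P x
    · simp [hP, h x hx hP]
    · simp [hP]

lemma prob_mono {μ : PMF β} {P Q : β → Prop} (h : ∀ x, P x → Q x) : prob μ P ≤ prob μ Q :=
  prob_mono_on fun x _ => h x

lemma prob_le_one (μ : PMF β) (P : β → Prop) : prob μ P ≤ 1 :=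
  (expect_mono (ψ := fun _ => 1) fun x => by split_ifs <;> simp).trans (expect_const _ _).le

lemma prob_exists_le {κ : Type*} (μ : PMF β) (s : Finset κ) (P : κ → β → Prop) :
    prob μ (fun x => ∃ i ∈ s, P i x) ≤ ∑ i ∈ s, prob μ (P i) := by
  classical
  unfold prob
  rw [← expect_sum]
  refine expect_mono fun x => ?_
  split_ifs with h
  · obtain ⟨i, hi, hP⟩ := h
    refine le_trans (by simp [hP]) (Finset.single_le_sum (f := fun i => if P i x then (1 : ℝ≥0∞) else 0)
      (fun _ _ => zero_le) hi)
  · exact zero_le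

lemma prob_add_not (μ : PMF β) (P : β → Prop) : prob μ P + prob μ (fun x => ¬ P x) = 1 := by
  rw [prob, prob, ← expect_add]
  refine Eq.trans (expect_congr_on fun x _ => ?_) (expect_const μ 1)
  by_cases hP : P x <;> simp [hP]

lemma prob_uniform [Fintype β] [Nonempty β] (P : β → Prop) [DecidablePred P] :
    prob (PMF.uniformOfFintype β) P = (Finset.univ.filter P).card / (Fintype.card β : ℝ≥0∞) := by
  classical
  simp only [prob, expect, PMF.uniformOfFintype_apply, mul_ite, mul_one, mul_zero]
  rw [tsum_fintype, ← Finset.sum_filter, Finset.sum_const, nsmul_eq_mul, div_eq_mul_inv]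

end Prob

/-! ### Random graphs contain no dense structures -/

/-- Deleting a subset `A` of `E` from a graph that contains `E` determines both the graph and `A`.
So `2 ^ |E|` times the number of such graphs is at most the number of all graphs. -/
lemma prob_subset_edgeSet_le {n : ℕ} (E : Finset (Sym2 (Fin n))) :
    prob (PlantedClique.erdosRenyi n) (fun G => (E : Set (Sym2 (Fin n))) ⊆ G.edgeSet) ≤
      ((2 : ℝ≥0∞) ^ E.card)⁻¹ := by
  classical
  let : Fintype (SimpleGraph (Fin n)) := Fintype.ofFinite _
  have h : (Finset.univ.filter fun G : SimpleGraph (Fin n) =>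
      (E : Set (Sym2 (Fin n))) ⊆ G.edgeSet).card * 2 ^ E.card ≤
        Fintype.card (SimpleGraph (Fin n)) := by
    rw [← Finset.card_powerset, ← Finset.card_product]
    refine Finset.card_le_card_of_injOn (fun t => t.1.deleteEdges t.2) (by simp) ?_
    rintro ⟨G, A⟩ hG ⟨G', A'⟩ hG' heq
    simp only [Finset.coe_product, Set.mem_prod, Finset.mem_coe, Finset.mem_filter,
      Finset.mem_univ, true_and, Finset.mem_powerset] at hG hG'
    have h1 : G.edgeSet \ A = G'.edgeSet \ A' := by
      simpa only [SimpleGraph.edgeSet_deleteEdges] using congrArg SimpleGraph.edgeSet heq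
    have hA : A = A' := by
      ext e
      have h2 := Set.ext_iff.1 h1 e
      simp only [Set.mem_sdiff, Finset.mem_coe] at h2
      constructor
      · intro he
        by_contra he'
        exact (h2.2 ⟨hG'.1 (hG.2 he), he'⟩).2 he
      · intro he
        by_contra he'
        exact (h2.1 ⟨hG.1 (hG'.2 he), he'⟩).2 he
    subst hA
    have : G = G' := by
      rw [← SimpleGraph.edgeSet_inj]
      ext e
      have h2 := Set.ext_iff.1 h1 e
      simp only [Set.mem_sdiff, Finset.mem_coe] at h2
      by_cases he : e ∈ A
      · exact iff_of_true (hG.1 (hG.2 he)) (hG'.1 (hG'.2 he))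
      · tauto
    rw [this]
  rw [PlantedClique.erdosRenyi, prob_uniform]
  have h' : ((Finset.univ.filter fun G : SimpleGraph (Fin n) =>
      (E : Set (Sym2 (Fin n))) ⊆ G.edgeSet).card : ℝ≥0∞) * 2 ^ E.card ≤
        Fintype.card (SimpleGraph (Fin n)) := by exact_mod_cast h
  refine ENNReal.div_le_of_le_mul ?_
  rw [mul_comm, ← div_eq_mul_inv, ENNReal.le_div_iff_mul_le (Or.inl (by simp)) (Or.inl (by simp))]
  exact h'

/-- The number of edges of a dense structure. -/
lemma card_le_two_mul_image {n μ h r : ℕ} {p : Fin μ × Fin h → Fin n}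
    {N : Fin μ → Fin r → Fin μ × Fin h} (hp : Function.Injective p)
    (hN : ∀ a, Function.Injective (N a)) :
    μ * h * r ≤ 2 * ((Finset.univ : Finset ((Fin μ × Fin h) × Fin r)).image
      fun t => s(p t.1, p (N t.1.1 t.2))).card := by
  classical
  have := Finset.card_le_mul_card_image (f := fun t : (Fin μ × Fin h) × Fin r =>
    s(p t.1, p (N t.1.1 t.2))) Finset.univ 2 ?_
  · simpa [mul_comm, mul_assoc, mul_left_comm] using this
  · intro e _
    induction e using Sym2.ind with
    | _ a b =>
    have hinj : ∀ t t' : (Fin μ × Fin h) × Fin r, p t.1 = p t'.1 →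
        p (N t.1.1 t.2) = p (N t'.1.1 t'.2) → t = t' := by
      rintro ⟨t, z⟩ ⟨t', z'⟩ h1 h2
      obtain rfl := hp h1
      obtain rfl := hN _ (hp h2)
      rfl
    calc _ ≤ ((Finset.univ.filter fun t : (Fin μ × Fin h) × Fin r =>
            p t.1 = a ∧ p (N t.1.1 t.2) = b) ∪
          (Finset.univ.filter fun t : (Fin μ × Fin h) × Fin r =>
            p t.1 = b ∧ p (N t.1.1 t.2) = a)).card := by
          refine Finset.card_le_card fun t ht => ?_
          simpa [Sym2.eq_iff] using ht
      _ ≤ 1 + 1 := (Finset.card_union_le _ _).trans (add_le_add ?_ ?_)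
    · refine Finset.card_le_one.2 fun t ht t' ht' => ?_
      simp only [Finset.mem_filter, Finset.mem_univ, true_and] at ht ht'
      exact hinj _ _ (ht.1.trans ht'.1.symm) (ht.2.trans ht'.2.symm)
    · refine Finset.card_le_one.2 fun t ht t' ht' => ?_
      simp only [Finset.mem_filter, Finset.mem_univ, true_and] at ht ht'
      exact hinj _ _ (ht.1.trans ht'.1.symm) (ht.2.trans ht'.2.symm)

lemma lt_two_pow_lam (n : ℕ) : n < 2 ^ lam n := Nat.lt_pow_succ_log_self (by omega) n

/-- Arithmetic of the union bound. -/
lemma dense_count_le {n μ h r E : ℕ} (hμ : 1 ≤ μ) (hh : 1 ≤ h) (hr : 8 * lam n ≤ r)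
    (hlog : (μ * h) ^ 8 ≤ 2 ^ h) (hE : μ * h * r ≤ 2 * E) :
    n ^ (μ * h) * ((μ * h) ^ r) ^ μ * n ^ 2 ≤ 2 ^ E := by
  have hn : n ≤ 2 ^ lam n := (lt_two_pow_lam n).le
  -- Eighth powers avoid roots when `hlog` is used. The exponents on the left then add up to at most
  -- `4 * μ * h * r`, which is at most `8 * E`.
  refine (Nat.pow_le_pow_iff_left (n := 8) (by omega)).1 ?_
  calc (n ^ (μ * h) * ((μ * h) ^ r) ^ μ * n ^ 2) ^ 8
      = n ^ (μ * h * 8) * ((μ * h) ^ 8) ^ (r * μ) * n ^ 16 := by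
        rw [mul_pow, mul_pow, ← pow_mul, ← pow_mul, ← pow_mul, ← pow_mul, ← pow_mul]
        congr 3
        ring
    _ ≤ (2 ^ lam n) ^ (μ * h * 8) * (2 ^ h) ^ (r * μ) * (2 ^ lam n) ^ 16 := by gcongr
    _ = 2 ^ (lam n * (μ * h * 8) + h * (r * μ) + lam n * 16) := by
        simp only [pow_add, pow_mul]
    _ ≤ 2 ^ (E * 8) := by
        refine Nat.pow_le_pow_right (by omega) ?_
        have h1 : lam n * 8 * (μ * h) ≤ r * (μ * h) := Nat.mul_le_mul_right _ (by omega)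
        have h2 : 1 ≤ μ * h := Nat.mul_pos hμ hh
        have h3 : r * 1 ≤ r * (μ * h) := Nat.mul_le_mul_left _ h2
        nlinarith
    _ = (2 ^ E) ^ 8 := pow_mul _ _ _

/-- Union bound over the positions of the `μ * h` vertices and, for each part, its `r` neighbours
among them. Each configuration forces at least `μ * h * r / 2` distinct edges, and `dense_count_le`
leaves the factor `n ^ 2` to spare. -/
lemma prob_hasDense_le {n μ h r : ℕ} (hμ : 1 ≤ μ) (hh : 1 ≤ h) (hr : 8 * lam n ≤ r)
    (hlog : (μ * h) ^ 8 ≤ 2 ^ h) :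
    prob (PlantedClique.erdosRenyi n) (fun G => HasDense G μ h r) ≤ ((n : ℝ≥0∞) ^ 2)⁻¹ := by
  classical
  let E : (Fin μ × Fin h → Fin n) × (Fin μ → Fin r → Fin μ × Fin h) → Finset (Sym2 (Fin n)) :=
    fun c => Finset.univ.image fun t : (Fin μ × Fin h) × Fin r => s(c.1 t.1, c.1 (c.2 t.1.1 t.2))
  let s : Finset ((Fin μ × Fin h → Fin n) × (Fin μ → Fin r → Fin μ × Fin h)) :=
    Finset.univ.filter fun c => Function.Injective c.1 ∧ ∀ a, Function.Injective (c.2 a)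
  have h1 : prob (PlantedClique.erdosRenyi n) (fun G => HasDense G μ h r) ≤
      ∑ c ∈ s, prob (PlantedClique.erdosRenyi n)
        (fun G => (E c : Set (Sym2 (Fin n))) ⊆ G.edgeSet) := by
    refine le_trans (prob_mono fun G hG => ?_) (prob_exists_le _ s fun c (G : SimpleGraph (Fin n)) =>
      (E c : Set (Sym2 (Fin n))) ⊆ G.edgeSet)
    obtain ⟨p, N, hp, hN, hadj⟩ := hG
    refine ⟨(p, N), by simp [s, hp, hN], ?_⟩
    intro e he
    simp only [E, Finset.coe_image, Set.mem_image] at he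
    obtain ⟨t, -, rfl⟩ := he
    exact hadj t.1.1 t.1.2 t.2
  have hcard : s.card ≤ n ^ (μ * h) * ((μ * h) ^ r) ^ μ := by
    refine (Finset.card_le_univ _).trans ?_
    simp
  obtain hs | ⟨c₀, hc₀⟩ := s.eq_empty_or_nonempty
  · rw [hs, Finset.sum_empty] at h1
    exact h1.trans zero_le
  set K := n ^ (μ * h) * ((μ * h) ^ r) ^ μ with hK
  have hKpos : 0 < K := (Finset.card_pos.2 ⟨c₀, hc₀⟩).trans_le hcard
  have h2 : ∀ c ∈ s, prob (PlantedClique.erdosRenyi n)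
      (fun G => (E c : Set (Sym2 (Fin n))) ⊆ G.edgeSet) ≤ ((K : ℝ≥0∞) * (n : ℝ≥0∞) ^ 2)⁻¹ := by
    intro c hc
    refine (prob_subset_edgeSet_le (E c)).trans (ENNReal.inv_le_inv.2 ?_)
    simp only [s, Finset.mem_filter, Finset.mem_univ, true_and] at hc
    exact_mod_cast dense_count_le (n := n) (E := (E c).card) hμ hh hr hlog
      (card_le_two_mul_image hc.1 hc.2)
  refine h1.trans ((Finset.sum_le_card_nsmul _ _ _ h2).trans ?_)
  rw [nsmul_eq_mul, ENNReal.mul_inv (Or.inl (by exact_mod_cast hKpos.ne')) (Or.inl (by simp)),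
    ← mul_assoc]
  refine (mul_le_mul_left (?_ : (s.card : ℝ≥0∞) * (K : ℝ≥0∞)⁻¹ ≤ 1) _).trans (one_mul _).le
  rw [← div_eq_mul_inv]
  exact ENNReal.div_le_of_le_mul (by rw [one_mul]; exact_mod_cast hcard)

/-- Supplies the hypothesis `(μ * h) ^ 8 ≤ 2 ^ h` of the union bound, as `μ ≤ l * l` and `h = (l +
1) / 2 ≤ l`. -/
lemma eventually_pow_le_two_pow : ∀ᶠ l : ℕ in Filter.atTop, (l * l * l) ^ 8 ≤ 2 ^ ((l + 1) / 2) := by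
  have h := (isLittleO_pow_const_const_pow_of_one_lt (R := ℝ) 48 (by norm_num : (1 : ℝ) < 2)).bound
    (by norm_num : (0 : ℝ) < 1)
  filter_upwards [h] with l hl
  have hl' : l ^ 48 ≤ 2 ^ l := by
    simp only [norm_pow, Real.norm_natCast, Real.norm_ofNat, one_mul] at hl
    exact_mod_cast hl
  refine (Nat.pow_le_pow_iff_left (n := 2) (by omega)).1 ?_
  calc ((l * l * l) ^ 8) ^ 2 = l ^ 48 := by ring
    _ ≤ 2 ^ l := hl'
    _ ≤ 2 ^ ((l + 1) / 2 * 2) := Nat.pow_le_pow_right (by omega) (by omega)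
    _ = _ := pow_mul _ _ _

lemma tendsto_lam : Filter.Tendsto lam Filter.atTop Filter.atTop := by
  refine Filter.tendsto_atTop_mono (f := Nat.log 2) (fun n => Nat.le_succ _) ?_
  refine Filter.tendsto_atTop_atTop.2 fun b => ⟨2 ^ b, fun n hn => ?_⟩
  exact Nat.le_log_of_pow_le (by omega) hn

/-- On a random graph no output passes the test. -/
lemma eventually_prob_verified_le : ∀ᶠ n : ℕ in Filter.atTop,
    prob (PlantedClique.erdosRenyi n) (fun G => ∃ l k y, 1 ≤ k ∧ k ≤ l ∧ l ≤ lam n ∧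
      Verified n l k (PlantedClique.encodeGraph G) y) ≤ 1 / 3 := by
  obtain ⟨L, hL⟩ := Filter.eventually_atTop.1 eventually_pow_le_two_pow
  have hlog : ∀ᶠ k : ℕ in Filter.atTop, 3 * (k + 1) ^ 5 ≤ (2 ^ (k - 1)) ^ 2 := by
    have h := (isLittleO_pow_const_const_pow_of_one_lt (R := ℝ) 5
      (by norm_num : (1 : ℝ) < 2)).bound (by norm_num : (0 : ℝ) < 1 / 3)
    have h' := (Filter.tendsto_add_atTop_nat 1).eventually h
    filter_upwards [h', Filter.eventually_ge_atTop 3] with k hk hk3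
    simp only [norm_pow, Real.norm_natCast, Real.norm_ofNat] at hk
    have h2 : 3 * (k + 1) ^ 5 ≤ 2 ^ (k + 1) := by
      have : 3 * ((k + 1 : ℕ) : ℝ) ^ 5 ≤ 2 ^ (k + 1) := by linarith
      exact_mod_cast this
    refine h2.trans ?_
    rw [← pow_mul]
    exact Nat.pow_le_pow_right (by omega) (by omega)
  filter_upwards [tendsto_lam.eventually hlog, tendsto_lam.eventually_gt_atTop (L * L * L),
    Filter.eventually_ge_atTop 1] with n hn hnL hn1
  classical
  -- The possible triples of `l`, the number `μ` of parts and the degree `C`. There are only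
  -- polylogarithmically many, against a probability of at most `n⁻²` for each.
  let s : Finset (ℕ × ℕ × ℕ) := (Finset.range (lam n + 1) ×ˢ
    (Finset.range (lam n * lam n + 1) ×ˢ Finset.range (lam n * lam n + 1))).filter
      fun t => 1 ≤ t.2.1 ∧ 8 * lam n ≤ t.2.2 * ((t.1 + 1) / 2) ∧ 1 ≤ (t.1 + 1) / 2 ∧
        (t.2.1 * ((t.1 + 1) / 2)) ^ 8 ≤ 2 ^ ((t.1 + 1) / 2)
  have h1 : prob (PlantedClique.erdosRenyi n) (fun G => ∃ l k y, 1 ≤ k ∧ k ≤ l ∧ l ≤ lam n ∧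
      Verified n l k (PlantedClique.encodeGraph G) y) ≤
      ∑ t ∈ s, prob (PlantedClique.erdosRenyi n)
        (fun G => HasDense G t.2.1 ((t.1 + 1) / 2) (t.2.2 * ((t.1 + 1) / 2))) := by
    refine le_trans (prob_mono fun G hG => ?_) (prob_exists_le _ s _)
    obtain ⟨l, k, y, hk, hkl, hl, hv⟩ := hG
    obtain ⟨μ, C, hμ, hμl, hCl, hC, hd⟩ := hv.hasDense hk hkl hl
    refine ⟨(l, μ, C), ?_, hd⟩
    have hll : l * l ≤ lam n * lam n := Nat.mul_le_mul hl hl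
    simp only [s, Finset.mem_filter, Finset.mem_product, Finset.mem_range]
    refine ⟨⟨by omega, by omega, by omega⟩, hμ, hC, by omega, ?_⟩
    -- Small `l` cannot occur: the dense structure has `8λ ≤ C * h ≤ l³`, while `λ` exceeds `L³`.
    have hlL : L ≤ l := by
      by_contra! hlt
      have h3 : (l + 1) / 2 ≤ l := by omega
      have h4 : C * ((l + 1) / 2) ≤ l * l * l := Nat.mul_le_mul hCl h3
      have h5 : l * l * l ≤ L * L * L := by gcongr
      omega
    refine (Nat.pow_le_pow_left ?_ 8).trans (hL l hlL)
    exact Nat.mul_le_mul hμl (by omega)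
  have hscard : s.card ≤ (lam n + 1) ^ 5 := by
    refine (Finset.card_filter_le _ _).trans ?_
    simp only [Finset.card_product, Finset.card_range]
    have : lam n * lam n + 1 ≤ (lam n + 1) ^ 2 := by nlinarith
    calc _ ≤ (lam n + 1) * ((lam n + 1) ^ 2 * (lam n + 1) ^ 2) := by gcongr
      _ = _ := by ring
  have hn2 : 3 * s.card ≤ n ^ 2 := by
    refine (Nat.mul_le_mul_left 3 hscard).trans (hn.trans (Nat.pow_le_pow_left ?_ 2))
    simp only [lam, Nat.add_sub_cancel]
    exact Nat.pow_log_le_self 2 (by omega)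
  refine h1.trans ((Finset.sum_le_card_nsmul _ _ ((n : ℝ≥0∞) ^ 2)⁻¹ fun t ht => ?_).trans ?_)
  · simp only [s, Finset.mem_filter] at ht
    exact prob_hasDense_le ht.2.1 ht.2.2.2.1 ht.2.2.1 ht.2.2.2.2
  · rw [nsmul_eq_mul, ← div_eq_mul_inv]
    refine ENNReal.div_le_of_le_mul ?_
    rw [one_div, mul_comm, ← div_eq_mul_inv, ENNReal.le_div_iff_mul_le (Or.inl (by simp))
      (Or.inl (by simp)), mul_comm]
    exact_mod_cast hn2

/-! ### Instances built from graphs with a large clique -/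

lemma ofList_ofFn_eq_tabulate (N : ℕ) (φ : ℕ → Data) :
    Data.ofList (List.ofFn fun i : Fin N => φ i) = tabulate N φ := by
  rw [tabulate]
  congr 1
  exact List.ext_getElem (by simp) fun i h1 h2 => by simp

lemma source_lt {n l k i : ℕ} (hi : i < k) (hq : 0 < numChoices n l) {r : ℕ} (hr : r < 4) :
    4 * (i * numChoices n l) + r < numVert n l k := by
  have := Nat.mul_le_mul_right (numChoices n l) (show i + 1 ≤ k from hi)
  rw [numVert]
  nlinarith

/-- The instance encoded by `instData`. -/
def inst (n l k : ℕ) (gm : Data) (hq : 0 < numChoices n l) (hk : 0 < k) : DSN.Instance where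
  n := numVert n l k
  weight u v := weightOf gm (blockLen n l) l (numChoices n l) u v
  demands := List.ofFn fun i : Fin (k * k) =>
    (⟨4 * (i / k * numChoices n l), source_lt (Nat.div_lt_of_lt_mul i.2) hq (by omega : 0 < 4)⟩,
      ⟨4 * (i % k * numChoices n l) + 3, source_lt (Nat.mod_lt _ hk) hq (by omega)⟩)
  nodup := by
    refine List.nodup_ofFn.2 fun i j h => ?_
    simp only [Prod.mk.injEq, Fin.mk.injEq] at h
    have h1 : (i : ℕ) / k = j / k := Nat.eq_of_mul_eq_mul_right hq (by omega)
    have h2 : (i : ℕ) % k = j % k := Nat.eq_of_mul_eq_mul_right hq (by omega)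
    exact Fin.ext (by rw [← Nat.div_add_mod i k, ← Nat.div_add_mod j k, h1, h2])

section Inst

variable {n l k : ℕ} {gm : Data} {hq : 0 < numChoices n l} {hk : 0 < k}

lemma inst_k : (inst n l k gm hq hk).k = k * k := by
  simp [DSN.Instance.k, inst]

lemma inst_encode : (inst n l k gm hq hk).encode = instData n l k gm := by
  rw [DSN.Instance.encode, instData]
  congr 1
  · rw [Data.ofMatrix, ← ofList_ofFn_eq_tabulate]
    congr 2
    funext i
    exact ofList_ofFn_eq_tabulate (numVert n l k) fun v =>
      DSN.Instance.encodeWeight (weightOf gm (blockLen n l) l (numChoices n l) i v)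
  · rw [← ofList_ofFn_eq_tabulate]
    simp only [inst, List.map_ofFn]
    rfl

lemma mem_demands {a b : Fin (inst n l k gm hq hk).n} :
    (a, b) ∈ (inst n l k gm hq hk).demands ↔ ∃ i < k, ∃ j < k,
      a.val = 4 * (i * numChoices n l) ∧ b.val = 4 * (j * numChoices n l) + 3 := by
  constructor
  · intro h
    obtain ⟨i, hi⟩ := List.mem_ofFn.1 h
    exact ⟨i / k, Nat.div_lt_of_lt_mul i.2, i % k, Nat.mod_lt _ hk,
      congrArg (fun t => t.1.val) hi.symm, congrArg (fun t => t.2.val) hi.symm⟩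
  · rintro ⟨i, hi, j, hj, h1, h2⟩
    have hlt : j + k * i < k * k := by
      have := Nat.mul_le_mul_left k (show i + 1 ≤ k from hi)
      nlinarith
    refine List.mem_ofFn.2 ⟨⟨j + k * i, hlt⟩, Prod.ext (Fin.ext ?_) (Fin.ext ?_)⟩
    · simp only [Nat.add_mul_div_left _ _ hk, Nat.div_eq_of_lt hj, zero_add]
      exact h1.symm
    · simp only [Nat.add_mul_mod_self_left, Nat.mod_eq_of_lt hj]
      exact h2.symm

lemma weightOf_isSome {m q u v : ℕ} :
    (weightOf gm m l q u v).isSome = true ↔ ArcOne q u v ∨ ArcZero gm m l q u v := by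
  unfold weightOf
  split_ifs <;> simp_all

open Classical in
lemma weightOf_getD {m q u v : ℕ} :
    (weightOf gm m l q u v).getD 0 = if ArcOne q u v then 1 else 0 := by
  unfold weightOf
  split_ifs <;> simp_all

lemma entry_encodeSolution {I : DSN.Instance} {R : Fin I.n → Fin I.n → Bool} {u v : ℕ}
    (hu : u < I.n) (hv : v < I.n) : entry (I.encodeSolution R) u v ↔ R ⟨u, hu⟩ ⟨v, hv⟩ = true := by
  rw [entry, DSN.Instance.encodeSolution, Data.ofMatrix, nth_ofList,
    List.getD_eq_getElem _ _ (by simpa), List.getElem_ofFn, nth_ofList,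
    List.getD_eq_getElem _ _ (by simpa), List.getElem_ofFn, toBool_ofBool]

lemma inst_cost (R : Fin (inst n l k gm hq hk).n → Fin (inst n l k gm hq hk).n → Bool) :
    ∑ u ∈ Finset.range (numVert n l k), rowCost (numChoices n l) (numVert n l k)
      ((inst n l k gm hq hk).encodeSolution R) u = (inst n l k gm hq hk).cost R := by
  classical
  rw [DSN.Instance.cost, Finset.sum_range]
  refine Finset.sum_congr rfl fun u _ => ?_
  rw [rowCost, Finset.sum_range]
  refine Finset.sum_congr rfl fun v _ => ?_
  have h : entry ((inst n l k gm hq hk).encodeSolution R) u v ↔ R u v = true :=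
    entry_encodeSolution (I := inst n l k gm hq hk) (R := R) u.2 v.2
  rw [show (inst n l k gm hq hk).weight u v = weightOf gm (blockLen n l) l (numChoices n l) u v from rfl,
    weightOf_getD]
  by_cases hR : R u v = true
  · simp [h, hR]
  · simp [h, hR]

/-- Every solution passes the connectivity test. -/
lemma connects_of_isSolution {R : Fin (inst n l k gm hq hk).n → Fin (inst n l k gm hq hk).n → Bool}
    (hR : (inst n l k gm hq hk).IsSolution R) :
    Connects n l k gm ((inst n l k gm hq hk).encodeSolution R) := by
  intro i hi j hj
  have hpath := hR.2 (⟨4 * (i * numChoices n l), source_lt hi hq (by omega : 0 < 4)⟩,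
    ⟨4 * (j * numChoices n l) + 3, source_lt hj hq (by omega)⟩) (mem_demands.2 ⟨i, hi, j, hj, rfl, rfl⟩)
  have harc : ∀ a b, R a b = true → ArcOne (numChoices n l) a b ∨
      ArcZero gm (blockLen n l) l (numChoices n l) a b := fun a b h => weightOf_isSome.1 (hR.1 a b h)
  simp only at hpath
  -- Every arc raises the residue modulo four by one, so a path from a source to a sink has exactly
  -- three arcs; they are split off one after the other.
  rcases Relation.ReflTransGen.cases_head hpath with h | ⟨u, hu, hpath⟩
  · have := congrArg Fin.val h
    simp only at this
    omega
  have hu1 : ArcOne (numChoices n l) (4 * (i * numChoices n l)) u := by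
    rcases harc _ _ hu with h | h
    · exact h
    · have := h.1
      simp only at this
      omega
  have hu4 : u.val % 4 = 1 := by
    rcases hu1 with h | h
    · exact h.2.1
    · omega
  rcases Relation.ReflTransGen.cases_head hpath with h | ⟨v, hv, hpath⟩
  · have := congrArg Fin.val h
    simp only at this
    omega
  have hv0 : ArcZero gm (blockLen n l) l (numChoices n l) u v := by
    rcases harc _ _ hv with h | h
    · rcases h with h | h <;> omega
    · exact h
  have hv4 := hv0.2.1
  rcases Relation.ReflTransGen.cases_head hpath with h | ⟨w, hw, hpath⟩
  · have := congrArg Fin.val h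
    simp only at this
    omega
  have hw1 : ArcOne (numChoices n l) v w := by
    rcases harc _ _ hw with h | h
    · exact h
    · have := h.1
      omega
  have hw4 : w.val % 4 = 3 := by
    rcases hw1 with h | h
    · omega
    · exact h.2.1
  rcases Relation.ReflTransGen.cases_head hpath with h | ⟨x, hx, -⟩
  · have hw' : w.val = 4 * (j * numChoices n l) + 3 := congrArg Fin.val h
    refine ⟨u, u.2, v, v.2, ⟨?_, hu1⟩, hv0, ?_, hw' ▸ hw1⟩
    · exact (entry_encodeSolution (I := inst n l k gm hq hk)
        (source_lt hi hq (by omega : 0 < 4)) u.2).2 hu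
    · exact (entry_encodeSolution (I := inst n l k gm hq hk) v.2
        (source_lt hj hq (by omega))).2 (h ▸ hw)
  · rcases harc _ _ hx with h | h
    · rcases h with h | h <;> omega
    · have := h.1
      omega

/-- Approximate solutions pass the test if the optimum is small. -/
lemma verified_of_isApproxSolution {ρ : ℝ}
    {R R₀ : Fin (inst n l k gm hq hk).n → Fin (inst n l k gm hq hk).n → Bool}
    (hR₀ : (inst n l k gm hq hk).IsSolution R₀) (hc : (inst n l k gm hq hk).cost R₀ ≤ 2 * k)
    (hR : (inst n l k gm hq hk).IsApproxSolution ρ R)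
    (hρ : |ρ| * (2 * k) * (32 * lam n) ≤ (k * k * l : ℝ)) :
    Verified n l k gm ((inst n l k gm hq hk).encodeSolution R) := by
  refine ⟨?_, connects_of_isSolution hR.1⟩
  rw [Cheap, inst_cost]
  have h1 := hR.2 R₀ hR₀
  have hc' : ((inst n l k gm hq hk).cost R₀ : ℝ) ≤ 2 * k := by exact_mod_cast hc
  have h2 : ((inst n l k gm hq hk).cost R : ℝ) ≤ |ρ| * (2 * k) :=
    h1.trans ((mul_le_mul_of_nonneg_right (le_abs_self ρ) (Nat.cast_nonneg _)).trans
      (mul_le_mul_of_nonneg_left hc' (abs_nonneg _)))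
  have h3 : ((inst n l k gm hq hk).cost R : ℝ) * (32 * lam n) ≤ k * k * l :=
    (mul_le_mul_of_nonneg_right h2 (by positivity)).trans hρ
  exact_mod_cast h3

end Inst

/-- Expansion in base `m`: every choice of one vertex per block is coded by some number below `m ^
l`. -/
lemma exists_digits {m : ℕ} (l : ℕ) : ∀ r : ℕ → ℕ, (∀ c, r c < m) →
    ∃ σ < m ^ l, ∀ c < l, σ / m ^ c % m = r c := by
  induction l with
  | zero => exact fun r _ => ⟨0, by simp, by simp⟩
  | succ l ih =>
    intro r hr
    have hm : 0 < m := (Nat.zero_le _).trans_lt (hr 0)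
    obtain ⟨σ, hσ, h⟩ := ih (fun c => r (c + 1)) fun c => hr _
    refine ⟨r 0 + m * σ, ?_, ?_⟩
    · have h1 := Nat.mul_le_mul_left m (show σ + 1 ≤ m ^ l from hσ)
      have h2 := hr 0
      rw [pow_succ']
      nlinarith
    · rintro (_ | c) hc
      · simp [Nat.mod_eq_of_lt (hr 0)]
      · rw [pow_succ', ← Nat.div_div_eq_div_mul, Nat.add_mul_div_left _ _ hm,
          Nat.div_eq_of_lt (hr 0), zero_add]
        exact h c (by omega)

/-- The set `P` meets all blocks. -/
def HitsBlocks (n l : ℕ) (P : ℕ → Prop) : Prop :=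
  ∀ β < 2 * l * l, ∃ r < blockLen n l, P (β * blockLen n l + r)

/-- The set `P` is a clique. -/
def CliqueIn (n : ℕ) (gm : Data) (P : ℕ → Prop) : Prop :=
  ∀ x < n, ∀ y < n, x ≠ y → P x → P y → entry gm x y

lemma HitsBlocks.blockLen_pos {n l : ℕ} {P : ℕ → Prop} (h : HitsBlocks n l P) (hl : 0 < l) :
    0 < blockLen n l := by
  obtain ⟨r, hr, -⟩ := h 0 (by positivity)
  omega

lemma HitsBlocks.numChoices_pos {n l : ℕ} {P : ℕ → Prop} (h : HitsBlocks n l P) (hl : 0 < l) :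
    0 < numChoices n l := Nat.pow_pos (h.blockLen_pos hl)

/-- A clique that meets all blocks yields a solution of cost at most `2 * k`. -/
lemma exists_cheap_solution {n l k : ℕ} {gm : Data} {P : ℕ → Prop} (hhit : HitsBlocks n l P)
    (hcl : CliqueIn n gm P) (hk : 0 < k) (hkl : k ≤ l) (hq : 0 < numChoices n l) :
    ∃ R, (inst n l k gm hq hk).IsSolution R ∧ (inst n l k gm hq hk).cost R ≤ 2 * k := by
  classical
  have hm : 0 < blockLen n l := hhit.blockLen_pos (by omega)
  have hr : ∀ β, ∃ r < blockLen n l, β < 2 * l * l → P (β * blockLen n l + r) := by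
    intro β
    by_cases hβ : β < 2 * l * l
    · obtain ⟨r, h1, h2⟩ := hhit β hβ
      exact ⟨r, h1, fun _ => h2⟩
    · exact ⟨0, hm, fun h => absurd h hβ⟩
  choose r hr hrP using hr
  have hσ := fun i => exists_digits (m := blockLen n l) l (fun c => r (i * l + c)) fun c => hr _
  choose σ hσlt hσ using hσ
  have hpt : ∀ i < 2 * l, ∀ c < l, P (point (blockLen n l) l i c (σ i)) := by
    intro i hi c hc
    rw [point, hσ i c hc]
    refine hrP _ ?_
    nlinarith
  set q := numChoices n l with hqdef
  have hσlt' : ∀ i, σ i < q := hσlt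
  let U : ℕ → ℕ := fun i => 4 * (i * q + σ i) + 1
  let Z : ℕ → ℕ := fun j => 4 * (j * q + σ (l + j)) + 2
  have hdiv : ∀ i s, s < q → (i * q + s) / q = i := fun i s hs => by
    rw [mul_comm, Nat.mul_add_div hq, Nat.div_eq_of_lt hs, add_zero]
  have hmod : ∀ i s, s < q → (i * q + s) % q = s := fun i s hs => by
    rw [mul_comm, Nat.mul_add_mod, Nat.mod_eq_of_lt hs]
  have hU4 : ∀ i, U i / 4 = i * q + σ i := fun i => by simp only [U]; omega
  have hZ4 : ∀ i, Z i / 4 = i * q + σ (l + i) := fun i => by simp only [Z]; omega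
  have hlt : ∀ i < k, ∀ s < q, ∀ a < 4, 4 * (i * q + s) + a < numVert n l k := by
    intro i hi s hs a ha
    have := Nat.mul_le_mul_right q (show i + 1 ≤ k from hi)
    rw [numVert, ← hqdef]
    nlinarith
  have harcU : ∀ i, ArcOne q (4 * (i * q)) (U i) := fun i => Or.inl ⟨by omega, by simp only [U]; omega, by
    rw [hU4, hdiv _ _ (hσlt' i), Nat.mul_div_cancel_left _ (by omega), Nat.mul_div_cancel _ hq]⟩
  have harcZ : ∀ i, ArcOne q (Z i) (4 * (i * q) + 3) := fun i => Or.inr ⟨by simp only [Z]; omega,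
    by omega, by
      rw [hZ4, hdiv _ _ (hσlt' _), show (4 * (i * q) + 3) / 4 = i * q by omega,
        Nat.mul_div_cancel _ hq]⟩
  have hzero : ∀ i < k, ∀ j < k, ArcZero gm (blockLen n l) l q (U i) (Z j) := by
    intro i hi j hj
    refine ⟨by simp only [U]; omega, by simp only [Z]; omega, fun c hc c' hc' => ?_⟩
    rw [hU4, hZ4, hdiv _ _ (hσlt' _), hdiv _ _ (hσlt' _), hmod _ _ (hσlt' _), hmod _ _ (hσlt' _)]
    refine hcl _ (point_lt hm (by omega) hc (blockLen_mul_le n l)) _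
      (point_lt hm (by omega) hc' (blockLen_mul_le n l)) ?_ (hpt _ (by omega) c hc)
      (hpt _ (by omega) c' hc')
    intro h
    have := point_div_div (i := i) (σ := σ i) hm hc
    rw [h, point_div_div hm hc'] at this
    omega
  -- All free arcs are bought, and for each colour one arc from its source and one arc to its sink,
  -- namely those at the choices inside `P`.
  let Q : ℕ → ℕ → Prop := fun a b => ArcZero gm (blockLen n l) l q a b ∨
    ∃ i < k, (a = 4 * (i * q) ∧ b = U i) ∨ (a = Z i ∧ b = 4 * (i * q) + 3)
  refine ⟨fun a b => decide (Q a b), ⟨fun a b hab => ?_, ?_⟩, ?_⟩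
  · refine weightOf_isSome.2 ?_
    rcases of_decide_eq_true hab with h | ⟨i, -, ⟨h1, h2⟩ | ⟨h1, h2⟩⟩
    · exact Or.inr h
    · rw [h1, h2]
      exact Or.inl (harcU i)
    · rw [h1, h2]
      exact Or.inl (harcZ i)
  · rintro ⟨a, b⟩ hab
    obtain ⟨i, hi, j, hj, ha, hb⟩ := mem_demands.1 hab
    let u' : Fin (inst n l k gm hq hk).n := ⟨U i, hlt i hi _ (hσlt' _) 1 (by omega)⟩
    let v' : Fin (inst n l k gm hq hk).n := ⟨Z j, hlt j hj _ (hσlt' _) 2 (by omega)⟩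
    refine .head (b := u') (decide_eq_true (Or.inr ⟨i, hi, Or.inl ⟨ha, rfl⟩⟩)) (.head (b := v')
      (decide_eq_true (Or.inl (hzero i hi j hj))) (.single (decide_eq_true (Or.inr ⟨j, hj,
        Or.inr ⟨rfl, hb⟩⟩))))
  · have hcost : (inst n l k gm hq hk).cost (fun a b => decide (Q a b)) ≤
        (((Finset.range k).image fun i => (4 * (i * q), U i)) ∪
          ((Finset.range k).image fun i => (Z i, 4 * (i * q) + 3))).card := by
      have h1 : (inst n l k gm hq hk).cost (fun a b => decide (Q a b)) =
          ((Finset.univ : Finset (Fin (numVert n l k) × Fin (numVert n l k))).filter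
            fun t => Q t.1 t.2 ∧ ArcOne q t.1 t.2).card := by
        rw [Finset.card_filter, ← Finset.univ_product_univ, Finset.sum_product]
        refine Finset.sum_congr rfl fun a _ => Finset.sum_congr rfl fun b _ => ?_
        rw [show (inst n l k gm hq hk).weight a b = weightOf gm (blockLen n l) l q a b from rfl,
          weightOf_getD]
        by_cases hQ : Q a b <;> simp [hQ]
      rw [h1]
      refine Finset.card_le_card_of_injOn (fun t => (t.1.val, t.2.val)) ?_ ?_
      · rintro ⟨a, b⟩ hab
        simp only [Finset.coe_filter, Finset.mem_univ, true_and, Set.mem_ofPred_eq] at hab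
        obtain ⟨h | ⟨i, hi, h⟩, h'⟩ := hab
        · have h2 := h.1
          rcases h' with h' | h' <;> omega
        · simp only [Finset.coe_union, Finset.coe_image, Set.mem_union, Set.mem_image,
            Finset.mem_coe, Finset.mem_range, Prod.mk.injEq]
          rcases h with h | h
          · exact Or.inl ⟨i, hi, h.1.symm, h.2.symm⟩
          · exact Or.inr ⟨i, hi, h.1.symm, h.2.symm⟩
      · rintro ⟨a, b⟩ - ⟨a', b'⟩ - h
        simp only [Prod.mk.injEq] at h
        exact Prod.ext (Fin.ext h.1) (Fin.ext h.2)
    refine hcost.trans ((Finset.card_union_le _ _).trans ?_)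
    have h1 := Finset.card_image_le (s := Finset.range k) (f := fun i => (4 * (i * q), U i))
    have h2 := Finset.card_image_le (s := Finset.range k) (f := fun i => (Z i, 4 * (i * q) + 3))
    rw [Finset.card_range] at h1 h2
    omega

/-! ### The clock -/

lemma polyB_eval (p : Polynomial ℕ) : PolyB (fun x : ℕ => x) fun x => p.eval x := by
  induction p using Polynomial.induction_on' with
  | add p q hp hq => simpa using hp.add hq
  | monomial i c => simpa using (PolyB.const c).mul (PolyB.self.pow i)

lemma size_ofList_le {L : List Data} {B : ℕ} (h : ∀ x ∈ L, x.size ≤ B) :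
    (Data.ofList L).size ≤ L.length * B + 1 := by
  induction L with
  | nil => simp [Data.ofList, Data.size]
  | cons x L ih =>
    simp only [Data.ofList, Data.size, List.length_cons]
    have h1 := h x (by simp)
    have h2 := ih fun y hy => h y (by simp [hy])
    nlinarith

lemma size_tabulate_le {N B : ℕ} {φ : ℕ → Data} (h : ∀ i < N, (φ i).size ≤ B) :
    (tabulate N φ).size ≤ N * B + 1 := by
  refine (size_ofList_le (B := B) ?_).trans (by simp)
  intro x hx
  obtain ⟨i, hi, rfl⟩ := List.mem_map.1 hx
  exact h i (List.mem_range.1 hi)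

lemma size_ofUnary (m : ℕ) : (Data.ofUnary m).size = m + 1 := by
  induction m with
  | zero => rfl
  | succ m ih => rw [ofUnary_succ, Data.size, ih, Data.size]; ring

lemma size_instData_le (n l k : ℕ) (gm : Data) : (instData n l k gm).size ≤
    numVert n l k * (numVert n l k * 4 + 1) + 1 + (k * k * (2 * numVert n l k + 5) + 1) := by
  rw [instData, Data.size]
  refine add_le_add (size_tabulate_le fun u _ => size_tabulate_le fun v _ => ?_)
    (size_tabulate_le fun i hi => ?_)
  · unfold weightOf
    split_ifs <;> simp [DSN.Instance.encodeWeight, Data.size, Data.ofBinary, Data.ofList, Data.ofBool]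
  · have hk : 0 < k := by
      rcases Nat.eq_zero_or_pos k with h | h
      · simp [h] at hi
      · exact h
    rw [Data.size, size_ofUnary, size_ofUnary, numVert]
    have h1 := Nat.mul_le_mul_right (numChoices n l) (Nat.div_lt_of_lt_mul hi).le
    have h2 := Nat.mul_le_mul_right (numChoices n l) (Nat.mod_lt i hk).le
    omega

lemma four_le_stageSize (n l : ℕ) : 4 ≤ stageSize n l :=
  calc 4 = 2 ^ 2 := rfl
    _ ≤ 2 ^ (l + 2) := Nat.pow_le_pow_right (by omega) (by omega)
    _ ≤ _ := Nat.pow_le_pow_left (by omega) _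

/-- A clock that suffices for all constant parameters. -/
lemma exists_clock (f : ℕ → ℕ) (p : Polynomial ℕ) : ∃ d, ∀ n l k gm, k ≤ l → 6 * f (k * k) ≤ n →
    6 * (f (k * k) * p.eval (instData n l k gm).size) ≤ stageSize n l ^ d := by
  let α := {t : (ℕ × ℕ) × (ℕ × Data) // t.2.1 ≤ t.1.2}
  let M : α → ℕ := fun t => stageSize t.1.1.1 t.1.1.2
  have hk : PolyB M fun t => t.1.2.1 :=
    PolyB.self.of_le fun t => t.2.trans (stageSize_bounds _ _).2.1
  have hq : PolyB M fun t => numChoices t.1.1.1 t.1.1.2 := PolyB.self.of_le fun t =>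
    (Nat.pow_le_pow_left (Nat.div_le_self _ _) _).trans (stageSize_bounds _ _).2.2
  have hN : PolyB M fun t => numVert t.1.1.1 t.1.1.2 t.1.2.1 := (PolyB.const 4).mul (hk.mul hq)
  have hs : PolyB M fun t => (instData t.1.1.1 t.1.1.2 t.1.2.1 t.1.2.2).size :=
    (((hN.mul ((hN.mul (.const 4)).add (.const 1))).add (.const 1)).add
      (((hk.mul hk).mul (((PolyB.const 2).mul hN).add (.const 5))).add (.const 1))).of_le
      fun t => size_instData_le _ _ _ _
  obtain ⟨e, he⟩ := ((polyB_eval p).reindex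
    fun t : α => (instData t.1.1.1 t.1.1.2 t.1.2.1 t.1.2.2).size).trans hs
  -- One factor `s` pays for `6 * f (k * k) ≤ n ≤ s`, so the exponent does not depend on `f`; the
  -- factor two at `e` comes from `s + 2 ≤ s ^ 2`.
  refine ⟨1 + 2 * e, fun n l k gm hkl hf => ?_⟩
  have h1 := he ⟨((n, l), (k, gm)), hkl⟩
  simp only [M] at h1
  have h4 := four_le_stageSize n l
  have hn := (stageSize_bounds n l).1
  generalize stageSize n l = s at *
  calc 6 * (f (k * k) * p.eval (instData n l k gm).size)
      = 6 * f (k * k) * p.eval (instData n l k gm).size := by ring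
    _ ≤ s * (s + 2) ^ e := Nat.mul_le_mul (hf.trans hn) h1
    _ ≤ s * (s ^ 2) ^ e := by
        gcongr
        nlinarith
    _ = _ := by rw [pow_add, pow_one, pow_mul]

open Classical in
lemma map_decide_false {β : Type*} (μ : PMF β) (P : β → Prop) :
    (μ.map fun x => decide (P x)) false = prob μ fun x => ¬ P x := by
  rw [PMF.map_apply]
  refine tsum_congr fun x => ?_
  by_cases h : P x <;> simp [h]

lemma le_half_of_add_eq_one {a b : ℝ≥0∞} (h : a + b = 1) (h' : 2 / 3 ≤ a + 1 / 6) : b ≤ 1 / 2 := by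
  have ha : a ≠ ⊤ := fun h0 => by simp [h0] at h
  have hb : b ≠ ⊤ := fun h0 => by simp [h0] at h
  have h1 := congrArg ENNReal.toReal h
  rw [ENNReal.toReal_add ha hb, ENNReal.toReal_one] at h1
  have h2 := ENNReal.toReal_mono (by simp [ha]) h'
  rw [ENNReal.toReal_add ha (by simp)] at h2
  rw [← ENNReal.toReal_le_toReal hb (by simp)]
  simp only [ENNReal.toReal_div, ENNReal.toReal_ofNat, ENNReal.toReal_one] at h2 ⊢
  linarith

/-- In the presence of a clique that meets all blocks, an attempt succeeds with constant
probability. -/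
lemma half_le_attempt {A : Prog} {f : ℕ → ℕ} {g : ℕ → ℝ} {p : Polynomial ℕ} {d n l k : ℕ} {gm : Data}
    {P : ℕ → Prop}
    (hA : ∀ I : DSN.Instance, expectedTime A I.encode ≤ ((f I.k * p.eval I.encode.size : ℕ) : ℝ≥0∞))
    (hg : DSN.Approximates A g)
    (hclock : 6 * (f (k * k) * p.eval (instData n l k gm).size) ≤ stageSize n l ^ d)
    (hhit : HitsBlocks n l P) (hcl : CliqueIn n gm P) (hk : 0 < k) (hkl : k ≤ l)
    (hρ : |g (k * k)| * (2 * k) * (32 * lam n) ≤ (k * k * l : ℝ)) :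
    attempt A d n l k gm false ≤ 1 / 2 := by
  classical
  have hq := hhit.numChoices_pos (by omega)
  obtain ⟨R₀, hR₀, hc⟩ := exists_cheap_solution hhit hcl hk hkl hq
  have h1 := hg (inst n l k gm hq hk) ⟨R₀, hR₀⟩
  have h2 := hA (inst n l k gm hq hk)
  rw [inst_k, inst_encode] at h1 h2
  set S := {y | ∃ R, (inst n l k gm hq hk).IsApproxSolution (g (k * k)) R ∧
    y = (inst n l k gm hq hk).encodeSolution R} with hS
  set t := stageSize n l ^ d with ht
  rw [outputProb_eq] at h1
  rw [expectedTime_eq] at h2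
  have h3 := liveProb_mul_le (init A (instData n l k gm)) t
  have h4 := haltValue_le_add S (init A (instData n l k gm)) t
  -- Markov's inequality: the clock exceeds the expected time by a factor of at least six. Of the
  -- success probability `2 / 3` at least `1 / 2` is left.
  have hlive : liveProb t (init A (instData n l k gm)) ≤ 1 / 6 := by
    have h5 : ((f (k * k) * p.eval (instData n l k gm).size : ℕ) : ℝ≥0∞) * 6 ≤ ((t + 1 : ℕ) : ℝ≥0∞) := by
      exact_mod_cast (by omega)
    have h6 : liveProb t (init A (instData n l k gm)) ≤
        ((f (k * k) * p.eval (instData n l k gm).size : ℕ) : ℝ≥0∞) / ((t + 1 : ℕ) : ℝ≥0∞) := by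
      rw [ENNReal.le_div_iff_mul_le (Or.inl (by simp)) (Or.inl (ENNReal.natCast_ne_top _)), mul_comm]
      exact h3.trans h2
    refine h6.trans (ENNReal.div_le_of_le_mul ?_)
    rw [one_div, mul_comm _ ((t + 1 : ℕ) : ℝ≥0∞), ← div_eq_mul_inv,
      ENNReal.le_div_iff_mul_le (Or.inl (by simp)) (Or.inl (by simp))]
    exact h5
  have h5 : haltProb S t (init A (instData n l k gm)) ≤
      prob (outputLaw A (instData n l k gm) t) (fun y => y ∈ S) :=
    haltProb_le_outputLaw A (instData n l k gm) t S
  have h6 : prob (outputLaw A (instData n l k gm) t) (fun y => y ∈ S) ≤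
      prob (outputLaw A (instData n l k gm) t) (Verified n l k gm) := by
    refine prob_mono fun y hy => ?_
    rw [hS] at hy
    obtain ⟨R, hR, hy⟩ := hy
    rw [hy]
    exact verified_of_isApproxSolution hR₀ hc hR hρ
  rw [attempt, map_decide_false]
  exact le_half_of_add_eq_one (prob_add_not _ _)
    (h1.trans (h4.trans (add_le_add (h5.trans h6) hlive)))

/-! ### The search -/

/-- Success is absorbing and the attempts use independent coins, so failure of the search is failure
of all attempts. -/
lemma search_false (A : Prog) (d n l : ℕ) (gm : Data) :
    search A d n l gm false = ∏ i ∈ Finset.range (l * n), attempt A d n l (i / n + 1) gm false := by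
  have htrue : ∀ r i, iterate (fun i b => if b = true then PMF.pure true
      else attempt A d n l (i / n + 1) gm) r i true = PMF.pure true := by
    intro r
    induction r with
    | zero => exact fun i => rfl
    | succ r ih => exact fun i => by rw [iterate, if_pos rfl, PMF.pure_bind, ih]
  have h : ∀ r i, iterate (fun i b => if b = true then PMF.pure true
      else attempt A d n l (i / n + 1) gm) r i false false =
      ∏ j ∈ Finset.range r, attempt A d n l ((i + j) / n + 1) gm false := by
    intro r
    induction r with
    | zero => exact fun i => by simp [iterate]
    | succ r ih =>
      intro i
      rw [iterate, if_neg (by simp), PMF.bind_apply, tsum_fintype, Fintype.sum_bool, htrue, ih,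
        Finset.prod_range_succ']
      simp only [PMF.pure_apply, Bool.false_eq_true, if_false, mul_zero, zero_add, add_zero]
      rw [mul_comm]
      congr 1
      refine Finset.prod_congr rfl fun j _ => ?_
      rw [show i + 1 + j = i + (j + 1) by omega]
  rw [search, h]
  simp

/-- Exactly the rounds `i` with `i / n = k - 1` use this `k`, and there are `n` of them. The search
need not know which `k` is good. -/
lemma search_false_le {A : Prog} {d n l k : ℕ} {gm : Data} (hk : 0 < k) (hkl : k ≤ l)
    (h : attempt A d n l k gm false ≤ 1 / 2) : search A d n l gm false ≤ (1 / 2) ^ n := by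
  classical
  rcases Nat.eq_zero_or_pos n with hn | hn
  · subst hn
    simpa using PMF.coe_le_one _ _
  rw [search_false]
  calc _ ≤ ∏ i ∈ Finset.range (l * n), (if i / n + 1 = k then (1 / 2 : ℝ≥0∞) else 1) := by
        refine Finset.prod_le_prod (fun _ _ => zero_le) fun i _ => ?_
        split_ifs with hi
        · rwa [hi]
        · exact PMF.coe_le_one _ _
    _ = (1 / 2) ^ ((Finset.range (l * n)).filter fun i => i / n + 1 = k).card := by
        rw [Finset.prod_ite, Finset.prod_const, Finset.prod_const_one, mul_one]
    _ ≤ (1 / 2) ^ n := by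
        refine pow_le_pow_of_le_one zero_le (by simp) ?_
        calc n = (Finset.range n).card := (Finset.card_range n).symm
          _ ≤ _ := Finset.card_le_card_of_injOn (fun r => (k - 1) * n + r) ?_ ?_
        · intro r hr
          have hr' : r < n := by simpa using hr
          simp only [Finset.coe_filter, Finset.mem_range, Set.mem_ofPred_eq]
          have h1 := Nat.mul_le_mul_right n (show k - 1 + 1 ≤ l by omega)
          refine ⟨by nlinarith, ?_⟩
          rw [mul_comm, Nat.mul_add_div hn, Nat.div_eq_of_lt hr']
          omega
        · intro r _ r' _ h
          simpa using h

/-- A search that can succeed finds an output that passes the test. -/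
lemma exists_verified_of_search {A : Prog} {d n l : ℕ} {gm : Data}
    (h : search A d n l gm true ≠ 0) : ∃ k y, 1 ≤ k ∧ k ≤ l ∧ Verified n l k gm y := by
  classical
  by_contra! hno
  have h1 : search A d n l gm false = 1 := by
    rw [search_false]
    refine Finset.prod_eq_one fun i hi => ?_
    rw [attempt, map_decide_false]
    refine le_antisymm (prob_le_one _ _) ?_
    rw [← expect_const (outputLaw A (instData n l (i / n + 1) gm) (stageSize n l ^ d)) 1]
    refine expect_mono fun y => ?_
    have hlt : i / n + 1 ≤ l := by
      rw [Finset.mem_range] at hi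
      exact Nat.div_lt_of_lt_mul (by rwa [mul_comm])
    rw [if_pos (hno (i / n + 1) y (Nat.le_add_left _ _) hlt)]
  have h2 := (search A d n l gm).tsum_coe
  rw [tsum_fintype, Fintype.sum_bool, h1] at h2
  refine h ?_
  have h3 : search A d n l gm true + 1 = 0 + 1 := by rw [h2, zero_add]
  exact (ENNReal.add_left_inj (by simp)).1 h3

/-! ### A lower bound for the mode of the binomial distribution -/

/-- The quotient of the terms at `j + 1` and `j` is `(n - j)κ / ((j + 1)(n - κ))`, which is at least
one for `j < κ` and at most one for `j ≥ κ`. -/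
lemma binomial_term_le_mode {n κ : ℕ} (hκ : 0 < κ) (hκn : κ < n) {j : ℕ} (hj : j ≤ n) :
    n.choose j * (κ ^ j * (n - κ) ^ (n - j)) ≤ n.choose κ * (κ ^ κ * (n - κ) ^ (n - κ)) := by
  obtain ⟨c, rfl⟩ := Nat.exists_eq_add_of_lt hκn
  set n := κ + c + 1 with hn
  have hc : n - κ = c + 1 := by omega
  rw [hc]
  let t : ℕ → ℕ := fun j => n.choose j * (κ ^ j * (c + 1) ^ (n - j))
  have hstep : ∀ j < n, t (j + 1) * ((j + 1) * (c + 1)) = t j * ((n - j) * κ) := by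
    intro j hj
    have h1 := Nat.choose_succ_right_eq n j
    have h2 : (c + 1) ^ (n - j) = (c + 1) ^ (n - (j + 1)) * (c + 1) := by
      rw [← pow_succ]
      congr 1
      omega
    simp only [t, h2, pow_succ]
    calc _ = (n.choose (j + 1) * (j + 1)) * (κ ^ j * κ * (c + 1) ^ (n - (j + 1))) * (c + 1) := by ring
      _ = _ := by rw [h1]; ring
  have hup : ∀ i, ∀ j, j + i = κ → t j ≤ t κ := by
    intro i
    induction i with
    | zero => intro j hj; rw [← hj, add_zero]
    | succ i ih =>
      intro j hj
      refine le_trans ?_ (ih (j + 1) (by omega))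
      have h := hstep j (by omega)
      obtain ⟨s, hs⟩ : ∃ s, n - j = s := ⟨_, rfl⟩
      rw [hs] at h
      have hle : (j + 1) * (c + 1) ≤ s * κ := by
        have : s = i + 1 + (c + 1) := by omega
        rw [this]
        nlinarith
      refine Nat.le_of_mul_le_mul_right (c := (j + 1) * (c + 1)) ?_ (by positivity)
      rw [h]
      exact Nat.mul_le_mul_left _ hle
  have hdown : ∀ i, κ + i ≤ n → t (κ + i) ≤ t κ := by
    intro i
    induction i with
    | zero => exact fun _ => le_rfl
    | succ i ih =>
      intro hi
      refine le_trans ?_ (ih (by omega))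
      have h := hstep (κ + i) (by omega)
      obtain ⟨s, hs⟩ : ∃ s, n - (κ + i) = s := ⟨_, rfl⟩
      rw [hs] at h
      have hle : s * κ ≤ (κ + i + 1) * (c + 1) := by
        have : s ≤ c + 1 := by omega
        calc s * κ ≤ (c + 1) * (κ + i + 1) := Nat.mul_le_mul this (by omega)
          _ = _ := mul_comm _ _
      refine Nat.le_of_mul_le_mul_right (c := (κ + i + 1) * (c + 1)) ?_ (by positivity)
      calc _ = t (κ + i) * (s * κ) := h
        _ ≤ _ := Nat.mul_le_mul_left _ hle
  have := (le_total j κ).elim (fun h => hup (κ - j) j (by omega)) fun h => by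
    obtain ⟨i, rfl⟩ := Nat.exists_eq_add_of_le h
    exact hdown i hj
  simpa only [t, hc] using this

lemma pow_le_mode {n κ : ℕ} (hκ : 0 < κ) (hκn : κ < n) :
    n ^ n ≤ (n + 1) * (n.choose κ * (κ ^ κ * (n - κ) ^ (n - κ))) := by
  calc n ^ n = (κ + (n - κ)) ^ n := by rw [Nat.add_sub_of_le hκn.le]
    _ = ∑ j ∈ Finset.range (n + 1), n.choose j * (κ ^ j * (n - κ) ^ (n - j)) := by
        rw [add_pow]
        exact Finset.sum_congr rfl fun j _ => by simp; ring
    _ ≤ ∑ j ∈ Finset.range (n + 1), n.choose κ * (κ ^ κ * (n - κ) ^ (n - κ)) :=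
        Finset.sum_le_sum fun j hj => binomial_term_le_mode hκ hκn
          (by rw [Finset.mem_range] at hj; omega)
    _ = _ := by simp

/-- A threshold for which a random set has exactly `κ` elements with substantial probability. -/
lemma exists_threshold {n κ B : ℕ} (hκ : 0 < κ) (hκn : κ < n) (hB : 2 * n ≤ B) :
    ∃ p < B, B ^ n ≤ 2 * (n + 1) * n.choose κ * (p ^ κ * (B - p) ^ (n - κ)) := by
  have hn : 0 < n := by omega
  -- The density `κ / n`, scaled to thresholds below `B` and rounded upwards, so that the factor `p
  -- ^ κ` loses nothing.
  set p := κ * B / n + 1 with hp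
  have hpn : κ * B ≤ p * n := by
    have := Nat.lt_div_mul_add (a := κ * B) hn
    rw [hp]
    nlinarith
  have hpn' : p * n ≤ κ * B + n := by
    have := Nat.div_mul_le_self (κ * B) n
    rw [hp]
    nlinarith
  have hpB : p < B := by
    obtain ⟨c, hc⟩ := Nat.exists_eq_add_of_lt hκn
    refine Nat.lt_of_mul_lt_mul_right (a := n) (hpn'.trans_lt ?_)
    nlinarith
  refine ⟨p, hpB, ?_⟩
  have hmode := pow_le_mode hκ hκn
  obtain ⟨c, hc⟩ : ∃ c, n - κ = c := ⟨_, rfl⟩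
  obtain ⟨e, he⟩ : ∃ e, B - p = e := ⟨_, rfl⟩
  have hcn : κ + c = n := by omega
  have heB : p + e = B := by omega
  rw [hc] at hmode
  rw [hc, he]
  have hc0 : 0 < c := by omega
  -- The rounding harms only the vertices outside the set. By Bernoulli's inequality the loss is `(1
  -- - n / (B * c)) ^ c ≥ 1 - n / B ≥ 1 / 2`; this is where `2 * n ≤ B` is needed.
  have key : (B * c) ^ c ≤ 2 * (e * n) ^ c := by
    have h1 : (B : ℝ) * c - n ≤ e * n := by
      have h2 : (p : ℝ) * n ≤ κ * B + n := by exact_mod_cast hpn'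
      have h3 : (κ : ℝ) + c = n := by exact_mod_cast hcn
      have h4 : (p : ℝ) + e = B := by exact_mod_cast heB
      have h5 : (e : ℝ) * n = B * n - p * n := by rw [← h4]; ring
      have h6 : (B : ℝ) * c = B * n - κ * B := by rw [← h3]; ring
      linarith
    have hBc : (0 : ℝ) < B * c := by
      have : 0 < B * c := Nat.mul_pos (by omega) hc0
      exact_mod_cast this
    have hx : (-2 : ℝ) ≤ -(n / (B * c)) := by
      have : (n : ℝ) / (B * c) ≤ 2 := by
        rw [div_le_iff₀ hBc]
        have h8 : (n : ℝ) ≤ 2 * (B * c) := by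
          have : n ≤ 2 * (B * c) := by nlinarith
          exact_mod_cast this
        exact h8
      linarith
    have h2 := one_add_mul_le_pow hx c
    have h3 : (1 : ℝ) / 2 ≤ 1 + c * -(n / (B * c)) := by
      have hB' : (0 : ℝ) < B := by exact_mod_cast (by omega : 0 < B)
      have hc' : (0 : ℝ) < c := by exact_mod_cast hc0
      have h4 : (c : ℝ) * -(n / (B * c)) = -(n / B) := by field_simp
      rw [h4]
      have h5 : (n : ℝ) / B ≤ 1 / 2 := by
        rw [div_le_iff₀ hB']
        have : (2 * n : ℝ) ≤ B := by exact_mod_cast hB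
        linarith
      linarith
    have h4 : (B * c : ℝ) ^ c ≤ 2 * (e * n : ℝ) ^ c := by
      have h5 : (B * c : ℝ) * (1 + -(n / (B * c))) = B * c - n := by
        have : (B * c : ℝ) * (n / (B * c)) = n := by rw [mul_comm, div_mul_cancel₀ _ hBc.ne']
        rw [mul_add, mul_neg, this]
        ring
      have h6 : (0 : ℝ) ≤ B * c - n := by
        have : n ≤ B * c := by nlinarith
        have : (n : ℝ) ≤ B * c := by exact_mod_cast this
        linarith
      calc (B * c : ℝ) ^ c = 2 * ((B * c : ℝ) ^ c * (1 / 2)) := by ring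
        _ ≤ 2 * ((B * c : ℝ) ^ c * (1 + -(n / (B * c))) ^ c) := by
            gcongr
            exact h3.trans h2
        _ = 2 * (B * c - n : ℝ) ^ c := by rw [← mul_pow, h5]
        _ ≤ 2 * (e * n : ℝ) ^ c := by gcongr
    exact_mod_cast h4
  refine Nat.le_of_mul_le_mul_right (c := n ^ n) ?_ (by positivity)
  calc B ^ n * n ^ n ≤ B ^ n * ((n + 1) * (n.choose κ * (κ ^ κ * c ^ c))) :=
        Nat.mul_le_mul_left _ hmode
    _ = (n + 1) * n.choose κ * ((κ * B) ^ κ * (B * c) ^ c) := by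
        have h1 : B ^ n = B ^ κ * B ^ c := by rw [← pow_add, hcn]
        rw [h1, mul_pow, mul_pow]
        ring
    _ ≤ (n + 1) * n.choose κ * ((p * n) ^ κ * (2 * (e * n) ^ c)) := by gcongr
    _ = 2 * (n + 1) * n.choose κ * (p ^ κ * e ^ c) * (n ^ κ * n ^ c) := by
        rw [mul_pow, mul_pow]
        ring
    _ = _ := by rw [← pow_add, hcn]

/-! ### Random bits -/

lemma iterate_succ_last {β : Type*} (F : ℕ → β → PMF β) (r : ℕ) : ∀ i x,
    iterate F (r + 1) i x = (iterate F r i x).bind (F (i + r)) := by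
  induction r with
  | zero =>
    intro i x
    simp only [iterate, PMF.pure_bind, add_zero]
    exact PMF.bind_pure _
  | succ r ih =>
    intro i x
    rw [iterate]
    conv_rhs => rw [iterate]
    rw [PMF.bind_bind]
    congr 1
    funext y
    rw [ih, show i + 1 + r = i + (r + 1) by omega]

/-- A list of bits. -/
def bitsData {N : ℕ} (f : Fin N → Bool) : Data := .ofList (List.ofFn fun i => .ofBool (f i))

/-- Lookup in a list of bits. -/
def bitAt {N : ℕ} (f : Fin N → Bool) (i : ℕ) : Bool := if h : i < N then f ⟨i, h⟩ else false

lemma toBool_nth_bitsData {N : ℕ} (f : Fin N → Bool) (i : ℕ) :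
    (nth i (bitsData f)).toBool = bitAt f i := by
  rw [bitsData, nth_ofList, bitAt]
  split_ifs with h
  · rw [List.getD_eq_getElem _ _ (by simpa), List.getElem_ofFn, toBool_ofBool]
  · rw [List.getD_eq_default _ _ (by simpa using h)]
    rfl

lemma expect_uniform {β : Type*} [Fintype β] [Nonempty β] (φ : β → ℝ≥0∞) :
    expect (PMF.uniformOfFintype β) φ = (Fintype.card β : ℝ≥0∞)⁻¹ * ∑ x, φ x := by
  simp only [expect, PMF.uniformOfFintype_apply]
  rw [tsum_fintype, Finset.mul_sum]

/-- The bit drawn last is the head of the list, so the induction peels off the last round of the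
loop. -/
lemma expect_randBits (N : ℕ) (φ : Data → ℝ≥0∞) :
    expect (randBits N) φ = ((2 : ℝ≥0∞) ^ N)⁻¹ * ∑ f : Fin N → Bool, φ (bitsData f) := by
  induction N generalizing φ with
  | zero => simp [randBits, iterate, expect_pure, bitsData, Data.ofList]
  | succ N ih =>
    have h : randBits (N + 1) = (randBits N).bind fun x =>
        ((PMF.uniformOfFintype Bool).map Data.ofBool).bind fun b => PMF.pure (.cons b x) :=
      iterate_succ_last _ _ _ _
    rw [h, expect_bind, ih]
    simp only [expect_bind, expect_map, expect_pure]
    simp only [expect_uniform, Fintype.sum_bool, Fintype.card_bool]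
    rw [← Finset.mul_sum, ← mul_assoc, pow_succ, ENNReal.mul_inv (by simp) (by simp)]
    congr 1
    rw [← (Fin.consEquiv fun _ : Fin (N + 1) => Bool).sum_comp, Fintype.sum_prod_type,
      Fintype.sum_bool, Finset.sum_add_distrib]
    congr 1 <;> refine Finset.sum_congr rfl fun f _ => ?_ <;> congr 1 <;>
      simp [bitsData, List.ofFn_succ, Data.ofList, Fin.consEquiv]

lemma sum_testBit (x b : ℕ) : ∑ i ∈ Finset.range b, (if x.testBit i = true then 2 ^ i else 0) = x % 2 ^ b := by
  induction b with
  | zero => simp [Nat.mod_one]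
  | succ b ih =>
    rw [Finset.sum_range_succ, ih, Nat.mod_pow_succ, Nat.testBit_eq_decide_div_mod_eq]
    rcases Nat.mod_two_eq_zero_or_one (x / 2 ^ b) with h | h <;> simp [h]

lemma number_bitsData {N b o x : ℕ} {f : Fin N → Bool} (hx : x < 2 ^ b)
    (h : ∀ i < b, bitAt f (o + i) = x.testBit i) : number (bitsData f) b o = x := by
  classical
  have hsum := sum_testBit x b
  rw [Nat.mod_eq_of_lt hx] at hsum
  rw [number]
  refine (Finset.sum_congr rfl fun i hi => ?_).trans hsum
  rw [toBool_nth_bitsData, h i (Finset.mem_range.1 hi)]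

/-! ### Comparison of the sampled set with a uniformly random set of fixed size -/

open Classical in
/-- The sampled set. -/
def sampleSet (n : ℕ) (thr labels : Data) : Finset (Fin n) :=
  Finset.univ.filter fun v => InSample n thr labels v

lemma mem_sampleSet {n : ℕ} {thr labels : Data} {v : Fin n} :
    v ∈ sampleSet n thr labels ↔ InSample n thr labels v := by
  simp [sampleSet]

/-- The number of lists of labels that lead to a given set. -/
lemma le_card_labels {n p : ℕ} (thr : Data) (hthr : number thr (labelLen n) 0 = p)
    (hp : p < 2 ^ labelLen n) (S : Finset (Fin n)) :
    p ^ S.card * (2 ^ labelLen n - p) ^ (n - S.card) ≤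
      (Finset.univ.filter fun f : Fin (n * labelLen n) → Bool =>
        sampleSet n thr (bitsData f) = S).card := by
  classical
  set b := labelLen n with hb
  have hbpos : 0 < b := by simp [hb, labelLen, lam]
  -- The labels that put exactly the members of `S` below the threshold; `F` below writes their
  -- binary digits one after another.
  let T : Fin n → Finset ℕ := fun v => if v ∈ S then Finset.range p else Finset.Ico p (2 ^ b)
  have hT : (Fintype.piFinset T).card = p ^ S.card * (2 ^ b - p) ^ (n - S.card) := by
    rw [Fintype.card_piFinset]
    have : ∀ v, (T v).card = if v ∈ S then p else 2 ^ b - p := by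
      intro v
      simp only [T]
      split_ifs <;> simp
    simp only [this]
    rw [Finset.prod_ite, Finset.prod_const, Finset.prod_const]
    congr 2
    · congr 1
      ext v
      simp
    · rw [Finset.filter_not, Finset.card_sdiff]
      simp
  have hTlt : ∀ x ∈ Fintype.piFinset T, ∀ v, x v < 2 ^ b ∧ (x v < p ↔ v ∈ S) := by
    intro x hx v
    have := Fintype.mem_piFinset.1 hx v
    simp only [T] at this
    split_ifs at this with h
    · rw [Finset.mem_range] at this
      exact ⟨by omega, iff_of_true this h⟩
    · rw [Finset.mem_Ico] at this
      exact ⟨this.2, iff_of_false (by omega) h⟩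
  let F : (Fin n → ℕ) → Fin (n * b) → Bool := fun x i =>
    (x ⟨i / b, Nat.div_lt_of_lt_mul (i.2.trans_eq (mul_comm _ _))⟩).testBit (i % b)
  have hF : ∀ x ∈ Fintype.piFinset T, ∀ v : Fin n, number (bitsData (F x)) b (v * b) = x v := by
    intro x hx v
    refine number_bitsData (hTlt x hx v).1 fun i hi => ?_
    have hlt : v * b + i < n * b := by
      have := Nat.mul_le_mul_right b (show v.val + 1 ≤ n from v.2)
      nlinarith
    rw [bitAt, dif_pos hlt]
    simp only [F]
    congr 1
    · congr 1
      refine Fin.ext ?_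
      simp only
      rw [mul_comm, Nat.mul_add_div hbpos, Nat.div_eq_of_lt hi, add_zero]
    · rw [mul_comm, Nat.mul_add_mod, Nat.mod_eq_of_lt hi]
  rw [← hT]
  refine Finset.card_le_card_of_injOn F ?_ ?_
  · intro x hx
    simp only [Finset.coe_filter, Finset.mem_univ, true_and, Set.mem_ofPred_eq]
    ext v
    rw [mem_sampleSet, InSample, ← hb, hF x hx v, hthr]
    exact (hTlt x hx v).2
  · intro x hx y hy hxy
    funext v
    rw [← hF x hx v, ← hF y hy v, hxy]

lemma expect_randomSubset {n κ : ℕ} (hκn : κ ≤ n) (χ : Finset (Fin n) → ℝ≥0∞) :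
    expect (PlantedClique.randomSubset n κ) χ =
      (n.choose κ : ℝ≥0∞)⁻¹ * ∑ S ∈ Finset.powersetCard κ Finset.univ, χ S := by
  classical
  set s := Finset.powersetCard κ (Finset.univ : Finset (Fin n)) with hs
  have hscard : s.card = n.choose κ := by simp [hs]
  simp only [expect, PlantedClique.randomSubset, min_eq_left hκn]
  rw [tsum_fintype, Finset.mul_sum, ← Finset.sum_subset (Finset.subset_univ s)]
  · refine Finset.sum_congr rfl fun S hS => ?_
    rw [PMF.uniformOfFinset_apply_of_mem _ hS, hscard]
  · intro S _ hS
    rw [PMF.uniformOfFinset_apply_of_notMem _ hS, zero_mul]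

/-- The random set of the tests dominates a uniformly random set of fixed size. -/
lemma expect_randomSubset_le {n κ : ℕ} (hκ : 0 < κ) (hκn : κ < n) (χ : Finset (Fin n) → ℝ≥0∞) :
    expect (PlantedClique.randomSubset n κ) χ ≤ ((2 * 2 ^ labelLen n * (n + 1) : ℕ) : ℝ≥0∞) *
      expect (randBits (labelLen n)) fun thr => expect (randBits (n * labelLen n)) fun labels =>
        χ (sampleSet n thr labels) := by
  classical
  set b := labelLen n with hb
  have hB : 2 * n ≤ 2 ^ b := by
    have h1 := lt_two_pow_lam n
    have h2 : 2 ≤ 2 ^ lam n := by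
      calc 2 = 2 ^ 1 := rfl
        _ ≤ _ := Nat.pow_le_pow_right (by omega) (by simp [lam])
    rw [hb, labelLen, two_mul (lam n), pow_add]
    exact Nat.mul_le_mul h2 h1.le
  obtain ⟨p, hp, hbound⟩ := exists_threshold hκ hκn hB
  -- Only the event that the random threshold equals `p` is used. It has probability `2 ^ (-b)`,
  -- whence the factor `2 ^ b`; so the program needs no knowledge of `κ`.
  let f₀ : Fin b → Bool := fun i => p.testBit i
  have hf₀ : number (bitsData f₀) b 0 = p := number_bitsData hp fun i hi => by
    simp [bitAt, f₀, hi]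
  set s := Finset.powersetCard κ (Finset.univ : Finset (Fin n)) with hs
  have h1 : expect (PlantedClique.randomSubset n κ) χ = (n.choose κ : ℝ≥0∞)⁻¹ * ∑ S ∈ s, χ S :=
    expect_randomSubset hκn.le χ
  have h2 : ((2 : ℝ≥0∞) ^ (n * b))⁻¹ * ((p ^ κ * (2 ^ b - p) ^ (n - κ) : ℕ) * ∑ S ∈ s, χ S) ≤
      expect (randBits (n * b)) fun labels => χ (sampleSet n (bitsData f₀) labels) := by
    rw [expect_randBits]
    gcongr
    rw [← Finset.sum_fiberwise (s := Finset.univ)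
      (g := fun f : Fin (n * b) → Bool => sampleSet n (bitsData f₀) (bitsData f)), Finset.mul_sum]
    refine le_trans (Finset.sum_le_sum fun S hS => ?_)
      (Finset.sum_le_sum_of_subset (Finset.subset_univ s))
    rw [Finset.sum_congr rfl (g := fun _ => χ S) fun f hf => by rw [(Finset.mem_filter.1 hf).2],
      Finset.sum_const, nsmul_eq_mul]
    gcongr
    have h3 := le_card_labels (bitsData f₀) hf₀ hp S
    rw [(Finset.mem_powersetCard.1 hS).2] at h3
    exact h3
  have h3 : ((2 : ℝ≥0∞) ^ b)⁻¹ * (expect (randBits (n * b)) fun labels =>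
      χ (sampleSet n (bitsData f₀) labels)) ≤ expect (randBits b) fun thr =>
        expect (randBits (n * b)) fun labels => χ (sampleSet n thr labels) := by
    rw [expect_randBits b]
    gcongr
    exact Finset.single_le_sum (f := fun f : Fin b → Bool => expect (randBits (n * b)) fun labels =>
      χ (sampleSet n (bitsData f) labels)) (fun _ _ => zero_le) (Finset.mem_univ f₀)
  refine le_trans ?_ (mul_le_mul_right (h3.trans' (mul_le_mul_right h2 _)) _)
  rw [h1]
  set X := ∑ S ∈ s, χ S
  have hC : (n.choose κ : ℝ≥0∞) ≠ 0 := by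
    exact_mod_cast (Nat.choose_pos hκn.le).ne'
  rw [← mul_assoc, ← mul_assoc, ← mul_assoc]
  gcongr
  have h4 : ((2 ^ b : ℕ) : ℝ≥0∞) * ((2 ^ b : ℕ) : ℝ≥0∞) ^ n ≤ ((2 * 2 ^ b * (n + 1) : ℕ) : ℝ≥0∞) *
      ((p ^ κ * (2 ^ b - p) ^ (n - κ) : ℕ) : ℝ≥0∞) * (n.choose κ : ℝ≥0∞) := by
    have : 2 ^ b * (2 ^ b) ^ n ≤ 2 * 2 ^ b * (n + 1) * (p ^ κ * (2 ^ b - p) ^ (n - κ)) *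
        n.choose κ := by
      calc 2 ^ b * (2 ^ b) ^ n ≤ 2 ^ b * (2 * (n + 1) * n.choose κ * (p ^ κ * (2 ^ b - p) ^ (n - κ))) :=
            Nat.mul_le_mul_left _ hbound
        _ = _ := by ring
    exact_mod_cast this
  have hD : ((2 ^ b : ℕ) : ℝ≥0∞) * ((2 ^ b : ℕ) : ℝ≥0∞) ^ n = 2 ^ b * 2 ^ (n * b) := by
    push_cast
    rw [mul_comm n b, pow_mul]
  rw [hD] at h4
  set D : ℝ≥0∞ := 2 ^ b * 2 ^ (n * b) with hDdef
  have hD0 : D ≠ 0 := by simp [hDdef]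
  have hDt : D ≠ ⊤ := by
    rw [hDdef, ← pow_add]
    simp
  have hinv : D⁻¹ = ((2 : ℝ≥0∞) ^ b)⁻¹ * ((2 : ℝ≥0∞) ^ (n * b))⁻¹ :=
    ENNReal.mul_inv (by simp) (by simp)
  calc (n.choose κ : ℝ≥0∞)⁻¹ = (n.choose κ : ℝ≥0∞)⁻¹ * D * D⁻¹ := by
        rw [mul_assoc, ENNReal.mul_inv_cancel hD0 hDt, mul_one]
    _ ≤ (n.choose κ : ℝ≥0∞)⁻¹ * (((2 * 2 ^ b * (n + 1) : ℕ) : ℝ≥0∞) *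
        ((p ^ κ * (2 ^ b - p) ^ (n - κ) : ℕ) : ℝ≥0∞) * (n.choose κ : ℝ≥0∞)) * D⁻¹ := by gcongr
    _ = ((2 * 2 ^ b * (n + 1) : ℕ) : ℝ≥0∞) * ((p ^ κ * (2 ^ b - p) ^ (n - κ) : ℕ) : ℝ≥0∞) * D⁻¹ *
        ((n.choose κ : ℝ≥0∞) * (n.choose κ : ℝ≥0∞)⁻¹) := by ring
    _ = _ := by
        rw [ENNReal.mul_inv_cancel hC (by simp), mul_one, hinv]
        ring

/-! ### The graphs of the tests -/

lemma map_uniform_of_fiber {α β : Type*} [Fintype α] [Nonempty α] [Fintype β] [Nonempty β]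
    [DecidableEq β] (f : α → β) (c : ℕ)
    (h : ∀ y, (Finset.univ.filter fun x => f x = y).card = c) :
    (PMF.uniformOfFintype α).map f = PMF.uniformOfFintype β := by
  classical
  have hcard : Fintype.card α = Fintype.card β * c := by
    rw [← Finset.card_univ, Finset.card_eq_sum_card_fiberwise (t := Finset.univ) (f := f)
      fun _ _ => by simp]
    simp [h]
  have hc : c ≠ 0 := by
    rintro rfl
    exact Fintype.card_ne_zero (α := α) (by rw [hcard, mul_zero])
  ext y
  rw [PMF.map_apply, PMF.uniformOfFintype_apply, tsum_fintype]
  simp only [PMF.uniformOfFintype_apply]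
  rw [← Finset.sum_filter, Finset.sum_const]
  simp only [eq_comm (a := y)]
  rw [h, nsmul_eq_mul, hcard, Nat.cast_mul, ENNReal.mul_inv (by simp) (by simp), mul_left_comm,
    ENNReal.mul_inv_cancel (by exact_mod_cast hc) (by simp), mul_one]

/-- The graph given by a matrix of bits, of which the entries above the diagonal are used. -/
def graphOf {n : ℕ} (e : Fin (n * n) → Bool) : SimpleGraph (Fin n) where
  Adj u v := u ≠ v ∧ bitAt e (min u.val v.val * n + max u.val v.val) = true
  symm := ⟨fun u v h => ⟨h.1.symm, by rw [min_comm, max_comm]; exact h.2⟩⟩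
  loopless := ⟨fun u h => h.1 rfl⟩

lemma graphOf_adj {n : ℕ} {e : Fin (n * n) → Bool} {u v : Fin n} :
    (graphOf e).Adj u v ↔ u ≠ v ∧ bitAt e (min u.val v.val * n + max u.val v.val) = true := Iff.rfl

open Classical in
/-- The matrix of a graph as a list of bits. -/
def bitsOf {n : ℕ} (G : SimpleGraph (Fin n)) (i : Fin (n * n)) : Bool :=
  decide (G.Adj ⟨i / n, Nat.div_lt_of_lt_mul i.2⟩ ⟨i % n, Nat.mod_lt _ (by
    rcases Nat.eq_zero_or_pos n with h | h
    · have := i.2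
      simp [h] at this
    · exact h)⟩)

lemma pair_lt {n u v : ℕ} (hu : u < n) (hv : v < n) : u * n + v < n * n := by
  have := Nat.mul_le_mul_right n (show u + 1 ≤ n from hu)
  nlinarith

lemma bitAt_xor_bitsOf {n : ℕ} (e : Fin (n * n) → Bool) (G : SimpleGraph (Fin n)) (u v : Fin n) :
    bitAt (fun i => xor (e i) (bitsOf G i)) (min u.val v.val * n + max u.val v.val) = true ↔
      ¬ (bitAt e (min u.val v.val * n + max u.val v.val) = true ↔ G.Adj u v) := by
  classical
  have hn : 0 < n := (Nat.zero_le _).trans_lt u.2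
  have h1 : ∀ u v : Fin n, bitsOf G ⟨u.val * n + v.val, pair_lt u.2 v.2⟩ = decide (G.Adj u v) := by
    intro u v
    rw [bitsOf]
    congr 2
    · refine Fin.ext ?_
      simp only
      rw [mul_comm, Nat.mul_add_div hn, Nat.div_eq_of_lt v.2, add_zero]
    · refine Fin.ext ?_
      simp only
      rw [mul_comm, Nat.mul_add_mod, Nat.mod_eq_of_lt v.2]
  rcases le_total u.val v.val with h | h
  · rw [min_eq_left h, max_eq_right h, bitAt, bitAt, dif_pos (pair_lt u.2 v.2),
      dif_pos (pair_lt u.2 v.2), h1]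
    by_cases hG : G.Adj u v <;> simp [hG]
  · rw [min_eq_right h, max_eq_left h, bitAt, bitAt, dif_pos (pair_lt v.2 u.2),
      dif_pos (pair_lt v.2 u.2), h1, G.adj_comm]
    by_cases hG : G.Adj u v <;> simp [hG]

-- Adding the matrix of `G` modulo two is an involution that exchanges the fibres over `G` and over
-- the empty graph. All fibres of `graphOf` therefore have equal size, and uniform bits give a
-- uniform graph.
open Classical in
lemma card_graphOf_fiber {n : ℕ} (G : SimpleGraph (Fin n)) :
    (Finset.univ.filter fun e : Fin (n * n) → Bool => graphOf e = G).card =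
      (Finset.univ.filter fun e : Fin (n * n) → Bool => graphOf e = ⊥).card := by
  have hinv : ∀ e : Fin (n * n) → Bool,
      (fun i => xor (xor (e i) (bitsOf G i)) (bitsOf G i)) = e := by
    intro e
    funext i
    cases e i <;> cases bitsOf G i <;> rfl
  refine Finset.card_nbij' (fun e i => xor (e i) (bitsOf G i)) (fun e i => xor (e i) (bitsOf G i))
    ?_ ?_ (fun e _ => hinv e) fun e _ => hinv e
  · intro e he
    simp only [Finset.coe_filter, Finset.mem_univ, true_and, Set.mem_ofPred_eq] at he ⊢
    ext u v
    rw [graphOf_adj, bitAt_xor_bitsOf, ← he, graphOf_adj]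
    simp only [SimpleGraph.bot_adj]
    tauto
  · intro e he
    simp only [Finset.coe_filter, Finset.mem_univ, true_and, Set.mem_ofPred_eq] at he ⊢
    ext u v
    have h1 : ¬ (graphOf e).Adj u v := by rw [he]; exact id
    rw [graphOf_adj] at h1
    rw [graphOf_adj, bitAt_xor_bitsOf]
    have h2 : G.Adj u v → u ≠ v := fun h => h.ne
    tauto

lemma expect_erdosRenyi (n : ℕ) (φ : SimpleGraph (Fin n) → ℝ≥0∞) :
    expect (PlantedClique.erdosRenyi n) φ =
      ((2 : ℝ≥0∞) ^ (n * n))⁻¹ * ∑ e : Fin (n * n) → Bool, φ (graphOf e) := by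
  classical
  let : Fintype (SimpleGraph (Fin n)) := Fintype.ofFinite _
  rw [PlantedClique.erdosRenyi, ← map_uniform_of_fiber graphOf _ card_graphOf_fiber, expect_map,
    expect_uniform]
  simp

lemma cliqueOn_adj {n : ℕ} {S : Finset (Fin n)} {u v : Fin n} :
    (PlantedClique.cliqueOn S).Adj u v ↔ u ≠ v ∧ u ∈ S ∧ v ∈ S := by
  rw [PlantedClique.cliqueOn, SimpleGraph.fromRel_adj]
  tauto

lemma sampleMatrix_bitsData {n : ℕ} (e : Fin (n * n) → Bool) (thr labels : Data) :
    sampleMatrix n (bitsData e) thr labels =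
      PlantedClique.encodeGraph (graphOf e ⊔ PlantedClique.cliqueOn (sampleSet n thr labels)) := by
  classical
  rw [sampleMatrix, PlantedClique.encodeGraph, Data.ofMatrix, ← ofList_ofFn_eq_tabulate]
  congr 2
  funext u
  rw [← ofList_ofFn_eq_tabulate]
  congr 2
  funext v
  congr 1
  rw [decide_eq_decide, toBool_nth_bitsData, SimpleGraph.sup_adj, graphOf_adj, cliqueOn_adj,
    mem_sampleSet, mem_sampleSet, ne_eq, ne_eq, Fin.ext_iff]
  tauto

/-- Membership in a set of vertices, for numbers. -/
def memSet {n : ℕ} (S : Finset (Fin n)) (v : ℕ) : Prop := ∃ h : v < n, (⟨v, h⟩ : Fin n) ∈ S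

lemma hits_iff {n l : ℕ} {thr labels : Data} :
    Hits n l thr labels ↔ HitsBlocks n l (memSet (sampleSet n thr labels)) := by
  refine forall₂_congr fun β hβ => exists_congr fun r => and_congr_right fun hr => ?_
  have hlt : β * blockLen n l + r < n := by
    have h1 := Nat.mul_le_mul_right (blockLen n l) (show β + 1 ≤ 2 * l * l from hβ)
    have h2 := blockLen_mul_le n l
    nlinarith
  simp only [memSet, mem_sampleSet, hlt, exists_true_left]

lemma cliqueIn_encodeGraph {n : ℕ} (G : SimpleGraph (Fin n)) (S : Finset (Fin n)) :
    CliqueIn n (PlantedClique.encodeGraph (G ⊔ PlantedClique.cliqueOn S)) (memSet S) := by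
  intro x hx y hy hxy hxS hyS
  rw [entry_encodeGraph _ hx hy, SimpleGraph.sup_adj, cliqueOn_adj]
  exact Or.inr ⟨fun h => hxy (congrArg Fin.val h), hxS.2, hyS.2⟩

/-! ### The tests estimate the failure probability of the search -/

open Classical in
/-- The probability that the search fails on a graph with a planted clique that meets all blocks. -/
def failValue (A : Prog) (d n l : ℕ) (G : SimpleGraph (Fin n)) (S : Finset (Fin n)) : ℝ≥0∞ :=
  if HitsBlocks n l (memSet S) then
    search A d n l (PlantedClique.encodeGraph (G ⊔ PlantedClique.cliqueOn S)) false else 0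

lemma testRun_false (A : Prog) (d n l : ℕ) :
    testRun A d n l false = expect (PlantedClique.erdosRenyi n) fun G =>
      expect (randBits (labelLen n)) fun thr => expect (randBits (n * labelLen n)) fun labels =>
        failValue A d n l G (sampleSet n thr labels) := by
  classical
  have hap : ∀ (μ : PMF Data) (ν : Data → PMF Bool), (μ.bind ν) false = expect μ fun x => ν x false :=
    fun μ ν => PMF.bind_apply _ _ _
  rw [testRun, hap, expect_randBits, expect_erdosRenyi]
  congr 1
  refine Finset.sum_congr rfl fun e _ => ?_
  rw [hap]
  congr 1
  funext thr
  rw [hap]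
  congr 1
  funext labels
  rw [failValue, sampleMatrix_bitsData]
  by_cases h : Hits n l thr labels
  · rw [if_pos h, if_pos (hits_iff.1 h)]
  · rw [if_neg h, if_neg fun h' => h (hits_iff.2 h')]
    simp

/-- If the search often fails on planted graphs, this is noticed by the tests. -/
lemma expect_failValue_le {A : Prog} {d n l κ : ℕ} (hκ : 0 < κ) (hκn : κ < n) :
    (expect (PlantedClique.erdosRenyi n) fun G => expect (PlantedClique.randomSubset n κ) fun S =>
      failValue A d n l G S) ≤
      ((2 * 2 ^ labelLen n * (n + 1) : ℕ) : ℝ≥0∞) * testRun A d n l false := by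
  rw [testRun_false, ← expect_const_mul]
  exact expect_mono fun G => expect_randomSubset_le hκ hκn _

lemma testRuns_true (A : Prog) (d n l : ℕ) :
    testRuns A d n l true = (testRun A d n l true) ^ (n ^ 5) := by
  have hfalse : ∀ r i, iterate (fun _ b => if b = true then testRun A d n l else PMF.pure false) r i
      false = PMF.pure false := by
    intro r
    induction r with
    | zero => exact fun i => rfl
    | succ r ih => exact fun i => by rw [iterate, if_neg (by simp), PMF.pure_bind, ih]
  have h : ∀ r i, iterate (fun _ b => if b = true then testRun A d n l else PMF.pure false) r i
      true true = (testRun A d n l true) ^ r := by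
    intro r
    induction r with
    | zero => exact fun i => by simp [iterate]
    | succ r ih =>
      intro i
      rw [iterate, if_pos rfl, PMF.bind_apply, tsum_fintype, Fintype.sum_bool, hfalse, ih]
      simp [pow_succ']
  rw [testRuns, h]

/-- Bernoulli's inequality gives `r * a ≤ (1 + a) ^ r`, and `b * (1 + a) ≤ b + a = 1`. Thus a test
that fails with probability `a` cannot both have sizable `a` and be likely to pass `r` times,
however `a` depends on `n` and `l`. -/
lemma mul_pow_le_one {a b : ℝ≥0∞} (h : a + b = 1) (r : ℕ) : (r : ℝ≥0∞) * (a * b ^ r) ≤ 1 := by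
  have hb : b ≤ 1 := h ▸ le_add_self
  have h1 : ∀ r : ℕ, (r : ℝ≥0∞) * a + 1 ≤ (1 + a) ^ r := by
    intro r
    induction r with
    | zero => simp
    | succ r ih =>
      calc ((r + 1 : ℕ) : ℝ≥0∞) * a + 1 = (r * a + 1) * 1 + 1 * a := by push_cast; ring
        _ ≤ (r * a + 1) * 1 + (r * a + 1) * a := by
            gcongr
            exact le_add_self
        _ = (r * a + 1) * (1 + a) := by ring
        _ ≤ (1 + a) ^ r * (1 + a) := by gcongr
        _ = _ := (pow_succ _ _).symm
  have h2 : b * (1 + a) ≤ 1 := by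
    calc b * (1 + a) = b * a + b := by ring
      _ ≤ 1 * a + b := by gcongr
      _ = 1 := by rw [one_mul, h]
  calc (r : ℝ≥0∞) * (a * b ^ r) = b ^ r * (r * a) := by ring
    _ ≤ b ^ r * (1 + a) ^ r := by
        gcongr
        exact le_self_add.trans (h1 r)
    _ = (b * (1 + a)) ^ r := (mul_pow _ _ _).symm
    _ ≤ 1 := pow_le_one' h2 r

lemma bool_add (μ : PMF Bool) : μ false + μ true = 1 := by
  have := μ.tsum_coe
  rw [tsum_fintype, Fintype.sum_bool, add_comm] at this
  exact this

lemma stage_some_false (A : Prog) (d n l : ℕ) (gm : Data) :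
    stage A d n l gm (some false) = search A d n l gm false * testRuns A d n l true := by
  rw [stage, PMF.bind_apply, tsum_fintype, Fintype.sum_bool, if_pos rfl, if_neg (by simp),
    PMF.map_apply, tsum_fintype, Fintype.sum_bool]
  simp

lemma stage_none_le (A : Prog) (d n l : ℕ) (gm : Data) :
    stage A d n l gm none ≤ testRuns A d n l false := by
  rw [stage, PMF.bind_apply, tsum_fintype, Fintype.sum_bool, if_pos rfl, if_neg (by simp),
    PMF.map_apply, tsum_fintype, Fintype.sum_bool]
  simp only [PMF.pure_apply, reduceCtorEq, if_false, mul_zero, zero_add, Bool.false_eq_true, if_true]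
  exact mul_le_of_le_one_left zero_le (PMF.coe_le_one _ _)

lemma stage_some_true (A : Prog) (d n l : ℕ) (gm : Data) :
    stage A d n l gm (some true) = search A d n l gm true := by
  rw [stage, PMF.bind_apply, tsum_fintype, Fintype.sum_bool, if_pos rfl, if_neg (by simp),
    PMF.map_apply, tsum_fintype, Fintype.sum_bool]
  simp

/-- The probability that a stage rejects a planted graph. -/
lemma expect_stage_reject_le {A : Prog} {d n l κ : ℕ} (hκ : 0 < κ) (hκn : κ < n) :
    expect (PlantedClique.planted n κ)
      (fun G => stage A d n l (PlantedClique.encodeGraph G) (some false)) ≤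
      prob (PlantedClique.randomSubset n κ) (fun S => ¬ HitsBlocks n l (memSet S)) +
        ((2 * 2 ^ labelLen n * (n + 1) : ℕ) : ℝ≥0∞) / ((n ^ 5 : ℕ) : ℝ≥0∞) := by
  classical
  set T := testRun A d n l with hT
  set r := n ^ 5 with hr
  -- A rejection requires a failed search and passed tests, which are independent. Cliques that miss
  -- a block are charged to the first summand.
  have hpt : ∀ G S, search A d n l (PlantedClique.encodeGraph (G ⊔ PlantedClique.cliqueOn S)) false *
      testRuns A d n l true ≤
      (if ¬ HitsBlocks n l (memSet S) then 1 else 0) + failValue A d n l G S * (T true) ^ r := by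
    intro G S
    rw [testRuns_true]
    by_cases h : HitsBlocks n l (memSet S)
    · simp [failValue, h, hT, hr]
    · simp only [h, not_false_eq_true, if_true]
      exact (mul_le_one' (PMF.coe_le_one _ _) (pow_le_one' (PMF.coe_le_one _ _) _)).trans le_self_add
  have h1 : expect (PlantedClique.planted n κ)
      (fun G => stage A d n l (PlantedClique.encodeGraph G) (some false)) ≤
      expect (PlantedClique.erdosRenyi n) fun G => expect (PlantedClique.randomSubset n κ) fun S =>
        (if ¬ HitsBlocks n l (memSet S) then 1 else 0) + failValue A d n l G S * (T true) ^ r := by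
    rw [PlantedClique.planted, expect_bind]
    refine expect_mono fun G => ?_
    rw [expect_map]
    refine expect_mono fun S => ?_
    rw [stage_some_false]
    exact hpt G S
  refine h1.trans ?_
  simp only [expect_add, expect_const, expect_mul_const]
  refine add_le_add (expect_mono fun S => le_of_eq (by congr)) ?_
  have h2 := mul_le_mul_left (expect_failValue_le (A := A) (d := d) (l := l) hκ hκn) (T true ^ r)
  refine h2.trans ?_
  rw [ENNReal.le_div_iff_mul_le (Or.inl (by
    have : r ≠ 0 := by rw [hr]; exact pow_ne_zero _ (by omega)
    exact_mod_cast this)) (Or.inl (by simp))]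
  have h3 := mul_pow_le_one (bool_add T) r
  calc _ = ((2 * 2 ^ labelLen n * (n + 1) : ℕ) : ℝ≥0∞) * ((r : ℝ≥0∞) * (T false * T true ^ r)) := by ring
    _ ≤ _ := mul_le_of_le_one_right zero_le h3

/-! ### A random set meets all blocks -/

/-- Falling factorials are compared factor by factor, by `(n - m - i) / (n - i) ≤ (n - m) / n`. -/
lemma choose_sub_mul_pow_le (n m κ : ℕ) : (n - m).choose κ * n ^ κ ≤ n.choose κ * (n - m) ^ κ := by
  have h : (n - m).descFactorial κ * n ^ κ ≤ n.descFactorial κ * (n - m) ^ κ := by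
    induction κ with
    | zero => simp
    | succ κ ih =>
      have hstep : (n - m - κ) * n ≤ (n - κ) * (n - m) := by
        rcases Nat.eq_zero_or_pos (n - m - κ) with h0 | h0
        · simp [h0]
        · obtain ⟨c, hc⟩ : ∃ c, n - m - κ = c := ⟨_, rfl⟩
          have h1 : n = c + m + κ := by omega
          have h2 : n - κ = c + m := by omega
          have h3 : n - m = c + κ := by omega
          rw [hc, h2, h3, h1]
          nlinarith
      rw [Nat.descFactorial_succ, Nat.descFactorial_succ, pow_succ, pow_succ]
      calc _ = ((n - m - κ) * n) * ((n - m).descFactorial κ * n ^ κ) := by ring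
        _ ≤ ((n - κ) * (n - m)) * (n.descFactorial κ * (n - m) ^ κ) := Nat.mul_le_mul hstep ih
        _ = _ := by ring
  rw [Nat.descFactorial_eq_factorial_mul_choose, Nat.descFactorial_eq_factorial_mul_choose,
    mul_assoc, mul_assoc] at h
  exact Nat.le_of_mul_le_mul_left h (Nat.factorial_pos κ)

/-- The probability is a quotient of binomial coefficients, at most `(1 - |T| / n) ^ κ`, as for
sampling with replacement. -/
lemma prob_disjoint_le {n κ : ℕ} (hκn : κ ≤ n) (hn : 0 < n) (T : Finset (Fin n)) :
    prob (PlantedClique.randomSubset n κ) (fun S => Disjoint S T) ≤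
      ENNReal.ofReal (Real.exp (-(κ * T.card / n))) := by
  classical
  have h1 : prob (PlantedClique.randomSubset n κ) (fun S => Disjoint S T) ≤
      (n.choose κ : ℝ≥0∞)⁻¹ * ((n - T.card).choose κ : ℕ) := by
    rw [prob, expect_randomSubset hκn]
    gcongr
    refine (Eq.trans (Finset.sum_congr rfl fun S _ => by congr)
      (Finset.sum_filter (fun S => Disjoint S T) fun _ => (1 : ℝ≥0∞)).symm).le.trans ?_
    rw [Finset.sum_const, nsmul_eq_mul, mul_one]
    have h2 : (Finset.powersetCard κ (Finset.univ \ T)).card = (n - T.card).choose κ := by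
      rw [Finset.card_powersetCard, Finset.card_sdiff_of_subset (Finset.subset_univ _)]
      simp
    rw [← h2]
    exact_mod_cast Finset.card_le_card fun S hS => by
      simp only [Finset.mem_filter, Finset.mem_powersetCard] at hS ⊢
      refine ⟨fun x hx => Finset.mem_sdiff.2 ⟨Finset.mem_univ _, Finset.disjoint_left.1 hS.2 hx⟩, hS.1.2⟩
  refine h1.trans ?_
  have hC : (0 : ℝ) < n.choose κ := by exact_mod_cast Nat.choose_pos hκn
  have hn' : (0 : ℝ) < n := by exact_mod_cast hn
  have hm : T.card ≤ n := by simpa using Finset.card_le_univ T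
  rw [mul_comm, ← div_eq_mul_inv, ← ENNReal.ofReal_natCast, ← ENNReal.ofReal_natCast,
    ← ENNReal.ofReal_div_of_pos hC]
  refine ENNReal.ofReal_le_ofReal ?_
  have h3 : ((n - T.card).choose κ : ℝ) * (n : ℝ) ^ κ ≤ n.choose κ * ((n : ℝ) - T.card) ^ κ := by
    have := choose_sub_mul_pow_le n T.card κ
    rw [← Nat.cast_sub hm]
    exact_mod_cast this
  have h4 : ((n - T.card).choose κ : ℝ) / n.choose κ ≤ (1 - T.card / n) ^ κ := by
    rw [div_le_iff₀ hC]
    have h5 : (1 - T.card / n : ℝ) = (n - T.card) / n := by field_simp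
    rw [h5, div_pow, div_mul_eq_mul_div, le_div_iff₀ (by positivity)]
    linarith
  refine h4.trans ?_
  have h6 : (0 : ℝ) ≤ 1 - T.card / n := by
    rw [sub_nonneg, div_le_one hn']
    exact_mod_cast hm
  calc (1 - T.card / n : ℝ) ^ κ ≤ Real.exp (-(T.card / n)) ^ κ :=
        pow_le_pow_left₀ h6 (Real.one_sub_le_exp_neg _) _
    _ = _ := by
        rw [← Real.exp_nat_mul]
        congr 1
        ring

lemma prob_not_hitsBlocks_le {n l κ : ℕ} (hκn : κ ≤ n) (hn : 0 < n) :
    prob (PlantedClique.randomSubset n κ) (fun S => ¬ HitsBlocks n l (memSet S)) ≤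
      ENNReal.ofReal (2 * l * l * Real.exp (-(κ * blockLen n l / n))) := by
  classical
  have hlt : ∀ β < 2 * l * l, ∀ r < blockLen n l, β * blockLen n l + r < n := by
    intro β hβ r hr
    have h1 := Nat.mul_le_mul_right (blockLen n l) (show β + 1 ≤ 2 * l * l from hβ)
    have h2 := blockLen_mul_le n l
    nlinarith
  let T : ℕ → Finset (Fin n) := fun β => Finset.univ.filter fun x => ∃ r < blockLen n l,
    x.val = β * blockLen n l + r
  have hT : ∀ β < 2 * l * l, (T β).card = blockLen n l := by
    intro β hβ
    have : T β = (Finset.univ : Finset (Fin (blockLen n l))).image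
        fun r => ⟨β * blockLen n l + r, hlt β hβ r r.2⟩ := by
      ext x
      simp only [T, Finset.mem_filter, Finset.mem_univ, true_and, Finset.mem_image]
      constructor
      · rintro ⟨r, hr, h⟩
        exact ⟨⟨r, hr⟩, Fin.ext h.symm⟩
      · rintro ⟨r, rfl⟩
        exact ⟨r, r.2, rfl⟩
    rw [this, Finset.card_image_of_injective, Finset.card_univ, Fintype.card_fin]
    intro r r' h
    simpa [Fin.ext_iff] using h
  have h1 : prob (PlantedClique.randomSubset n κ) (fun S => ¬ HitsBlocks n l (memSet S)) ≤
      ∑ β ∈ Finset.range (2 * l * l), prob (PlantedClique.randomSubset n κ)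
        (fun S => Disjoint S (T β)) := by
    refine (prob_mono fun S hS => ?_).trans (prob_exists_le _ _ fun β S => Disjoint S (T β))
    simp only [HitsBlocks, not_forall, not_exists, not_and] at hS
    obtain ⟨β, hβ, h⟩ := hS
    refine ⟨β, Finset.mem_range.2 hβ, Finset.disjoint_left.2 fun x hx hxT => ?_⟩
    obtain ⟨r, hr, hxr⟩ := (Finset.mem_filter.1 hxT).2
    refine h r hr ⟨hlt β hβ r hr, ?_⟩
    convert hx using 1
    exact Fin.ext hxr.symm
  refine h1.trans ((Finset.sum_le_card_nsmul _ _
    (ENNReal.ofReal (Real.exp (-(κ * blockLen n l / n)))) fun β hβ => ?_).trans ?_)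
  · have := prob_disjoint_le hκn hn (T β)
    rwa [hT β (Finset.mem_range.1 hβ)] at this
  · rw [Finset.card_range, nsmul_eq_mul, ENNReal.ofReal_mul (by positivity)]
    gcongr
    rw [← ENNReal.ofReal_natCast]
    push_cast
    exact le_rfl

/-- The size of the planted clique. -/
lemma eventually_cliqueSize {δ : ℝ} (hδ : 0 < δ) (hδ' : δ < 1 / 2) : ∀ᶠ n : ℕ in Filter.atTop,
    0 < ⌈(n : ℝ) ^ δ⌉₊ ∧ ⌈(n : ℝ) ^ δ⌉₊ < n ∧ (4 * lam n ^ 3 : ℝ) ≤ (n : ℝ) ^ δ := by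
  have hb : (1 : ℝ) < 2 ^ δ := Real.one_lt_rpow (by norm_num) hδ
  have h1 : ∀ᶠ x : ℕ in Filter.atTop, (4 * x ^ 3 : ℝ) ≤ ((2 : ℝ) ^ (x - 1)) ^ δ := by
    have h := (isLittleO_pow_const_const_pow_of_one_lt (R := ℝ) 3 hb).bound
      (by positivity : (0 : ℝ) < 1 / (4 * 2 ^ δ))
    filter_upwards [h, Filter.eventually_ge_atTop 1] with x hx hx1
    rw [Real.norm_of_nonneg (by positivity), Real.norm_of_nonneg (by positivity)] at hx
    have h2 : ((2 : ℝ) ^ (x - 1)) ^ δ = ((2 : ℝ) ^ δ) ^ (x - 1) := by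
      rw [← Real.rpow_natCast, ← Real.rpow_natCast, ← Real.rpow_mul (by norm_num),
        ← Real.rpow_mul (by norm_num), mul_comm]
    rw [h2]
    have h3 : ((2 : ℝ) ^ δ) ^ x = (2 ^ δ) ^ (x - 1) * 2 ^ δ := by
      rw [← pow_succ]
      congr 1
      omega
    rw [h3] at hx
    have h4 : 1 / (4 * (2 : ℝ) ^ δ) * ((2 ^ δ) ^ (x - 1) * 2 ^ δ) = (2 ^ δ) ^ (x - 1) / 4 := by
      field_simp
    rw [h4] at hx
    linarith
  filter_upwards [tendsto_lam.eventually h1, Filter.eventually_ge_atTop 5] with n hn hn5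
  have hn0 : (1 : ℝ) ≤ n := by exact_mod_cast (by omega : 1 ≤ n)
  have hpos : (0 : ℝ) < (n : ℝ) ^ δ := Real.rpow_pos_of_pos (by linarith) _
  refine ⟨Nat.ceil_pos.2 hpos, ?_, ?_⟩
  · have h2 : (n : ℝ) ^ δ ≤ Real.sqrt n := by
      rw [Real.sqrt_eq_rpow]
      exact Real.rpow_le_rpow_of_exponent_le hn0 hδ'.le
    have h3 : Real.sqrt n < n - 1 := by
      have : (5 : ℝ) ≤ n := by exact_mod_cast hn5
      rw [Real.sqrt_lt' (by linarith)]
      nlinarith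
    have h4 := Nat.ceil_lt_add_one hpos.le
    have h5 : (⌈(n : ℝ) ^ δ⌉₊ : ℝ) < n := by linarith
    exact_mod_cast h5
  · refine hn.trans (Real.rpow_le_rpow (by positivity) ?_ hδ.le)
    have : 2 ^ (lam n - 1) ≤ n := by
      simp only [lam, Nat.add_sub_cancel]
      exact Nat.pow_log_le_self 2 (by omega)
    exact_mod_cast this

/-- All stages together rarely reject planted graphs. -/
lemma eventually_sum_stage_reject_le (A : Prog) (d : ℕ) {δ : ℝ} (hδ : 0 < δ) (hδ' : δ < 1 / 2) :
    ∀ᶠ n : ℕ in Filter.atTop, ∑ i ∈ Finset.range (lam n),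
      expect (PlantedClique.planted n ⌈(n : ℝ) ^ δ⌉₊)
        (fun G => stage A d n (i + 1) (PlantedClique.encodeGraph G) (some false)) ≤ 1 / 6 := by
  have hexp : ∀ᶠ x : ℕ in Filter.atTop, (2 * x ^ 3 * Real.exp (-x) : ℝ) ≤ 1 / 12 := by
    have h := (Real.tendsto_pow_mul_exp_neg_atTop_nhds_zero 3).comp tendsto_natCast_atTop_atTop
    filter_upwards [h.eventually (ge_mem_nhds (by norm_num : (0 : ℝ) < 1 / 24))] with x hx
    simp only [Function.comp] at hx
    linarith
  have hpow : ∀ᶠ x : ℕ in Filter.atTop, 192 * x ≤ 2 ^ (x - 1) := by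
    have h := (isLittleO_pow_const_const_pow_of_one_lt (R := ℝ) 1
      (by norm_num : (1 : ℝ) < 2)).bound (by norm_num : (0 : ℝ) < 1 / 384)
    filter_upwards [h, Filter.eventually_ge_atTop 1] with x hx hx1
    simp only [norm_pow, Real.norm_natCast, Real.norm_ofNat] at hx
    have h3 : (2 : ℝ) ^ x = 2 ^ (x - 1) * 2 := by
      rw [← pow_succ]
      congr 1
      omega
    have : (192 * x : ℝ) ≤ 2 ^ (x - 1) := by
      rw [h3] at hx
      linarith
    exact_mod_cast this
  filter_upwards [eventually_cliqueSize hδ hδ', tendsto_lam.eventually hexp,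
    tendsto_lam.eventually hpow, Filter.eventually_ge_atTop 1] with n hκ hexp hpow hn
  obtain ⟨hκ0, hκn, hκl⟩ := hκ
  set κ := ⌈(n : ℝ) ^ δ⌉₊ with hκdef
  have hκ4 : 4 * lam n ^ 3 ≤ κ := by
    have : (4 * lam n ^ 3 : ℝ) ≤ κ := hκl.trans (Nat.le_ceil _)
    exact_mod_cast this
  have hn0 : (0 : ℝ) < n := by exact_mod_cast hn
  have hlam : 1 ≤ lam n := by simp [lam]
  have hmiss : ∀ i ∈ Finset.range (lam n),
      prob (PlantedClique.randomSubset n κ) (fun S => ¬ HitsBlocks n (i + 1) (memSet S)) ≤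
        ENNReal.ofReal (2 * lam n ^ 2 * Real.exp (-lam n)) := by
    intro i hi
    refine (prob_not_hitsBlocks_le hκn.le (by omega)).trans (ENNReal.ofReal_le_ofReal ?_)
    have hil : i + 1 ≤ lam n := Finset.mem_range.1 hi
    set l := i + 1 with hl
    have hl2 : 2 * l * l ≤ n := by
      have h1 : l * l ≤ lam n * lam n := Nat.mul_le_mul hil hil
      nlinarith
    have hm1 : 1 ≤ blockLen n l := (Nat.one_le_div_iff (by positivity)).2 hl2
    have hm : n ≤ 4 * (l * l) * blockLen n l := by
      have h1 := Nat.lt_div_mul_add (a := n) (b := 2 * l * l) (by positivity)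
      have h2 : n / (2 * l * l) = blockLen n l := rfl
      rw [h2] at h1
      have h3 : 2 * l * l * 1 ≤ 2 * l * l * blockLen n l := Nat.mul_le_mul_left _ hm1
      nlinarith
    -- A block has at least `n / (4l²)` vertices, so a clique of `4λ³` vertices is expected to meet
    -- it at least `λ` times and misses it with probability at most `exp (-λ)`.
    have hx : lam n * n ≤ κ * blockLen n l := by
      have h1 : l * l ≤ lam n * lam n := Nat.mul_le_mul hil hil
      calc lam n * n ≤ lam n * (4 * (l * l) * blockLen n l) := Nat.mul_le_mul_left _ hm
        _ ≤ lam n * (4 * (lam n * lam n) * blockLen n l) := by gcongr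
        _ = 4 * lam n ^ 3 * blockLen n l := by ring
        _ ≤ _ := Nat.mul_le_mul_right _ hκ4
    have hx' : (lam n : ℝ) ≤ κ * blockLen n l / n := by
      rw [le_div_iff₀ hn0]
      exact_mod_cast hx
    have hll : (2 * l * l : ℝ) ≤ 2 * lam n ^ 2 := by
      have : 2 * l * l ≤ 2 * lam n ^ 2 := by nlinarith
      exact_mod_cast this
    calc _ ≤ (2 * l * l : ℝ) * Real.exp (-lam n) := by gcongr
      _ ≤ _ := by gcongr
  -- Labels have `2λ` bits, so the domination factor is at most `16n³`, and `n⁵` tests outweigh it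
  -- even after summation over the `λ` stages.
  have htest : ((2 * 2 ^ labelLen n * (n + 1) : ℕ) : ℝ≥0∞) / ((n ^ 5 : ℕ) : ℝ≥0∞) ≤
      ENNReal.ofReal (16 / n ^ 2) := by
    have hn5 : (0 : ℝ) < ((n ^ 5 : ℕ) : ℝ) := by positivity
    rw [← ENNReal.ofReal_natCast, ← ENNReal.ofReal_natCast, ← ENNReal.ofReal_div_of_pos hn5]
    refine ENNReal.ofReal_le_ofReal ?_
    have h1 : 2 ^ labelLen n ≤ 4 * n ^ 2 := by
      have h2 : 2 ^ lam n ≤ 2 * n := by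
        rw [lam, pow_succ, mul_comm]
        exact Nat.mul_le_mul_left 2 (Nat.pow_log_le_self 2 (by omega))
      rw [labelLen, mul_comm, pow_mul]
      calc (2 ^ lam n) ^ 2 ≤ (2 * n) ^ 2 := Nat.pow_le_pow_left h2 2
        _ = _ := by ring
    have h3 : 2 * 2 ^ labelLen n * (n + 1) ≤ 16 * n ^ 3 := by
      calc 2 * 2 ^ labelLen n * (n + 1) ≤ 2 * (4 * n ^ 2) * (2 * n) := by
            gcongr
            omega
        _ = _ := by ring
    rw [div_le_div_iff₀ hn5 (by positivity)]
    have h4 : ((2 * 2 ^ labelLen n * (n + 1) : ℕ) : ℝ) ≤ 16 * n ^ 3 := by exact_mod_cast h3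
    push_cast at h4 ⊢
    calc _ ≤ (16 * n ^ 3 : ℝ) * n ^ 2 := by gcongr
      _ = _ := by ring
  calc _ ≤ ∑ i ∈ Finset.range (lam n), (ENNReal.ofReal (2 * lam n ^ 2 * Real.exp (-lam n)) +
        ENNReal.ofReal (16 / n ^ 2)) := Finset.sum_le_sum fun i hi =>
        (expect_stage_reject_le hκ0 hκn).trans (add_le_add (hmiss i hi) htest)
    _ = ENNReal.ofReal (lam n * (2 * lam n ^ 2 * Real.exp (-lam n) + 16 / n ^ 2)) := by
        rw [Finset.sum_const, Finset.card_range, nsmul_eq_mul, ← ENNReal.ofReal_add (by positivity)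
          (by positivity), ENNReal.ofReal_mul (by positivity), ENNReal.ofReal_natCast]
    _ ≤ ENNReal.ofReal (1 / 6) := by
        refine ENNReal.ofReal_le_ofReal ?_
        have h1 : (lam n : ℝ) * (16 / n ^ 2) ≤ 1 / 12 := by
          have h2 : 192 * lam n ≤ n := hpow.trans (by
            simp only [lam, Nat.add_sub_cancel]
            exact Nat.pow_log_le_self 2 (by omega))
          have h3 : (192 * lam n : ℝ) ≤ n := by exact_mod_cast h2
          have h4 : (1 : ℝ) ≤ n := by exact_mod_cast hn
          rw [mul_div_assoc', div_le_iff₀ (by positivity)]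
          nlinarith
        have h2 : (lam n : ℝ) * (2 * lam n ^ 2 * Real.exp (-lam n)) = 2 * lam n ^ 3 * Real.exp (-lam n) := by
          ring
        rw [mul_add, h2]
        linarith
    _ = 1 / 6 := by
        rw [ENNReal.ofReal_div_of_pos (by norm_num)]
        simp

/-! ### The stages at which the algorithm works -/

/-- The union bound for `r` independent tests, stated without subtraction. -/
lemma one_le_pow_add {a b : ℝ≥0∞} (h : a + b = 1) (r : ℕ) : 1 ≤ r * a + b ^ r := by
  have hb : b ≤ 1 := h ▸ le_add_self
  induction r with
  | zero => simp
  | succ r ih =>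
    calc (1 : ℝ≥0∞) = a + b * 1 := by rw [mul_one, h]
      _ ≤ a + b * (r * a + b ^ r) := by gcongr
      _ = a + (b * (r * a) + b ^ (r + 1)) := by ring
      _ ≤ a + (1 * (r * a) + b ^ (r + 1)) := by gcongr
      _ = _ := by push_cast; ring

lemma testRuns_false_le (A : Prog) (d n l : ℕ) :
    testRuns A d n l false ≤ ((n ^ 5 : ℕ) : ℝ≥0∞) * testRun A d n l false := by
  have h1 := bool_add (testRuns A d n l)
  have h2 := one_le_pow_add (bool_add (testRun A d n l)) (n ^ 5)
  rw [← testRuns_true, ← h1] at h2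
  exact (ENNReal.add_le_add_iff_right ((PMF.coe_le_one _ _).trans_lt ENNReal.one_lt_top).ne).1 h2

/-- Stages above a small multiple of the logarithm decide almost surely. -/
lemma eventually_stage_none_le {A : Prog} {f : ℕ → ℕ} {g : ℕ → ℝ} {p : Polynomial ℕ} {d : ℕ}
    (hA : ∀ I : DSN.Instance, expectedTime A I.encode ≤ ((f I.k * p.eval I.encode.size : ℕ) : ℝ≥0∞))
    (hg : DSN.Approximates A g) (hg' : g =o[Filter.atTop] fun k : ℕ => Real.sqrt k)
    (hd : ∀ n l k gm, k ≤ l → 6 * f (k * k) ≤ n →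
      6 * (f (k * k) * p.eval (instData n l k gm).size) ≤ stageSize n l ^ d)
    {ε : ℝ} (hε : 0 < ε) : ∀ᶠ n : ℕ in Filter.atTop, ∀ l : ℕ, ε * lam n ≤ l → ∀ gm,
      stage A d n l gm none ≤ ((n ^ 5 : ℕ) : ℝ≥0∞) * (1 / 2) ^ n := by
  classical
  -- With `k * k` demand pairs, `|g (k * k)| ≤ (ε / 64) * k` gives `|g (k * k)| * 2k * 32λ ≤ k²ελ ≤
  -- k²l`, which is the requirement of `half_le_attempt`.
  have h1 := hg'.bound (by positivity : 0 < ε / 64)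
  have hsq : Filter.Tendsto (fun k : ℕ => k * k) Filter.atTop Filter.atTop :=
    Filter.tendsto_atTop_mono (fun k => Nat.le_mul_self k) Filter.tendsto_id
  -- This `k` depends on `ε` and `g` alone. It is fixed before `n` grows, so that both `k ≤ ελ` and
  -- `6 * f (k * k) ≤ n` hold eventually for arbitrary `f`.
  obtain ⟨k, hk, hk1⟩ := ((hsq.eventually h1).and (Filter.eventually_ge_atTop 1)).exists
  rw [Real.norm_eq_abs, Real.norm_of_nonneg (Real.sqrt_nonneg _), Nat.cast_mul,
    Real.sqrt_mul_self (Nat.cast_nonneg _)] at hk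
  have hlarge : ∀ᶠ n : ℕ in Filter.atTop, (k : ℝ) ≤ ε * lam n :=
    ((tendsto_natCast_atTop_atTop.comp tendsto_lam).const_mul_atTop hε).eventually_ge_atTop _
  filter_upwards [hlarge, Filter.eventually_ge_atTop (6 * f (k * k))] with n hn hnf l hl gm
  have hkl : k ≤ l := by exact_mod_cast hn.trans hl
  refine (stage_none_le A d n l gm).trans ((testRuns_false_le A d n l).trans ?_)
  gcongr
  rw [testRun_false]
  refine le_trans (expect_mono (ψ := fun _ => (1 / 2 : ℝ≥0∞) ^ n) fun G => ?_) (expect_const _ _).le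
  refine le_trans (expect_mono (ψ := fun _ => (1 / 2 : ℝ≥0∞) ^ n) fun thr => ?_) (expect_const _ _).le
  refine le_trans (expect_mono (ψ := fun _ => (1 / 2 : ℝ≥0∞) ^ n) fun labels => ?_)
    (expect_const _ _).le
  rw [failValue]
  split_ifs with hhit
  · refine search_false_le hk1 hkl (half_le_attempt hA hg (hd n l k _ hkl hnf) hhit
      (cliqueIn_encodeGraph _ _) hk1 hkl ?_)
    calc |g (k * k)| * (2 * k) * (32 * lam n) ≤ ε / 64 * k * (2 * k) * (32 * lam n) := by gcongr
      _ = k * k * (ε * lam n) := by ring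
      _ ≤ k * k * l := by gcongr
  · exact zero_le

/-! ### The verdict -/

lemma iterate_mainStep_some (A : Prog) (d n : ℕ) (gm : Data) (b : Bool) (r : ℕ) : ∀ i,
    iterate (mainStep A d n gm) r i (some b) = PMF.pure (some b) := by
  induction r with
  | zero => exact fun i => rfl
  | succ r ih => exact fun i => by rw [iterate, mainStep, PMF.pure_bind, ih]

lemma iterate_mainStep_succ (A : Prog) (d n : ℕ) (gm : Data) (r i : ℕ) (v : Option Bool) :
    iterate (mainStep A d n gm) (r + 1) i none v =
      stage A d n (i + 1) gm none * iterate (mainStep A d n gm) r (i + 1) none v +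
        (if v = none then 0 else stage A d n (i + 1) gm v) := by
  rw [iterate, PMF.bind_apply, tsum_fintype, Fintype.sum_option, Fintype.sum_bool,
    iterate_mainStep_some, iterate_mainStep_some]
  rcases v with _ | _ | _ <;> simp [mainStep]

/-- Without a verdict at the end every stage was undecided, so any one reliable stage gives a bound.
-/
lemma mainLaw_none_le (A : Prog) (d n : ℕ) (gm : Data) {j : ℕ} (hj : j < lam n) :
    mainLaw A d n gm none ≤ stage A d n (j + 1) gm none := by
  have h : ∀ r i j, i ≤ j → j < i + r →
      iterate (mainStep A d n gm) r i none none ≤ stage A d n (j + 1) gm none := by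
    intro r
    induction r with
    | zero => intro i j h1 h2; omega
    | succ r ih =>
      intro i j h1 h2
      rw [iterate_mainStep_succ, if_pos rfl, add_zero]
      rcases h1.eq_or_lt with rfl | h1
      · exact mul_le_of_le_one_right zero_le (PMF.coe_le_one _ _)
      · exact (mul_le_of_le_one_left zero_le (PMF.coe_le_one _ _)).trans (ih (i + 1) j h1 (by omega))
  exact h _ _ _ (Nat.zero_le _) (by omega)

lemma mainLaw_some_le (A : Prog) (d n : ℕ) (gm : Data) (b : Bool) :
    mainLaw A d n gm (some b) ≤ ∑ j ∈ Finset.range (lam n), stage A d n (j + 1) gm (some b) := by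
  have h : ∀ r i, iterate (mainStep A d n gm) r i none (some b) ≤
      ∑ j ∈ Finset.range r, stage A d n (i + j + 1) gm (some b) := by
    intro r
    induction r with
    | zero => intro i; simp [iterate]
    | succ r ih =>
      intro i
      rw [iterate_mainStep_succ, if_neg (by simp), Finset.sum_range_succ']
      refine add_le_add ((mul_le_of_le_one_left zero_le (PMF.coe_le_one _ _)).trans
        ((ih (i + 1)).trans (le_of_eq ?_))) le_rfl
      exact Finset.sum_congr rfl fun j _ => by rw [show i + 1 + j = i + (j + 1) by omega]
  simpa [mainLaw] using h (lam n) 0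

lemma mainLaw_add (A : Prog) (d n : ℕ) (gm : Data) : mainLaw A d n gm (some true) +
    (mainLaw A d n gm (some false) + mainLaw A d n gm none) = 1 := by
  have h := (mainLaw A d n gm).tsum_coe
  rw [tsum_fintype, Fintype.sum_option, Fintype.sum_bool] at h
  rw [← h]
  ring

lemma acceptProb_eq {A B : Prog} {d n : ℕ} (D : PMF (SimpleGraph (Fin n)))
    (hB : ∀ G : SimpleGraph (Fin n), outputProb B (PlantedClique.encodeGraph G) {Data.ofBool true} =
      mainLaw A d n (PlantedClique.encodeGraph G) (some true)) :
    PlantedClique.acceptProb B D =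
      expect D fun G => mainLaw A d n (PlantedClique.encodeGraph G) (some true) := by
  rw [PlantedClique.acceptProb, expect]
  exact tsum_congr fun G => by rw [hB]

/-- The distinguisher rarely accepts random graphs. -/
lemma expect_mainLaw_erdosRenyi_le (A : Prog) (d n : ℕ) :
    expect (PlantedClique.erdosRenyi n)
      (fun G => mainLaw A d n (PlantedClique.encodeGraph G) (some true)) ≤
      prob (PlantedClique.erdosRenyi n) (fun G => ∃ l k y, 1 ≤ k ∧ k ≤ l ∧ l ≤ lam n ∧
        Verified n l k (PlantedClique.encodeGraph G) y) := by
  classical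
  refine expect_mono fun G => ?_
  split_ifs with h
  · exact PMF.coe_le_one _ _
  · refine (mainLaw_some_le A d n _ true).trans (le_of_eq (Finset.sum_eq_zero fun j hj => ?_))
    rw [stage_some_true]
    by_contra h0
    obtain ⟨k, y, hk, hkl, hv⟩ := exists_verified_of_search h0
    exact h ⟨j + 1, k, y, hk, hkl, Finset.mem_range.1 hj, hv⟩

lemma two_thirds_le_of_add {a b c : ℝ≥0∞} (h : a + (b + c) = 1) (hb : b ≤ 1 / 6) (hc : c ≤ 1 / 6) :
    2 / 3 ≤ a := by
  have h1 : (2 / 3 : ℝ≥0∞) + (1 / 6 + 1 / 6) = 1 := by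
    have h2 : (2 / 3 : ℝ≥0∞) ≠ ⊤ := ENNReal.div_ne_top (by simp) (by simp)
    rw [← ENNReal.toReal_eq_toReal_iff' (by simp [h2]) (by simp), ENNReal.toReal_add h2 (by simp),
      ENNReal.toReal_add (by simp) (by simp)]
    simp
    norm_num
  refine (ENNReal.add_le_add_iff_right (a := (1 / 6 + 1 / 6 : ℝ≥0∞)) (by simp)).1 ?_
  calc (2 / 3 : ℝ≥0∞) + (1 / 6 + 1 / 6) = a + (b + c) := h1.trans h.symm
    _ ≤ _ := by gcongr

/-! ### The running time -/

lemma loopTime_le_const {β : Type*} {F : ℕ → β → PMF β} {T : ℕ → β → ℝ≥0∞} {c : ℝ≥0∞} (r : ℕ) :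
    ∀ i x, (∀ j x, j < i + r → T j x ≤ c) → loopTime F T r i x ≤ r * (10 + c) := by
  induction r with
  | zero => intro i x _; simp [loopTime]
  | succ r ih =>
    intro i x h
    rw [loopTime]
    calc _ ≤ 10 + c + expect (F i x) (fun _ => (r : ℝ≥0∞) * (10 + c)) := by
          gcongr
          · exact h i x (by omega)
          · exact expect_mono fun y => ih (i + 1) y fun j x hj => h j x (by omega)
      _ = _ := by
          rw [expect_const]
          push_cast
          ring

lemma loopTime_some (A : Prog) (d n D : ℕ) (gm : Data) (b : Bool) (r : ℕ) : ∀ i,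
    loopTime (mainStep A d n gm) (roundTime D n) r i (some b) = r * (10 + D) := by
  induction r with
  | zero => intro i; simp [loopTime]
  | succ r ih =>
    intro i
    rw [loopTime, mainStep, expect_pure, ih, roundTime]
    push_cast
    ring

/-- The time bound for a stage. -/
def stageBound (D n l : ℕ) : ℕ := (stageSize n l + 2) ^ D

lemma stageBound_mono {D n l l' : ℕ} (h : l ≤ l') : stageBound D n l ≤ stageBound D n l' :=
  Nat.pow_le_pow_left (Nat.add_le_add_right (Nat.pow_le_pow_right (by omega) (by omega)) 2) D

lemma roundTime_le {D n i l : ℕ} (h : i + 1 ≤ l) (v : Option Bool) :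
    roundTime D n i v ≤ ((D + stageBound D n l : ℕ) : ℝ≥0∞) := by
  cases v with
  | some b =>
    rw [roundTime]
    exact_mod_cast Nat.le_add_right _ _
  | none =>
    rw [roundTime]
    exact_mod_cast (stageBound_mono h).trans (Nat.le_add_left _ _)

/-- If stage `l` decides almost surely, later stages hardly contribute to the running time. -/
lemma loopTime_main_le {A : Prog} {d n D l L : ℕ} {gm : Data} {τ : ℝ≥0∞} (hl : 1 ≤ l)
    (hlL : l ≤ L) (hτ : stage A d n l gm none ≤ τ) :
    loopTime (mainStep A d n gm) (roundTime D n) L 0 none ≤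
      l * (10 + (D + stageBound D n l : ℕ)) + L * (10 + D) +
        τ * (L * (10 + (D + stageBound D n L : ℕ))) := by
  set R : ℝ≥0∞ := 10 + (D + stageBound D n l : ℕ) with hR
  set W : ℝ≥0∞ := L * (10 + D) with hW
  set Z : ℝ≥0∞ := L * (10 + (D + stageBound D n L : ℕ)) with hZ
  have hsome : ∀ r i b, r ≤ L →
      loopTime (mainStep A d n gm) (roundTime D n) r i (some b) ≤ W := by
    intro r i b hr
    rw [loopTime_some, hW]
    gcongr
  -- Here `s` counts the stages before stage `l`. Up to stage `l` each round costs at most `R`,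
  -- rounds after a verdict cost at most `W` in total, and the bound `Z` for all later stages is
  -- weighted by the chance `τ` that stage `l` is undecided.
  have key : ∀ s i r, i + s + 1 = l → l + r = L →
      loopTime (mainStep A d n gm) (roundTime D n) (s + 1 + r) i none ≤
        ((s + 1 : ℕ) : ℝ≥0∞) * R + W + τ * Z := by
    intro s
    induction s with
    | zero =>
      intro i r hi hr
      rw [show 0 + 1 + r = r + 1 by omega, loopTime]
      have h1 : expect (mainStep A d n gm i none)
          (loopTime (mainStep A d n gm) (roundTime D n) r (i + 1)) ≤ W + τ * Z := by
        calc _ ≤ expect (mainStep A d n gm i none) (fun v => W + if v = none then Z else 0) := by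
              refine expect_mono fun v => ?_
              cases v with
              | some b => exact (hsome r (i + 1) b (by omega)).trans le_self_add
              | none =>
                refine le_trans ?_ le_add_self
                rw [if_pos rfl, hZ]
                refine (loopTime_le_const (c := ((D + stageBound D n L : ℕ) : ℝ≥0∞)) r (i + 1) none
                  fun j v hj => roundTime_le (by omega) v).trans ?_
                gcongr
                omega
          _ = W + stage A d n l gm none * Z := by
              rw [expect_add, expect_const, mainStep, show i + 1 = l by omega, expect, tsum_fintype,
                Fintype.sum_option]
              simp
          _ ≤ _ := by gcongr
      calc _ ≤ 10 + ((D + stageBound D n l : ℕ) : ℝ≥0∞) + (W + τ * Z) := by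
            gcongr
            exact roundTime_le (by omega) none
        _ = _ := by
            rw [hR]
            push_cast
            ring
    | succ s ih =>
      intro i r hi hr
      rw [show s + 1 + 1 + r = (s + 1 + r) + 1 by omega, loopTime]
      calc _ ≤ 10 + ((D + stageBound D n l : ℕ) : ℝ≥0∞) + expect (mainStep A d n gm i none)
            (fun _ => ((s + 1 : ℕ) : ℝ≥0∞) * R + W + τ * Z) := by
            gcongr
            · exact roundTime_le (by omega) none
            · refine expect_mono fun v => ?_
              cases v with
              | some b =>
                refine (hsome _ (i + 1) b (by omega)).trans ?_
                exact le_add_self.trans le_self_add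
              | none => exact ih (i + 1) r (by omega) hr
        _ = _ := by
            rw [expect_const, hR]
            push_cast
            ring
  have h := key (l - 1) 0 (L - l) (by omega) (by omega)
  rw [show l - 1 + 1 + (L - l) = L by omega, show l - 1 + 1 = l by omega] at h
  exact h

/-- The left side is quasi-polynomial: with `x = lam n ≥ D + 20` its binary logarithm is at most `7x
+ (x + 1)(x + 3)D ≤ x³ ≤ 2 ^ (x - 1) ≤ n`. It makes stages reached with probability at most `n⁵ 2⁻ⁿ`
negligible. -/
lemma eventually_count_le (D : ℕ) : ∀ᶠ n : ℕ in Filter.atTop,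
    n ^ 5 * (lam n * (10 + (D + stageBound D n (lam n)))) ≤ 2 ^ n := by
  have hcube : ∀ᶠ x : ℕ in Filter.atTop, x ^ 3 ≤ 2 ^ (x - 1) := by
    have h := (isLittleO_pow_const_const_pow_of_one_lt (R := ℝ) 3
      (by norm_num : (1 : ℝ) < 2)).bound (by norm_num : (0 : ℝ) < 1 / 2)
    filter_upwards [h, Filter.eventually_ge_atTop 1] with x hx hx1
    simp only [norm_pow, Real.norm_natCast, Real.norm_ofNat] at hx
    have h3 : (2 : ℝ) ^ x = 2 ^ (x - 1) * 2 := by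
      rw [← pow_succ]
      congr 1
      omega
    have : (x : ℝ) ^ 3 ≤ 2 ^ (x - 1) := by
      rw [h3] at hx
      linarith
    exact_mod_cast this
  filter_upwards [tendsto_lam.eventually hcube, tendsto_lam.eventually_ge_atTop (D + 20),
    Filter.eventually_ge_atTop 2] with n hcube hx hn
  have hnlt := lt_two_pow_lam n
  have hnge : 2 ^ (lam n - 1) ≤ n := by
    simp only [lam, Nat.add_sub_cancel]
    exact Nat.pow_log_le_self 2 (by omega)
  have hbound : stageBound D n (lam n) ≤ 2 ^ ((lam n + 1) * (lam n + 3) * D) := by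
    have h1 : stageSize n (lam n) + 2 ≤ (n + 2) ^ (lam n + 3) := by
      have h2 := four_le_stageSize n (lam n)
      rw [show lam n + 3 = lam n + 2 + 1 by omega, pow_succ]
      have h3 : stageSize n (lam n) = (n + 2) ^ (lam n + 2) := rfl
      rw [← h3]
      nlinarith
    have h2 : n + 2 ≤ 2 ^ (lam n + 1) := by
      rw [pow_succ]
      omega
    calc stageBound D n (lam n) ≤ ((n + 2) ^ (lam n + 3)) ^ D := Nat.pow_le_pow_left h1 D
      _ ≤ ((2 ^ (lam n + 1)) ^ (lam n + 3)) ^ D := by gcongr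
      _ = _ := by rw [← pow_mul, ← pow_mul, mul_assoc]
  set x := lam n with hxdef
  have hD : 10 + (D + stageBound D n x) ≤ 2 ^ (x + (x + 1) * (x + 3) * D) := by
    have h1 : 10 + D + 1 ≤ 2 ^ x := (by omega : 10 + D + 1 ≤ x).trans Nat.lt_two_pow_self.le
    have h2 : 1 ≤ 2 ^ ((x + 1) * (x + 3) * D) := Nat.one_le_two_pow
    rw [pow_add]
    nlinarith
  calc n ^ 5 * (x * (10 + (D + stageBound D n x)))
      ≤ (2 ^ x) ^ 5 * (2 ^ x * 2 ^ (x + (x + 1) * (x + 3) * D)) := by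
        gcongr
        exact Nat.lt_two_pow_self.le
    _ = 2 ^ (x * 5 + (x + (x + (x + 1) * (x + 3) * D))) := by rw [← pow_mul, ← pow_add, ← pow_add]
    _ ≤ 2 ^ n := by
        refine Nat.pow_le_pow_right (by omega) (le_trans ?_ (hcube.trans hnge))
        obtain ⟨c, hc⟩ : ∃ c, x = D + 20 + c := Nat.exists_eq_add_of_le hx
        have h1 : (x + 1) * (x + 3) * D ≤ (x + 1) * (x + 3) * (x - 20) :=
          Nat.mul_le_mul_left _ (by omega)
        obtain ⟨e, he⟩ : ∃ e, x - 20 = e := ⟨_, rfl⟩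
        have he' : x = e + 20 := by omega
        rw [he] at h1
        refine le_trans (by omega : _ ≤ 7 * x + (x + 1) * (x + 3) * e) ?_
        rw [he']
        ring_nf
        nlinarith

lemma lam_le_log {n : ℕ} (hn : 1 ≤ n) : (lam n : ℝ) ≤ 2 * Real.log n + 1 := by
  have h1 : (2 : ℝ) ^ Nat.log 2 n ≤ n := by exact_mod_cast Nat.pow_log_le_self 2 (by omega)
  have h2 := Real.log_le_log (by positivity) h1
  rw [Real.log_pow] at h2
  have h3 := Real.log_two_gt_d9
  have h4 : (0 : ℝ) ≤ Nat.log 2 n := Nat.cast_nonneg _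
  rw [lam]
  push_cast
  nlinarith

/-- The running time is `n ^ (ε * log n)` for every `ε`. -/
lemma eventually_expectedTime_le {A B : Prog} {d D : ℕ}
    (hB : ∀ n (G : SimpleGraph (Fin n)), expectedTime B (PlantedClique.encodeGraph G) ≤
      (((n + 2) ^ D : ℕ) : ℝ≥0∞) + loopTime (mainStep A d n (PlantedClique.encodeGraph G))
        (roundTime D n) (lam n) 0 none)
    (hstage : ∀ ε : ℝ, 0 < ε → ∀ᶠ n : ℕ in Filter.atTop, ∀ l : ℕ, ε * lam n ≤ l → ∀ gm,
      stage A d n l gm none ≤ ((n ^ 5 : ℕ) : ℝ≥0∞) * (1 / 2) ^ n)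
    {ε : ℝ} (hε : 0 < ε) : ∀ᶠ n : ℕ in Filter.atTop, ∀ G : SimpleGraph (Fin n),
      expectedTime B (PlantedClique.encodeGraph G) ≤ ENNReal.ofReal ((n : ℝ) ^ (ε * Real.log n)) := by
  -- Stage `⌈ηλ⌉` costs about `n ^ (2 * D * η * λ)`, and `λ ≤ 2 log n + 1`; hence `8 * D * η ≤ ε`
  -- leaves half of the exponent for lower-order terms. The minimum with one keeps this stage among
  -- the first `λ`.
  set η := min 1 (ε / (8 * (D + 1))) with hη
  have hη0 : 0 < η := lt_min one_pos (by positivity)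
  have hη1 : η ≤ 1 := min_le_left _ _
  have hηε : 8 * D * η ≤ ε := by
    have h1 : η ≤ ε / (8 * (D + 1)) := min_le_right _ _
    rw [le_div_iff₀ (by positivity)] at h1
    nlinarith
  have hlog : ∀ᶠ n : ℕ in Filter.atTop, (10 * D + 8 : ℝ) ≤ ε / 2 * Real.log n :=
    ((Real.tendsto_log_atTop.comp tendsto_natCast_atTop_atTop).const_mul_atTop
      (by positivity)).eventually_ge_atTop _
  filter_upwards [hstage η hη0, eventually_count_le D, hlog, Filter.eventually_ge_atTop (D + 20)]
    with n hstage hcount hlog hn G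
  set l := ⌈η * lam n⌉₊ with hl
  have hlam1 : 1 ≤ lam n := by simp [lam]
  have hlamn : lam n ≤ n := by
    rw [lam]
    exact Nat.log_lt_self 2 (by omega)
  have hl1 : 1 ≤ l := Nat.ceil_pos.2 (by positivity)
  have hlL : l ≤ lam n := Nat.ceil_le.2 (mul_le_of_le_one_left (Nat.cast_nonneg _) hη1)
  have hlle : (l : ℝ) ≤ η * lam n + 1 := (Nat.ceil_lt_add_one (by positivity)).le
  have hloop := loopTime_main_le (D := D) hl1 hlL
    (hstage l (Nat.le_ceil _) (PlantedClique.encodeGraph G))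
  have hsmall : ((n ^ 5 : ℕ) : ℝ≥0∞) * (1 / 2) ^ n *
      (lam n * (10 + (D + stageBound D n (lam n) : ℕ))) ≤ 1 := by
    have h1 : ((n ^ 5 : ℕ) : ℝ≥0∞) * (lam n * (10 + (D + stageBound D n (lam n) : ℕ))) ≤ 2 ^ n := by
      exact_mod_cast hcount
    calc _ = (((n ^ 5 : ℕ) : ℝ≥0∞) * (lam n * (10 + (D + stageBound D n (lam n) : ℕ)))) *
          (1 / 2) ^ n := by ring
      _ ≤ 2 ^ n * (1 / 2) ^ n := by gcongr
      _ = 1 := by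
          rw [← mul_pow, one_div, ENNReal.mul_inv_cancel (by simp) (by simp), one_pow]
  have hnat : (n + 2) ^ D + (l * (10 + (D + stageBound D n l)) + lam n * (10 + D) + 1) ≤
      n ^ (2 * ((l + 3) * D + 4)) := by
    have hs : stageBound D n l ≤ (n + 2) ^ ((l + 3) * D) := by
      have h1 : stageSize n l + 2 ≤ (n + 2) ^ (l + 3) := by
        have h2 := four_le_stageSize n l
        have h3 : stageSize n l = (n + 2) ^ (l + 2) := rfl
        rw [show l + 3 = l + 2 + 1 by omega, pow_succ, ← h3]
        nlinarith
      rw [pow_mul]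
      exact Nat.pow_le_pow_left h1 D
    have hD : (n + 2) ^ D ≤ (n + 2) ^ ((l + 3) * D) :=
      Nat.pow_le_pow_right (by omega) (by nlinarith)
    have hq : 1 ≤ (n + 2) ^ ((l + 3) * D) := Nat.one_le_pow _ _ (by omega)
    rw [pow_mul]
    -- The bounds are powers of `n + 2`; passing to base `n` doubles the exponent.
    refine le_trans ?_ (Nat.pow_le_pow_left (by nlinarith : n + 2 ≤ n ^ 2) _)
    rw [pow_add]
    generalize (n + 2) ^ ((l + 3) * D) = Q at *
    set N := n + 2 with hN
    have hlN : l ≤ N := by omega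
    have hlamN : lam n ≤ N := by omega
    have hDN : 10 + D ≤ N := by omega
    have hN22 : 22 ≤ N := by omega
    calc N ^ D + (l * (10 + (D + stageBound D n l)) + lam n * (10 + D) + 1)
        ≤ Q + (N * (N + Q) + N * N + 1) := by
          have h1 : 10 + (D + stageBound D n l) ≤ N + Q := by omega
          have h2 := Nat.mul_le_mul hlN h1
          have h3 := Nat.mul_le_mul hlamN hDN
          omega
      _ ≤ Q * (1 + N + 2 * (N * N) + 1) := by nlinarith
      _ ≤ Q * N ^ 4 := by
          refine Nat.mul_le_mul_left _ ?_
          have h1 : 22 * N ≤ N * N := Nat.mul_le_mul_right _ hN22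
          have h2 : 22 * (N * N) ≤ N * N * (N * N) := Nat.mul_le_mul_right _ (by nlinarith)
          calc _ ≤ 22 * (N * N) := by omega
            _ ≤ N * N * (N * N) := h2
            _ = N ^ 4 := by ring
  have htime : expectedTime B (PlantedClique.encodeGraph G) ≤
      ((n ^ (2 * ((l + 3) * D + 4)) : ℕ) : ℝ≥0∞) := by
    refine (hB n G).trans ((add_le_add le_rfl (hloop.trans (add_le_add le_rfl hsmall))).trans ?_)
    exact_mod_cast hnat
  refine htime.trans ?_
  rw [← ENNReal.ofReal_natCast]
  refine ENNReal.ofReal_le_ofReal ?_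
  have hn1 : (1 : ℝ) ≤ n := by exact_mod_cast (by omega : 1 ≤ n)
  rw [Nat.cast_pow, ← Real.rpow_natCast]
  refine Real.rpow_le_rpow_of_exponent_le hn1 ?_
  have h1 := lam_le_log (by omega : 1 ≤ n)
  have hlog0 : 0 ≤ Real.log n := Real.log_nonneg hn1
  have hD0 : (0 : ℝ) ≤ D := Nat.cast_nonneg _
  push_cast
  calc 2 * (((l : ℝ) + 3) * D + 4) ≤ 2 * ((η * lam n + 1 + 3) * D + 4) := by gcongr
    _ ≤ 2 * ((η * (2 * Real.log n + 1) + 1 + 3) * D + 4) := by gcongr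
    _ = 8 * D * η * (Real.log n / 2) + (2 * D * η + 8 * D + 8) := by ring
    _ ≤ ε * (Real.log n / 2) + (2 * D * 1 + 8 * D + 8) := by gcongr
    _ = ε / 2 * Real.log n + (10 * D + 8) := by ring
    _ ≤ ε / 2 * Real.log n + ε / 2 * Real.log n := by gcongr
    _ = ε * Real.log n := by ring

/-! ### The distinguisher contradicts the hypothesis -/

/-- Time bounds `n ^ (ε * log n)` for every `ε` combine to `n ^ o(log n)`. -/
lemma runsInTime_of_eventually {B : Prog}
    (h : ∀ ε : ℝ, 0 < ε → ∀ᶠ n : ℕ in Filter.atTop, ∀ G : SimpleGraph (Fin n),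
      expectedTime B (PlantedClique.encodeGraph G) ≤
        ENNReal.ofReal ((n : ℝ) ^ (ε * Real.log n))) :
    PlantedClique.RunsInTime B := by
  let T : ℕ → ℝ≥0∞ := fun n =>
    ⨆ G : SimpleGraph (Fin n), expectedTime B (PlantedClique.encodeGraph G)
  have hT : ∀ ε : ℝ, 0 < ε → ∀ᶠ n : ℕ in Filter.atTop,
      T n ≤ ENNReal.ofReal ((n : ℝ) ^ (ε * Real.log n)) := fun ε hε =>
    (h ε hε).mono fun n hn => iSup_le hn
  -- The worst-case time, raised to at least one so that its logarithm is nonnegative. The exponent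
  -- `log τ / log n` then reproduces `τ` exactly.
  let τ : ℕ → ℝ := fun n => max 1 (T n).toReal
  refine ⟨fun n => Real.log (τ n) / Real.log n, ?_, ?_⟩
  · refine Asymptotics.isLittleO_iff.2 fun ε hε => ?_
    filter_upwards [hT ε hε, Filter.eventually_ge_atTop 2] with n hn hn2
    have hn1 : (1 : ℝ) < n := by exact_mod_cast (by omega : 1 < n)
    have hlog : 0 < Real.log n := Real.log_pos hn1
    have hpos : (0 : ℝ) < (n : ℝ) ^ (ε * Real.log n) := Real.rpow_pos_of_pos (by linarith) _
    have hτ : τ n ≤ (n : ℝ) ^ (ε * Real.log n) := by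
      refine max_le (Real.one_le_rpow hn1.le (by positivity)) ?_
      exact ENNReal.toReal_le_of_le_ofReal hpos.le hn
    have h1 : (1 : ℝ) ≤ τ n := le_max_left _ _
    have h2 : Real.log (τ n) ≤ ε * Real.log n * Real.log n := by
      refine (Real.log_le_log (by linarith) hτ).trans (le_of_eq ?_)
      rw [Real.log_rpow (by linarith)]
    rw [Real.norm_of_nonneg (div_nonneg (Real.log_nonneg h1) hlog.le), Real.norm_of_nonneg hlog.le,
      div_le_iff₀ hlog]
    exact h2
  · filter_upwards [hT 1 one_pos, Filter.eventually_ge_atTop 2] with n hn hn2 G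
    have hn1 : (1 : ℝ) < n := by exact_mod_cast (by omega : 1 < n)
    have hlog : 0 < Real.log n := Real.log_pos hn1
    have h1 : (0 : ℝ) < τ n := lt_of_lt_of_le one_pos (le_max_left _ _)
    have hfin : T n ≠ ⊤ := (hn.trans_lt ENNReal.ofReal_lt_top).ne
    have h2 : (n : ℝ) ^ (Real.log (τ n) / Real.log n) = τ n := by
      rw [Real.rpow_def_of_pos (by linarith), mul_div_cancel₀ _ hlog.ne', Real.exp_log h1]
    rw [h2]
    refine (show _ ≤ T n from le_iSup (fun G : SimpleGraph (Fin n) =>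
      expectedTime B (PlantedClique.encodeGraph G)) G).trans ?_
    rw [← ENNReal.ofReal_toReal hfin]
    exact ENNReal.ofReal_le_ofReal (le_max_right _ _)

/-- The distinguisher accepts planted graphs. -/
lemma eventually_planted_accept {A : Prog} {d : ℕ} {δ : ℝ} (hδ : 0 < δ) (hδ' : δ < 1 / 2)
    (hstage : ∀ ε : ℝ, 0 < ε → ∀ᶠ n : ℕ in Filter.atTop, ∀ l : ℕ, ε * lam n ≤ l → ∀ gm,
      stage A d n l gm none ≤ ((n ^ 5 : ℕ) : ℝ≥0∞) * (1 / 2) ^ n) :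
    ∀ᶠ n : ℕ in Filter.atTop, 2 / 3 ≤ expect (PlantedClique.planted n ⌈(n : ℝ) ^ δ⌉₊)
      fun G => mainLaw A d n (PlantedClique.encodeGraph G) (some true) := by
  filter_upwards [eventually_sum_stage_reject_le A d hδ hδ', hstage 1 one_pos,
    eventually_count_le 0] with n hrej hnone hcount
  set μ := PlantedClique.planted n ⌈(n : ℝ) ^ δ⌉₊
  refine two_thirds_le_of_add
    (b := expect μ fun G => mainLaw A d n (PlantedClique.encodeGraph G) (some false))
    (c := expect μ fun G => mainLaw A d n (PlantedClique.encodeGraph G) none) ?_ ?_ ?_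
  · rw [← expect_add, ← expect_add]
    simp only [mainLaw_add, expect_const]
  · refine (expect_mono fun G => mainLaw_some_le A d n _ false).trans ?_
    rw [expect_sum]
    exact hrej
  · have h6 : ((n ^ 5 : ℕ) : ℝ≥0∞) * (1 / 2) ^ n ≤ 1 / 6 := by
      have hlam : 1 ≤ lam n := by simp [lam]
      -- With exponent zero the stage bound is one, so `hcount` reads `n ^ 5 * (11 * lam n) ≤ 2 ^
      -- n`.
      have h1 : n ^ 5 * 6 ≤ 2 ^ n :=
        (Nat.mul_le_mul_left _ (by nlinarith)).trans hcount
      have h2 : ((n ^ 5 : ℕ) : ℝ≥0∞) * 6 ≤ 2 ^ n := by exact_mod_cast h1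
      rw [ENNReal.le_div_iff_mul_le (Or.inl (by simp)) (Or.inl (by simp))]
      calc ((n ^ 5 : ℕ) : ℝ≥0∞) * (1 / 2) ^ n * 6 =
            (((n ^ 5 : ℕ) : ℝ≥0∞) * 6) * (1 / 2) ^ n := by ring
        _ ≤ 2 ^ n * (1 / 2) ^ n := by gcongr
        _ = 1 := by
            rw [← mul_pow, one_div, ENNReal.mul_inv_cancel (by simp) (by simp), one_pow]
    refine le_trans (expect_mono fun G => ?_) ((expect_const μ _).le.trans h6)
    -- The last stage has `l = lam n` and is covered by `hnone`, which was taken at `ε = 1`.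
    have hlam : lam n - 1 < lam n := Nat.sub_lt (by simp [lam]) one_pos
    refine (mainLaw_none_le A d n _ hlam).trans (hnone _ ?_ _)
    rw [one_mul, Nat.sub_add_cancel (by simp [lam])]

/-- The program `B` is built from `A` and the clock exponent `d` only. The numbers `δ` and `ε` occur
in its analysis but not in its text, so one program serves the hypothesised `δ` and all `ε`
simultaneously. -/
theorem not_spch_of_approximation {f : ℕ → ℕ} {g : ℕ → ℝ}
    (hg : g =o[Filter.atTop] fun k : ℕ => Real.sqrt k) {A : Prog} (hf : DSN.RunsInTime A f)
    (hA : DSN.Approximates A g) : ¬ PlantedClique.SPCH := by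
  rintro ⟨δ, hδ, hδ', hno⟩
  obtain ⟨p, hp⟩ := hf
  obtain ⟨d, hd⟩ := exists_clock f p
  obtain ⟨B, D, hB⟩ := exists_distinguisher A d
  have hstage := fun (ε : ℝ) (hε : 0 < ε) => eventually_stage_none_le hp hA hg hd hε
  refine hno ⟨B, runsInTime_of_eventually fun ε hε =>
    eventually_expectedTime_le (fun n G => (hB n G).2) hstage hε, ?_⟩
  filter_upwards [eventually_planted_accept hδ hδ' hstage, eventually_prob_verified_le] with n h1 h2
  rw [acceptProb_eq _ fun G => (hB n G).1, acceptProb_eq _ fun G => (hB n G).1]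
  exact ⟨h1, (expect_mainLaw_erdosRenyi_le A d n).trans h2⟩

end DSNHardness

end

theorem mainTheorem9 (hSPCH : PlantedClique.SPCH) (f : ℕ → ℕ) (g : ℕ → ℝ)
    (hg : g =o[Filter.atTop] fun k : ℕ => Real.sqrt k) :
    ¬ ∃ A : WhileModel.Prog, DSN.RunsInTime A f ∧ DSN.Approximates A g := by
  rintro ⟨A, hf, hA⟩
  exact DSNHardness.not_spch_of_approximation hg hf hA hSPCH
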